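/- **Theorem (Lifts of contrast functions).** All manifolds are finite-dimensional, smooth and Hausdorff; functions, vector fields, tensors and connections are smooth. *Contrast functions.* For a vector field $X$ on a manifold $N$ let ${}^1X$, ${}^2X$ be the vector fields on $N\times N$ equal to $X$ on the first, respectively second, factor, and put $F[X_1\cdots X_k|Y_1\cdots Y_l]={}^1X_1\cdots{}^1X_k\,{}^2Y_1\cdots{}^2Y_l(F)$ and $F^*(x,y)=F(y,x)$ for $F:N\times N\to\mathbb R$. A smooth $F$ is a *contrast function* on $N$ if $F=0$ and $\mathrm dF=0$ on the diagonal and the tensor $g^F(X,Y)(x)=-F[X|Y](x,x)$ is a pseudo-Riemannian metric (symmetric and non-degenerate). It then induces an affine connection $\nabla^F$, its $g^F$-dual connection $(\nabla^F)^*$ and a $(0,3)$-tensor $T^F$ by $$g^F(\nabla^F_XY,Z)(x)=-F[XY|Z](x,x),\quad g^F((\nabla^F)^*_XY,Z)=X\,g^F(Y,Z)-g^F(Y,\nabla^F_XZ),\quad T^F(X,Y,Z)(x)=(F-F^*)[X|YZ](x,x).$$ *Lifts.* Let $r\ge 0$. $T^rM$ is the manifold of $r$-jets $[\gamma]_r$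 at $0$ of smooth curves $\gamma:\mathbb R\to M$; local coordinates $(x^i)$ of $M$ give coordinates $(x^i_\nu)_{0\le\nu\le r}$ of $T^rM$ by $x^i(\gamma(t))=\sum_{\nu\le r}x^i_\nu t^\nu+o(t^r)$. We identify $T^rM\times T^rM$ with $T^r(M\times M)$ by $([\gamma_1]_r,[\gamma_2]_r)\mapsto[(\gamma_1,\gamma_2)]_r$. For a function $f$ and $0\le\lambda\le r$ put $f^{(\lambda)}([\gamma]_r)=\frac1{\lambda!}\frac{\mathrm d^\lambda(f\circ\gamma)}{\mathrm dt^\lambda}(0)$, and $f^{(\lambda)}=0$ for $\lambda<0$. For covariant tensors and vector fields put $$\Big(K_{i_1\dots i_k}\,\mathrm dx^{i_1}\otimes\cdots\otimes \mathrm dx^{i_k}\Big)^{(\lambda)}=\sum_{0\le\mu_1,\dots,\mu_k\le r}(K_{i_1\dots i_k})^{(\lambda-\mu_1-\cdots-\mu_k)}\,\mathrm dx^{i_1}_{\mu_1}\otimes\cdots\otimes \mathrm dx^{i_k}_{\mu_k},\qquad \big(a^i\partial_{x^i}\big)^{(\lambda)}=\sum_{\nu=0}^r(a^i)^{(\nu+\lambda-r)}\partial_{x^i_\nu}.$$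 The complete lift of a function or covariant tensor is $K^c=K^{(r)}$. The complete lift of a connection $\nabla$ on $M$ is the affine connection $\nabla^c$ on $T^rM$ with $\nabla^c_{X^{(\lambda)}}Y^{(\mu)}=(\nabla_XY)^{(\lambda+\mu-r)}$ for all vector fields $X,Y$ on $M$ and all $0\le\lambda,\mu\le r$. *Statement.* Let $F:M\times M\to\mathbb R$ be a contrast function on $M$. Then $F^c:T^r(M\times M)=T^rM\times T^rM\to\mathbb R$ is a contrast function on $T^rM$. The induced objects $g,\nabla,\nabla^*,T$ exist for both $F$ and $F^c$, and $$g^{F^c}=(g^F)^c,\qquad \nabla^{F^c}=(\nabla^F)^c,\qquad (\nabla^{F^c})^*=\big((\nabla^F)^*\big)^c,\qquad T^{F^c}=(T^F)^c .$$ -/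

import Mathlib

open scoped Manifold ContDiff Topology
open Set Filter

noncomputable section

namespace ContrastLift

/-! ### Jets of curves and higher tangent bundles -/

section Jets

variable {E : Type*} [NormedAddCommGroup E] [NormedSpace ℝ E] {H : Type*} [TopologicalSpace H]
  (I : ModelWithCorners ℝ E H) (r : ℕ) (M : Type*) [TopologicalSpace M] [ChartedSpace H M]

/-- Smooth curves `γ : ℝ → M`. -/
abbrev Curve := C^∞⟮𝓘(ℝ, ℝ), ℝ; I, M⟯

/-- Two smooth curves are tangent of order `r` at `t = 0` if, for every smooth function `f` on
`M`, the derivatives of `f ∘ γ₁` and `f ∘ γ₂` at `0` agree up to order `r`. -/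
def jetSetoid : Setoid (Curve I M) where
  r γ₁ γ₂ := ∀ f : C^∞⟮I, M; 𝓘(ℝ, ℝ), ℝ⟯, ∀ l ≤ r,
    iteratedDeriv l (f ∘ γ₁) 0 = iteratedDeriv l (f ∘ γ₂) 0
  iseqv := ⟨fun _ _ _ _ ↦ rfl, fun h f l hl ↦ (h f l hl).symm,
    fun h h' f l hl ↦ (h f l hl).trans (h' f l hl)⟩

/-- The `r`-th order tangent bundle `T^r M`: the set of `r`-jets at `0` of smooth curves in `M`. -/
def HigherTangent := Quotient (jetSetoid I r M)

end Jets

/-- The `r`-jet `[γ]_r` of a smooth curve. -/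
def jet {E : Type*} [NormedAddCommGroup E] [NormedSpace ℝ E] {H : Type*} [TopologicalSpace H]
    {I : ModelWithCorners ℝ E H} (r : ℕ) {M : Type*} [TopologicalSpace M] [ChartedSpace H M]
    (γ : Curve I M) : HigherTangent I r M :=
  Quotient.mk _ γ

section Taylor

variable {V W : Type*} [NormedAddCommGroup V] [NormedSpace ℝ V]
  [NormedAddCommGroup W] [NormedSpace ℝ W]

/-- The `k`-th Taylor coefficient `(1/k!) c⁽ᵏ⁾(0)` of `c` at `0`, equal to `0` for negative `k`. -/
def taylorCoeff (k : ℤ) (c : ℝ → V) : V :=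
  if k < 0 then 0 else ((k.toNat.factorial : ℝ))⁻¹ • iteratedDeriv k.toNat c 0

lemma taylorCoeff_natCast (k : ℕ) (c : ℝ → V) :
    taylorCoeff k c = ((k.factorial : ℝ))⁻¹ • iteratedDeriv k c 0 := by
  simp [taylorCoeff]

/-- The polynomial curve `t ↦ x₀ + x₁ t + ⋯ + x_r t^r`. -/
def polyCurve {r : ℕ} (x : Fin (r + 1) → V) (t : ℝ) : V := ∑ ν : Fin (r + 1), t ^ (ν : ℕ) • x ν

lemma contDiff_polyCurve {r : ℕ} (x : Fin (r + 1) → V) : ContDiff ℝ ∞ (polyCurve x) := by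
  unfold polyCurve; fun_prop

@[simp] lemma polyCurve_zero {r : ℕ} (x : Fin (r + 1) → V) : polyCurve x 0 = x 0 := by
  rw [polyCurve, Fin.sum_univ_succ]; simp

lemma iteratedDeriv_polyCurve {r : ℕ} (x : Fin (r + 1) → V) (k : ℕ) :
    iteratedDeriv k (polyCurve x) 0 =
      if h : k < r + 1 then (k.factorial : ℝ) • x ⟨k, h⟩ else 0 := by
  have h1 : polyCurve x = fun t ↦ ∑ ν : Fin (r + 1), t ^ (ν : ℕ) • x ν := rfl
  have h2 : ∀ ν : Fin (r + 1), iteratedDeriv k (fun t : ℝ ↦ t ^ (ν : ℕ) • x ν) 0 =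
      if k = (ν : ℕ) then (k.factorial : ℝ) • x ν else 0 := by
    intro ν
    rw [iteratedDeriv_smul_const (by fun_prop), iteratedDeriv_fun_pow_zero]
    split_ifs with h
    · rw [h]
    · simp
  rw [h1, iteratedDeriv_fun_sum (fun i _ ↦ by fun_prop)]
  simp only [h2]
  split_ifs with h
  · rw [Finset.sum_eq_single ⟨k, h⟩]
    · simp
    · intro b _ hb
      rw [if_neg]
      rintro rfl
      exact hb rfl
    · simp
  · apply Finset.sum_eq_zero
    intro ν _
    rw [if_neg]
    have := ν.2
    omega

lemma natCast_le_infty (l : ℕ) : (l : ℕ∞ω) ≤ ∞ := by exact_mod_cast le_top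

lemma iteratedDeriv_comp_congr {g : V → W} {c₁ c₂ : ℝ → V} {r l : ℕ}
    (hg : ContDiffAt ℝ ∞ g (c₁ 0)) (h₁ : ContDiffAt ℝ ∞ c₁ 0) (h₂ : ContDiffAt ℝ ∞ c₂ 0)
    (h : ∀ k ≤ r, iteratedDeriv k c₁ 0 = iteratedDeriv k c₂ 0) (hl : l ≤ r) :
    iteratedDeriv l (g ∘ c₁) 0 = iteratedDeriv l (g ∘ c₂) 0 := by
  have h0 : c₁ 0 = c₂ 0 := by simpa using h 0 (Nat.zero_le _)
  rw [iteratedDeriv_vcomp_eq_sum_orderedFinpartition hg h₁ (natCast_le_infty l),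
    iteratedDeriv_vcomp_eq_sum_orderedFinpartition (h0 ▸ hg) h₂ (natCast_le_infty l), h0]
  refine Finset.sum_congr rfl fun c _ ↦ ?_
  congr 1
  funext j
  exact h _ ((c.partSize_le j).trans hl)

lemma contDiffOn_iteratedDeriv_polyCurve {g : V → W} {U : Set V} (hU : IsOpen U)
    (hg : ContDiffOn ℝ ∞ g U) (r l : ℕ) :
    ContDiffOn ℝ ∞ (fun x : Fin (r + 1) → V ↦ iteratedDeriv l (g ∘ polyCurve x) 0)
      {x | x 0 ∈ U} := by
  have hgx : ∀ y ∈ U, ContDiffAt ℝ ∞ g y := fun y hy ↦ hg.contDiffAt (hU.mem_nhds hy)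
  have key : ContDiffOn ℝ ∞ (fun x : Fin (r + 1) → V ↦ ∑ c : OrderedFinpartition l,
      iteratedFDeriv ℝ c.length g (x 0) fun j ↦ iteratedDeriv (c.partSize j) (polyCurve x) 0)
      {x | x 0 ∈ U} := by
    refine ContDiffOn.sum fun c _ x hx ↦ ContDiffAt.contDiffWithinAt ?_
    have h1 : ContDiffAt ℝ ∞ (fun x : Fin (r + 1) → V ↦ iteratedFDeriv ℝ c.length g (x 0)) x := by
      have : ContDiffAt ℝ ∞ (iteratedFDeriv ℝ c.length g) (x 0) :=
        (hgx _ hx).iteratedFDeriv_right (m := ∞) (by exact_mod_cast le_top)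
      exact this.comp x (contDiff_apply ℝ V (0 : Fin (r + 1))).contDiffAt
    have h2 : ContDiffAt ℝ ∞ (fun (x : Fin (r + 1) → V) (j : Fin c.length) ↦
        iteratedDeriv (c.partSize j) (polyCurve x) 0) x := by
      rw [contDiffAt_pi]
      intro j
      simp only [iteratedDeriv_polyCurve]
      split_ifs with h
      · exact (contDiff_const.smul (contDiff_apply ℝ V _)).contDiffAt
      · exact contDiffAt_const
    exact ((ContinuousLinearMap.id ℝ
      (V [×c.length]→L[ℝ] W)).cpolynomialAt_uncurry_of_multilinear.contDiffAt).comp x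
        (h1.prodMk h2)
  refine key.congr fun x hx ↦ ?_
  have hx' : ContDiffAt ℝ ∞ g (polyCurve x 0) := by
    rw [polyCurve_zero]; exact hgx _ hx
  rw [iteratedDeriv_vcomp_eq_sum_orderedFinpartition hx' (contDiff_polyCurve x).contDiffAt
    (natCast_le_infty l), polyCurve_zero]

end Taylor

/-! ### The manifold structure of `T^r M` -/

section AdaptedCharts

variable {E : Type*} [NormedAddCommGroup E] [NormedSpace ℝ E]
  {M : Type*} [TopologicalSpace M] [ChartedSpace E M] [IsManifold 𝓘(ℝ, E) ∞ M]

lemma Curve.contDiffAt_chart {e : OpenPartialHomeomorph M E} (he : e ∈ atlas E M)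
    (γ : Curve 𝓘(ℝ, E) M) (hγ : γ 0 ∈ e.source) : ContDiffAt ℝ ∞ (e ∘ γ) 0 := by
  rw [← contMDiffAt_iff_contDiffAt]
  exact (contMDiffAt_of_mem_maximalAtlas
    (IsManifold.subset_maximalAtlas he) hγ).comp (0 : ℝ) γ.contMDiff.contMDiffAt

lemma jet_of_chart_eq {r : ℕ} {γ₁ γ₂ : Curve 𝓘(ℝ, E) M} (h0 : γ₁ 0 = γ₂ 0)
    {e : OpenPartialHomeomorph M E} (he : e ∈ atlas E M) (hγ : γ₁ 0 ∈ e.source)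
    (h : ∀ l ≤ r, iteratedDeriv l (e ∘ γ₁) 0 = iteratedDeriv l (e ∘ γ₂) 0) :
    (jetSetoid 𝓘(ℝ, E) r M).r γ₁ γ₂ := by
  intro f l hl
  have key : ∀ γ : Curve 𝓘(ℝ, E) M, γ 0 ∈ e.source →
      iteratedDeriv l (f ∘ γ) 0 = iteratedDeriv l ((f ∘ e.symm) ∘ (e ∘ γ)) 0 := by
    intro γ h0
    refine Filter.EventuallyEq.iteratedDeriv_eq l ?_
    filter_upwards [γ.contMDiff.continuous.continuousAt (e.open_source.mem_nhds h0)] with t ht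
    simp [e.left_inv ht]
  have hγ' : γ₂ 0 ∈ e.source := h0 ▸ hγ
  rw [key _ hγ, key _ hγ']
  refine iteratedDeriv_comp_congr ?_ (γ₁.contDiffAt_chart he hγ) (γ₂.contDiffAt_chart he hγ') h hl
  rw [← contMDiffAt_iff_contDiffAt]
  exact f.contMDiff.contMDiffAt.comp _ (contMDiffAt_symm_of_mem_maximalAtlas
    (IsManifold.subset_maximalAtlas he) (e.map_source hγ))

lemma exists_curve_of_poly {r : ℕ} {e : OpenPartialHomeomorph M E} (he : e ∈ atlas E M)
    (x : Fin (r + 1) → E) (hx : x 0 ∈ e.target) :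
    ∃ γ : Curve 𝓘(ℝ, E) M, γ =ᶠ[𝓝 0] e.symm ∘ polyCurve x := by
  have hc : polyCurve x ⁻¹' e.target ∈ 𝓝 (0 : ℝ) :=
    (contDiff_polyCurve x).continuous.continuousAt
      (e.open_target.mem_nhds (by rwa [polyCurve_zero]))
  obtain ⟨δ, hδ, hball⟩ := Metric.mem_nhds_iff.1 hc
  let χ : ContDiffBump (0 : ℝ) := ⟨δ / 3, δ / 2, by positivity, by linarith⟩
  let s : ℝ → ℝ := fun t ↦ χ t * t
  have hs : ContDiff ℝ ∞ s := χ.contDiff.mul contDiff_id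
  have hsball : ∀ t, s t ∈ Metric.ball (0 : ℝ) δ := by
    intro t
    rw [mem_ball_zero_iff, Real.norm_eq_abs, abs_mul, abs_of_nonneg χ.nonneg]
    by_cases ht : t ∈ Metric.ball (0 : ℝ) (δ / 2)
    · rw [mem_ball_zero_iff, Real.norm_eq_abs] at ht
      nlinarith [abs_nonneg t, χ.le_one (x := t), χ.nonneg (x := t)]
    · have : χ t = 0 := χ.zero_of_le_dist (not_lt.1 ht)
      simpa [this] using hδ
  refine ⟨⟨fun t ↦ e.symm (polyCurve x (s t)), ?_⟩, ?_⟩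
  · intro t
    refine (contMDiffAt_symm_of_mem_maximalAtlas (IsManifold.subset_maximalAtlas he)
      (hball (hsball t))).comp t ?_
    exact ((contDiff_polyCurve x).comp hs).contMDiff.contMDiffAt
  · filter_upwards [χ.eventuallyEq_one] with t ht
    have h1 : s t = t := by simp [s, ht]
    change e.symm (polyCurve x (s t)) = _
    rw [h1]
    rfl

open Classical in
/-- The jet of the curve whose expression in the chart `e` is the polynomial curve with
coefficients `x` (a constant jet if `x₀` is not in the target of `e`). -/
def polyJet (r : ℕ) {e : OpenPartialHomeomorph M E} (he : e ∈ atlas E M) (x : Fin (r + 1) → E) :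
    HigherTangent 𝓘(ℝ, E) r M :=
  if hx : x 0 ∈ e.target then jet r (exists_curve_of_poly he x hx).choose
  else jet r ⟨fun _ ↦ e.symm (x 0), contMDiff_const⟩

lemma polyJet_spec {r : ℕ} {e : OpenPartialHomeomorph M E} (he : e ∈ atlas E M)
    {x : Fin (r + 1) → E} (hx : x 0 ∈ e.target) :
    ∃ γ : Curve 𝓘(ℝ, E) M, polyJet r he x = jet r γ ∧ γ 0 = e.symm (x 0) ∧
      γ =ᶠ[𝓝 0] e.symm ∘ polyCurve x ∧ e ∘ γ =ᶠ[𝓝 0] polyCurve x := by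
  have hc := (exists_curve_of_poly he x hx).choose_spec
  refine ⟨(exists_curve_of_poly he x hx).choose, by rw [polyJet, dif_pos hx], ?_, hc, ?_⟩
  · rw [hc.eq_of_nhds, Function.comp, polyCurve_zero]
  · have h2 := (contDiff_polyCurve x).continuous.continuousAt
      (x := 0) (e.open_target.mem_nhds (by rwa [polyCurve_zero]))
    filter_upwards [hc, h2] with t ht ht'
    simp only [Function.comp, ht]
    exact e.right_inv ht'

variable [FiniteDimensional ℝ E] [T2Space M]

lemma exists_smooth_extension {c : M} {U : Set M} (hU : U ∈ 𝓝 c) {g : M → ℝ}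
    (hg : ContMDiffOn 𝓘(ℝ, E) 𝓘(ℝ, ℝ) ∞ g U) :
    ∃ f : C^∞⟮𝓘(ℝ, E), M; 𝓘(ℝ, ℝ), ℝ⟯, (f : M → ℝ) =ᶠ[𝓝 c] g := by
  obtain ⟨V, hVU, hVo, hcV⟩ := mem_nhds_iff.1 hU
  obtain ⟨ψ, -, hψ⟩ := (SmoothBumpFunction.nhds_basis_tsupport (I := 𝓘(ℝ, E)) c).mem_iff.1
    (hVo.mem_nhds hcV)
  refine ⟨⟨fun x ↦ ψ x • g x, contMDiff_of_tsupport fun x hx ↦ ?_⟩, ?_⟩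
  · have hxV : x ∈ V := hψ (tsupport_smul_subset_left _ _ hx)
    exact ψ.contMDiffAt.smul ((hg.mono hVU).contMDiffAt (hVo.mem_nhds hxV))
  · filter_upwards [ψ.eventuallyEq_one] with x hx
    simp [hx]

lemma jet_base_eq {r : ℕ} {γ₁ γ₂ : Curve 𝓘(ℝ, E) M}
    (h : (jetSetoid 𝓘(ℝ, E) r M).r γ₁ γ₂) : γ₁ 0 = γ₂ 0 := by
  by_contra hne
  obtain ⟨ψ, -, hψ⟩ := (SmoothBumpFunction.nhds_basis_tsupport (I := 𝓘(ℝ, E)) (γ₁ 0)).mem_iff.1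
    (isOpen_compl_singleton.mem_nhds hne)
  have h1 := h ⟨ψ, ψ.contMDiff⟩ 0 (Nat.zero_le _)
  simp only [iteratedDeriv_zero, Function.comp, ContMDiffMap.coeFn_mk, ψ.eq_one] at h1
  have h2 : ψ (γ₂ 0) = 0 := by
    by_contra h3
    exact hψ (subset_tsupport _ h3) rfl
  rw [h2] at h1
  exact one_ne_zero h1

lemma jet_chart_eq {r : ℕ} {γ₁ γ₂ : Curve 𝓘(ℝ, E) M}
    (h : (jetSetoid 𝓘(ℝ, E) r M).r γ₁ γ₂) {e : OpenPartialHomeomorph M E} (he : e ∈ atlas E M)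
    (hγ : γ₁ 0 ∈ e.source) {l : ℕ} (hl : l ≤ r) :
    iteratedDeriv l (e ∘ γ₁) 0 = iteratedDeriv l (e ∘ γ₂) 0 := by
  have hγ' : γ₂ 0 ∈ e.source := jet_base_eq h ▸ hγ
  refine (SeparatingDual.eq_iff_forall_dual_eq (R := ℝ)).2 fun φ ↦ ?_
  have hφ : ∀ γ : Curve 𝓘(ℝ, E) M, γ 0 ∈ e.source →
      iteratedDeriv l (φ ∘ e ∘ γ) 0 = φ (iteratedDeriv l (e ∘ γ) 0) := by
    intro γ h0
    simp only [iteratedDeriv]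
    rw [φ.iteratedFDeriv_comp_left (γ.contDiffAt_chart he h0) (natCast_le_infty l)]
    rfl
  obtain ⟨f, hf⟩ := exists_smooth_extension (E := E) (e.open_source.mem_nhds hγ) (g := φ ∘ e)
    (φ.contMDiff.comp_contMDiffOn (contMDiffOn_of_mem_maximalAtlas
      (IsManifold.subset_maximalAtlas he)))
  rw [← hφ _ hγ, ← hφ _ hγ']
  have key : ∀ γ : Curve 𝓘(ℝ, E) M, γ 0 = γ₁ 0 →
      iteratedDeriv l (f ∘ γ) 0 = iteratedDeriv l (φ ∘ e ∘ γ) 0 := by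
    intro γ h0
    refine Filter.EventuallyEq.iteratedDeriv_eq l ?_
    have hc : Tendsto γ (𝓝 0) (𝓝 (γ₁ 0)) := h0 ▸ γ.contMDiff.continuous.continuousAt
    exact hc.eventually hf
  rw [← key _ rfl, ← key _ (jet_base_eq h).symm]
  exact h f l hl

/-- The projection `T^r M → M`, `[γ]_r ↦ γ(0)`. -/
def HigherTangent.base {r : ℕ} : HigherTangent 𝓘(ℝ, E) r M → M :=
  Quotient.lift (fun γ ↦ γ 0) fun _ _ h ↦ jet_base_eq h

@[simp] lemma base_jet {r : ℕ} (γ : Curve 𝓘(ℝ, E) M) : (jet r γ).base = γ 0 := rfl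

open Classical in
/-- The adapted coordinates `x_ν([γ]_r)`, `ν = 0, …, r`, on `T^r M` defined by a chart `e` of `M`:
`e(γ(t)) = x₀ + x₁ t + ⋯ + x_r t^r + o(t^r)`. -/
def adaptedCoord (r : ℕ) {e : OpenPartialHomeomorph M E} (he : e ∈ atlas E M) :
    HigherTangent 𝓘(ℝ, E) r M → Fin (r + 1) → E :=
  Quotient.lift
    (fun γ ν ↦ if γ 0 ∈ e.source then taylorCoeff (ν : ℕ) (e ∘ γ) else 0) (by
    intro γ₁ γ₂ h
    funext ν
    simp only [← jet_base_eq h]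
    split_ifs with h0
    · rw [taylorCoeff_natCast, taylorCoeff_natCast,
        jet_chart_eq h he h0 (Nat.lt_succ_iff.1 ν.2)]
    · rfl)

open Classical in
lemma adaptedCoord_jet {r : ℕ} {e : OpenPartialHomeomorph M E} (he : e ∈ atlas E M)
    {γ : Curve 𝓘(ℝ, E) M} (hγ : γ 0 ∈ e.source) (ν : Fin (r + 1)) :
    adaptedCoord r he (jet r γ) ν = (((ν : ℕ).factorial : ℝ))⁻¹ • iteratedDeriv ν (e ∘ γ) 0 := by
  change (if γ 0 ∈ e.source then taylorCoeff ((ν : ℕ) : ℤ) (e ∘ γ) else 0) = _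
  rw [if_pos hγ, taylorCoeff_natCast]

lemma adaptedCoord_jet_zero {r : ℕ} {e : OpenPartialHomeomorph M E} (he : e ∈ atlas E M)
    {γ : Curve 𝓘(ℝ, E) M} (hγ : γ 0 ∈ e.source) :
    adaptedCoord r he (jet r γ) 0 = e (γ 0) := by
  rw [adaptedCoord_jet he hγ]; simp

/-- The adapted chart of `T^r M` defined by a chart `e` of `M`. -/
def adaptedChart (r : ℕ) {e : OpenPartialHomeomorph M E} (he : e ∈ atlas E M) :
    PartialEquiv (HigherTangent 𝓘(ℝ, E) r M) (Fin (r + 1) → E) where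
  toFun := adaptedCoord r he
  invFun := polyJet r he
  source := {p | p.base ∈ e.source}
  target := {x | x 0 ∈ e.target}
  map_source' := by
    rintro ⟨γ⟩ hp
    change adaptedCoord r he (jet r γ) 0 ∈ e.target
    rw [adaptedCoord_jet_zero he hp]
    exact e.map_source hp
  map_target' := by
    intro x hx
    obtain ⟨γ, hγ, h0, -⟩ := polyJet_spec he hx
    change (polyJet r he x).base ∈ e.source
    rw [hγ, base_jet, h0]
    exact e.map_target hx
  left_inv' := by
    rintro ⟨γ⟩ hp
    change γ 0 ∈ e.source at hp
    change polyJet r he (adaptedCoord r he (jet r γ)) = jet r γ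
    have hx0 := adaptedCoord_jet_zero (r := r) he hp
    obtain ⟨γ', hγ', h0, -, h1⟩ := polyJet_spec (x := adaptedCoord r he (jet r γ)) he
      (hx0 ▸ e.map_source hp)
    rw [hx0, e.left_inv hp] at h0
    rw [hγ']
    refine Quotient.sound (jet_of_chart_eq h0 he (h0 ▸ hp) fun l hl ↦ ?_)
    rw [h1.iteratedDeriv_eq, iteratedDeriv_polyCurve, dif_pos (Nat.lt_succ_iff.2 hl),
      adaptedCoord_jet he hp, smul_smul, mul_inv_cancel₀ (by positivity), one_smul]
  right_inv' := by
    intro x hx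
    obtain ⟨γ', hγ', h0, -, h1⟩ := polyJet_spec he hx
    funext ν
    rw [hγ', adaptedCoord_jet he (h0 ▸ e.map_target hx), h1.iteratedDeriv_eq,
      iteratedDeriv_polyCurve, dif_pos ν.2, smul_smul, inv_mul_cancel₀ (by positivity), one_smul]

lemma adaptedChart_transition (r : ℕ) {e e' : OpenPartialHomeomorph M E} (he : e ∈ atlas E M)
    (he' : e' ∈ atlas E M) :
    IsOpen ((adaptedChart r he).symm.trans (adaptedChart r he')).source ∧
      ContDiffOn ℝ ∞ ((adaptedChart r he).symm.trans (adaptedChart r he'))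
        ((adaptedChart r he).symm.trans (adaptedChart r he')).source := by
  have hsrc : ((adaptedChart r he).symm.trans (adaptedChart r he')).source =
      {x | x 0 ∈ (e.symm.trans e').source} := by
    ext x
    change (x 0 ∈ e.target ∧ (polyJet r he x).base ∈ e'.source) ↔
      (x 0 ∈ e.target ∧ e.symm (x 0) ∈ e'.source)
    refine and_congr_right fun hx ↦ ?_
    obtain ⟨γ, hγ, h0, -⟩ := polyJet_spec he hx
    rw [hγ, base_jet, h0]
  rw [hsrc]
  refine ⟨(e.symm.trans e').open_source.preimage (continuous_apply 0), ?_⟩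
  rw [contDiffOn_pi]
  intro ν
  have hg : ContDiffOn ℝ ∞ (e.symm.trans e') (e.symm.trans e').source := by
    rw [← contMDiffOn_iff_contDiffOn]
    exact (contMDiffOn_of_mem_maximalAtlas (IsManifold.subset_maximalAtlas he')).comp
      ((contMDiffOn_symm_of_mem_maximalAtlas (IsManifold.subset_maximalAtlas he)).mono
        (by intro x hx; exact hx.1)) (by intro x hx; exact hx.2)
  refine ((contDiffOn_iteratedDeriv_polyCurve (e.symm.trans e').open_source hg r
    ν).const_smul (((ν : ℕ).factorial : ℝ))⁻¹).congr fun x hx ↦ ?_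
  obtain ⟨γ, hγ, h0, hc, -⟩ := polyJet_spec he hx.1
  have h0' : γ 0 ∈ e'.source := h0 ▸ hx.2
  change adaptedCoord r he' (polyJet r he x) ν = _
  rw [hγ, adaptedCoord_jet he' h0', (hc.fun_comp e').iteratedDeriv_eq]
  rfl

variable (E M) in
/-- The atlas of adapted charts of `T^r M`. -/
def adaptedCore (r : ℕ) : ChartedSpaceCore (Fin (r + 1) → E) (HigherTangent 𝓘(ℝ, E) r M) where
  atlas := {ê | ∃ (e : OpenPartialHomeomorph M E) (he : e ∈ atlas E M), ê = adaptedChart r he}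
  chartAt p := adaptedChart r (chart_mem_atlas E p.base)
  mem_chart_source p := mem_chart_source E p.base
  chart_mem_atlas p := ⟨_, _, rfl⟩
  open_source := by
    rintro _ _ ⟨e, he, rfl⟩ ⟨e', he', rfl⟩
    exact (adaptedChart_transition r he he').1
  continuousOn_toFun := by
    rintro _ _ ⟨e, he, rfl⟩ ⟨e', he', rfl⟩
    exact (adaptedChart_transition r he he').2.continuousOn

instance instTopologicalSpaceHigherTangent (r : ℕ) :
    TopologicalSpace (HigherTangent 𝓘(ℝ, E) r M) :=
  (adaptedCore E M r).toTopologicalSpace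

instance instChartedSpaceHigherTangent (r : ℕ) :
    ChartedSpace (Fin (r + 1) → E) (HigherTangent 𝓘(ℝ, E) r M) :=
  (adaptedCore E M r).toChartedSpace

instance instIsManifoldHigherTangent (r : ℕ) :
    IsManifold 𝓘(ℝ, Fin (r + 1) → E) ∞ (HigherTangent 𝓘(ℝ, E) r M) := by
  refine isManifold_of_contDiffOn _ _ _ ?_
  intro f f' hf hf'
  obtain ⟨_, ⟨⟨_, rfl⟩, _, ⟨⟨e, he, rfl⟩, rfl⟩, hfe⟩⟩ := hf
  obtain ⟨_, ⟨⟨_, rfl⟩, _, ⟨⟨e', he', rfl⟩, rfl⟩, hfe'⟩⟩ := hf'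
  rw [mem_singleton_iff] at hfe hfe'
  subst hfe hfe'
  have h := (adaptedChart_transition r he he').2
  refine h.mono ?_
  exact fun x hx ↦ hx.1

end AdaptedCharts

/-! ### Lifts of functions and the identification `T^r (M × M) = T^r M × T^r M` -/

section FunctionLifts

variable {E : Type*} [NormedAddCommGroup E] [NormedSpace ℝ E] {H : Type*} [TopologicalSpace H]
  {I : ModelWithCorners ℝ E H} {M : Type*} [TopologicalSpace M] [ChartedSpace H M]
  {E' : Type*} [NormedAddCommGroup E'] [NormedSpace ℝ E'] {H' : Type*} [TopologicalSpace H']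
  {I' : ModelWithCorners ℝ E' H'} {M' : Type*} [TopologicalSpace M'] [ChartedSpace H' M']

/-- The `l`-lift `f^(l)([γ]_r) = (1/l!) (d/dt)^l (f ∘ γ)(0)`, `0 ≤ l ≤ r`, of a smooth function. -/
def functionLift (r l : ℕ) (hl : l ≤ r) (f : C^∞⟮I, M; 𝓘(ℝ, ℝ), ℝ⟯) : HigherTangent I r M → ℝ :=
  Quotient.lift (fun γ ↦ taylorCoeff l (f ∘ γ)) fun γ₁ γ₂ h ↦ by
    rw [taylorCoeff_natCast, taylorCoeff_natCast, h f l hl]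

/-- The map `T^r g : T^r M → T^r M'`, `[γ]_r ↦ [g ∘ γ]_r`. -/
def jetMap (r : ℕ) (g : C^∞⟮I, M; I', M'⟯) : HigherTangent I r M → HigherTangent I' r M' :=
  Quotient.map (fun γ ↦ g.comp γ) fun _ _ h f l hl ↦ h (f.comp g) l hl

variable {V : Type*} [NormedAddCommGroup V] [NormedSpace ℝ V] [FiniteDimensional ℝ V]
  {N : Type*} [TopologicalSpace N] [ChartedSpace V N] [IsManifold 𝓘(ℝ, V) ∞ N] [T2Space N]

lemma jet_prodMk_eq {r : ℕ} {γ₁ γ₁' γ₂ γ₂' : Curve 𝓘(ℝ, V) N}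
    (h₁ : (jetSetoid 𝓘(ℝ, V) r N).r γ₁ γ₁') (h₂ : (jetSetoid 𝓘(ℝ, V) r N).r γ₂ γ₂') :
    (jetSetoid (𝓘(ℝ, V).prod 𝓘(ℝ, V)) r (N × N)).r (γ₁.prodMk γ₂) (γ₁'.prodMk γ₂') := by
  intro f l hl
  set e₁ := chartAt V (γ₁ 0)
  set e₂ := chartAt V (γ₂ 0)
  have he₁ : e₁ ∈ atlas V N := chart_mem_atlas _ _
  have he₂ : e₂ ∈ atlas V N := chart_mem_atlas _ _
  have hs₁ : γ₁ 0 ∈ e₁.source := mem_chart_source _ _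
  have hs₂ : γ₂ 0 ∈ e₂.source := mem_chart_source _ _
  have hs₁' : γ₁' 0 ∈ e₁.source := jet_base_eq h₁ ▸ hs₁
  have hs₂' : γ₂' 0 ∈ e₂.source := jet_base_eq h₂ ▸ hs₂
  let g : V × V → ℝ := fun z ↦ f (e₁.symm z.1, e₂.symm z.2)
  have key : ∀ c₁ c₂ : Curve 𝓘(ℝ, V) N, c₁ 0 ∈ e₁.source → c₂ 0 ∈ e₂.source →
      iteratedDeriv l (f ∘ (c₁.prodMk c₂)) 0 =
        iteratedDeriv l (g ∘ fun t ↦ ((e₁ ∘ c₁) t, (e₂ ∘ c₂) t)) 0 := by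
    intro c₁ c₂ hc₁ hc₂
    refine Filter.EventuallyEq.iteratedDeriv_eq l ?_
    filter_upwards [c₁.contMDiff.continuous.continuousAt (e₁.open_source.mem_nhds hc₁),
      c₂.contMDiff.continuous.continuousAt (e₂.open_source.mem_nhds hc₂)] with t ht₁ ht₂
    change f (c₁ t, c₂ t) = f (e₁.symm (e₁ (c₁ t)), e₂.symm (e₂ (c₂ t)))
    rw [e₁.left_inv ht₁, e₂.left_inv ht₂]
  have hd : ∀ (c₁ c₂ : ℝ → V) (k : ℕ), ContDiffAt ℝ ∞ c₁ 0 → ContDiffAt ℝ ∞ c₂ 0 →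
      iteratedDeriv k (fun t ↦ (c₁ t, c₂ t)) 0 = (iteratedDeriv k c₁ 0, iteratedDeriv k c₂ 0) := by
    intro c₁ c₂ k hc₁ hc₂
    simp only [iteratedDeriv]
    rw [iteratedFDeriv_prodMk hc₁ hc₂ (natCast_le_infty k)]
    rfl
  have hg : ContDiffAt ℝ ∞ g (e₁ (γ₁ 0), e₂ (γ₂ 0)) := by
    rw [← contMDiffAt_iff_contDiffAt]
    refine f.contMDiff.contMDiffAt.comp (e₁ (γ₁ 0), e₂ (γ₂ 0)) (ContMDiffAt.prodMk ?_ ?_)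
    · exact (contMDiffAt_symm_of_mem_maximalAtlas (IsManifold.subset_maximalAtlas he₁)
        (e₁.map_source hs₁)).comp (e₁ (γ₁ 0), e₂ (γ₂ 0)) contDiff_fst.contMDiff.contMDiffAt
    · exact (contMDiffAt_symm_of_mem_maximalAtlas (IsManifold.subset_maximalAtlas he₂)
        (e₂.map_source hs₂)).comp (e₁ (γ₁ 0), e₂ (γ₂ 0)) contDiff_snd.contMDiff.contMDiffAt
  rw [key _ _ hs₁ hs₂, key _ _ hs₁' hs₂']
  have d₁ := γ₁.contDiffAt_chart he₁ hs₁
  have d₂ := γ₂.contDiffAt_chart he₂ hs₂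
  have d₁' := γ₁'.contDiffAt_chart he₁ hs₁'
  have d₂' := γ₂'.contDiffAt_chart he₂ hs₂'
  refine iteratedDeriv_comp_congr (r := r) hg (d₁.prodMk d₂) (d₁'.prodMk d₂') (fun k hk ↦ ?_) hl
  rw [hd _ _ k d₁ d₂, hd _ _ k d₁' d₂', jet_chart_eq h₁ he₁ hs₁ hk, jet_chart_eq h₂ he₂ hs₂ hk]

variable (V N) in
/-- The canonical identification `T^r N × T^r N = T^r (N × N)`, `([γ₁]_r, [γ₂]_r) ↦ [(γ₁, γ₂)]_r`. -/
def jetProd (r : ℕ) : HigherTangent 𝓘(ℝ, V) r N × HigherTangent 𝓘(ℝ, V) r N ≃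
    HigherTangent (𝓘(ℝ, V).prod 𝓘(ℝ, V)) r (N × N) where
  toFun z := Quotient.map₂ (fun γ₁ γ₂ ↦ γ₁.prodMk γ₂) (fun _ _ h₁ _ _ h₂ ↦ jet_prodMk_eq h₁ h₂)
    z.1 z.2
  invFun p := (jetMap r ContMDiffMap.fst p, jetMap r ContMDiffMap.snd p)
  left_inv := by
    rintro ⟨⟨γ₁⟩, ⟨γ₂⟩⟩
    rfl
  right_inv := by
    rintro ⟨γ⟩
    rfl

/-- The complete lift `F^c : T^r (N × N) = T^r N × T^r N → ℝ` of a two-point function `F`. -/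
def contrastLift (r : ℕ) (F : C^∞⟮𝓘(ℝ, V).prod 𝓘(ℝ, V), N × N; 𝓘(ℝ, ℝ), ℝ⟯) :
    HigherTangent 𝓘(ℝ, V) r N × HigherTangent 𝓘(ℝ, V) r N → ℝ :=
  fun z ↦ functionLift r r le_rfl F (jetProd V N r z)

end FunctionLifts

/-! ### Contrast functions and the structures they induce -/

section Contrast

variable {V : Type*} [NormedAddCommGroup V] [NormedSpace ℝ V]
  {N : Type*} [TopologicalSpace N] [ChartedSpace V N]

variable (V N) in
/-- (Not necessarily smooth) vector fields on `N`. -/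
abbrev Field := ∀ x : N, TangentSpace 𝓘(ℝ, V) x

variable (V N) in
/-- (Not necessarily smooth) tensor fields of type `(0, k)` on `N`. -/
abbrev CovTensor (k : ℕ) :=
  ∀ x : N, ContinuousMultilinearMap ℝ (fun _ : Fin k ↦ TangentSpace 𝓘(ℝ, V) x) ℝ

/-- The expression of a vector field in a chart. -/
def Field.inChart (X : Field V N) (e : OpenPartialHomeomorph N V) (y : V) : V :=
  mfderiv 𝓘(ℝ, V) 𝓘(ℝ, V) e (e.symm y) (X (e.symm y))

/-- The expression of a covariant tensor field in a chart. -/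
def CovTensor.inChart {k : ℕ} (K : CovTensor V N k) (e : OpenPartialHomeomorph N V) (y : V) :
    V [×k]→L[ℝ] ℝ :=
  (K (e.symm y)).compContinuousLinearMap fun _ ↦ mfderiv 𝓘(ℝ, V) 𝓘(ℝ, V) e.symm y

/-- A covariant tensor field is smooth if its components in all charts of the atlas are. -/
def CovTensor.IsSmooth {k : ℕ} (K : CovTensor V N k) : Prop :=
  ∀ e ∈ atlas V N, ContDiffOn ℝ ∞ (K.inChart e) e.target

/-- Pseudo-Riemannian metrics: smooth, symmetric, non-degenerate `(0, 2)`-tensor fields. -/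
structure IsPseudoRiemannian (g : CovTensor V N 2) : Prop where
  smooth : g.IsSmooth
  symm : ∀ (x : N) (u v : TangentSpace 𝓘(ℝ, V) x), g x ![u, v] = g x ![v, u]
  nondegenerate : ∀ (x : N) (u : TangentSpace 𝓘(ℝ, V) x), (∀ v, g x ![u, v] = 0) → u = 0

/-- The vector field `¹X` on `N × N`, equal to `X` on the left factor. -/
def leftField (X : Field V N) : ∀ z : N × N, TangentSpace (𝓘(ℝ, V).prod 𝓘(ℝ, V)) z :=
  fun z ↦ ((X z.1, 0) : TangentSpace 𝓘(ℝ, V) z.1 × TangentSpace 𝓘(ℝ, V) z.2)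

/-- The vector field `²X` on `N × N`, equal to `X` on the right factor. -/
def rightField (X : Field V N) : ∀ z : N × N, TangentSpace (𝓘(ℝ, V).prod 𝓘(ℝ, V)) z :=
  fun z ↦ ((0, X z.2) : TangentSpace 𝓘(ℝ, V) z.1 × TangentSpace 𝓘(ℝ, V) z.2)

/-- The derivative `Z(F)` of a function on `N × N` along a vector field. -/
def along (Z : ∀ z : N × N, TangentSpace (𝓘(ℝ, V).prod 𝓘(ℝ, V)) z) (F : N × N → ℝ) : N × N → ℝ :=
  fun z ↦ mvfderiv (𝓘(ℝ, V).prod 𝓘(ℝ, V)) F z (Z z)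

/-- `F[X₁ ⋯ X_k | Y₁ ⋯ Y_l] = ¹X₁ ⋯ ¹X_k ²Y₁ ⋯ ²Y_l (F)`. -/
def bracket (F : N × N → ℝ) (Xs Ys : List (Field V N)) : N × N → ℝ :=
  Xs.foldr (fun X G ↦ along (leftField X) G) (Ys.foldr (fun Y G ↦ along (rightField Y) G) F)

variable [IsManifold 𝓘(ℝ, V) ∞ N]

/-- Smooth vector fields. -/
def Field.IsSmooth (X : Field V N) : Prop :=
  ContMDiff 𝓘(ℝ, V) (𝓘(ℝ, V).prod 𝓘(ℝ, V)) ∞ (T% X)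

/-- `g` is the `(0, 2)`-tensor `g^F(X, Y)(x) = -F[X | Y](x, x)`. -/
def IsInducedMetric (F : N × N → ℝ) (g : CovTensor V N 2) : Prop :=
  ∀ X Y : Field V N, X.IsSmooth → Y.IsSmooth → ∀ x : N,
    g x ![X x, Y x] = -bracket F [X] [Y] (x, x)

variable (V) in
/-- Contrast functions (pseudo-Riemannian version): smooth functions on `N × N` whose first jet
vanishes on the diagonal and whose induced tensor `g^F` is a pseudo-Riemannian metric. -/
structure IsContrast (F : N × N → ℝ) : Prop where
  smooth : ContMDiff (𝓘(ℝ, V).prod 𝓘(ℝ, V)) 𝓘(ℝ, ℝ) ∞ F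
  diag : ∀ x : N, F (x, x) = 0
  diag_deriv : ∀ x : N, mvfderiv (𝓘(ℝ, V).prod 𝓘(ℝ, V)) F (x, x) = 0
  metric : ∃ g : CovTensor V N 2, IsPseudoRiemannian g ∧ IsInducedMetric F g

variable (V N) in
/-- Affine connections on `N`; `∇ Y x (X x)` is `(∇_X Y)(x)`. -/
abbrev Connection := CovariantDerivative 𝓘(ℝ, V) V (fun x : N ↦ TangentSpace 𝓘(ℝ, V) x)

/-- The vector field `∇_X Y`. -/
def Connection.apply (D : Connection V N) (X Y : Field V N) : Field V N := fun x ↦ D Y x (X x)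

/-- `D'` is the dual connection of `D` with respect to `g`:
`g(D'_X Y, Z) = X g(Y, Z) - g(Y, D_X Z)`. -/
def IsDualConnection (g : CovTensor V N 2) (D D' : Connection V N) : Prop :=
  ∀ X Y Z : Field V N, X.IsSmooth → Y.IsSmooth → Z.IsSmooth → ∀ x : N,
    g x ![D'.apply X Y x, Z x] =
      mvfderiv 𝓘(ℝ, V) (fun y ↦ g y ![Y y, Z y]) x (X x) - g x ![Y x, D.apply X Z x]

variable (V N) in
/-- A metric tensor, a connection, a second connection and a `(0, 3)`-tensor on `N`. -/
structure StatisticalData where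
  metric : CovTensor V N 2
  conn : Connection V N
  dual : Connection V N
  skewness : CovTensor V N 3

/-- The data `(g^F, ∇^F, (∇^F)^*, T^F)` induced by a contrast function `F`. -/
structure StatisticalData.IsInducedBy (S : StatisticalData V N) (F : N × N → ℝ) : Prop where
  pseudoRiemannian : IsPseudoRiemannian S.metric
  metric_eq : IsInducedMetric F S.metric
  conn_smooth : CovariantDerivative.ContMDiffCovariantDerivative S.conn ∞
  conn_eq : ∀ X Y Z : Field V N, X.IsSmooth → Y.IsSmooth → Z.IsSmooth → ∀ x : N,
    S.metric x ![S.conn.apply X Y x, Z x] = -bracket F [X, Y] [Z] (x, x)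
  dual_smooth : CovariantDerivative.ContMDiffCovariantDerivative S.dual ∞
  dual_eq : IsDualConnection S.metric S.conn S.dual
  skewness_smooth : S.skewness.IsSmooth
  skewness_eq : ∀ X Y Z : Field V N, X.IsSmooth → Y.IsSmooth → Z.IsSmooth → ∀ x : N,
    S.skewness x ![X x, Y x, Z x] = bracket (fun z ↦ F z - F z.swap) [X] [Y, Z] (x, x)

end Contrast

/-! ### Lifts of tensor fields, vector fields and connections -/

section TensorLifts

variable {E : Type*} [NormedAddCommGroup E] [NormedSpace ℝ E] [FiniteDimensional ℝ E]
  {M : Type*} [TopologicalSpace M] [ChartedSpace E M] [IsManifold 𝓘(ℝ, E) ∞ M] [T2Space M]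

/-- The `l`-lift of a `(0, k)`-tensor field `K = K_{i₁…i_k} dx^{i₁} ⊗ ⋯ ⊗ dx^{i_k}` to `T^r M`,
`K^(l) = ∑ (K_{i₁…i_k})^(l - m₁ - ⋯ - m_k) dx^{i₁}_{m₁} ⊗ ⋯ ⊗ dx^{i_k}_{m_k}`
in the coordinates `x^i_m` adapted to the chart of `M` at the base point. -/
def CovTensor.lift (r l : ℕ) {k : ℕ} (K : CovTensor E M k) :
    CovTensor (Fin (r + 1) → E) (HigherTangent 𝓘(ℝ, E) r M) k := fun p ↦
  (∑ m : Fin k → Fin (r + 1),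
    (taylorCoeff ((l : ℤ) - ∑ i, (m i : ℤ)) fun t ↦
      K.inChart (chartAt E p.base)
        (polyCurve (chartAt (Fin (r + 1) → E) p p) t)).compContinuousLinearMap fun i ↦
          (ContinuousLinearMap.proj (m i) : (Fin (r + 1) → E) →L[ℝ] E)).compContinuousLinearMap
    fun _ ↦ mfderiv 𝓘(ℝ, Fin (r + 1) → E) 𝓘(ℝ, Fin (r + 1) → E) (chartAt (Fin (r + 1) → E) p) p

/-- The `l`-lift of a vector field `X = a^i ∂_{x^i}` to `T^r M`,
`X^(l) = ∑_ν (a^i)^(ν + l - r) ∂_{x^i_ν}` in the coordinates `x^i_ν` adapted to the chart of `M` at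
the base point; it is `0` for negative `l`. -/
def Field.lift (r : ℕ) (l : ℤ) (X : Field E M) :
    Field (Fin (r + 1) → E) (HigherTangent 𝓘(ℝ, E) r M) := fun p ↦
  (mfderiv 𝓘(ℝ, Fin (r + 1) → E) 𝓘(ℝ, Fin (r + 1) → E) (chartAt (Fin (r + 1) → E) p) p).inverse
    ((fun ν : Fin (r + 1) ↦ taylorCoeff ((ν : ℤ) + l - r) fun t ↦
      X.inChart (chartAt E p.base) (polyCurve (chartAt (Fin (r + 1) → E) p p) t)) :
      Fin (r + 1) → E)

/-- `D'` is the complete lift to `T^r M` of the connection `D` on `M`: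
`D'_{X^(l)} Y^(m) = (D_X Y)^(l + m - r)` for all smooth vector fields `X`, `Y` on `M` and all
`l, m = 0, …, r`. -/
def IsConnectionLift (r : ℕ) (D : Connection E M)
    (D' : Connection (Fin (r + 1) → E) (HigherTangent 𝓘(ℝ, E) r M)) : Prop :=
  ∀ X Y : Field E M, X.IsSmooth → Y.IsSmooth → ∀ l m : ℕ, l ≤ r → m ≤ r →
    D'.apply (X.lift r l) (Y.lift r m) = (D.apply X Y).lift r ((l : ℤ) + m - r)

end TensorLifts

end ContrastLift

end

open ContrastLift

/-!
The lift of a two-point function is governed by one rule. Write `f^(r - j)` for the function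
that maps `([γ₁], [γ₂])` to the `r`-th Taylor coefficient of `t ^ j f(γ₁(t), γ₂(t))` (`pairLift`),
so that `F^c = F^(r)`. In adapted coordinates a point of `T^r M` is a polynomial curve `x(t)` modulo
`t ^ (r + 1)`, a tangent vector is a polynomial curve `u(t)` modulo `t ^ (r + 1)`, the lift
`X^(r - j)` is the class of `t ^ j X(x(t))` (`Field.mfderiv_jetChart_lift`), and taking Taylor
coefficients commutes with differentiating in the coefficients of `x`
(`fderiv_taylorCoeff_param`). Hence `X^(r - j) f^(r - i) = (X f)^(r - i - j)` on either factor
(`along_leftField_lift_pairLift`, `along_rightField_lift_pairLift`), and so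
`F^c[X^(r - a) Y^(r - b) | Z^(r - c)] = (F[XY|Z])^(r - a - b - c)`, and likewise for the other
brackets.

In the same way `K^c(X₁^(r - j₁), …, X_k^(r - j_k)) = (K(X₁, …, X_k))^(r - j₁ - ⋯ - j_k)` for a
covariant tensor field `K` (`CovTensor.lift_apply_lift`). As lifted vector fields span every tangent
space of `T^r M` (`exists_eq_sum_lift`), the defining identities of `g^{F^c}` and `T^{F^c}` identify
them with `(g^F)^c` and `(T^F)^c`. In coordinates `(g^F)^c` is block triangular with `g^F` on the
antidiagonal, hence non-degenerate (`lift_nondegenerate`); so `F^c` is a contrast function, and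
pairing with lifted vector fields identifies `∇^{F^c}` with `(∇^F)^c`. The dual connection is the
connection induced by `F*` (`isInducedConnection_swap_iff`) and `(F*)^c = (F^c)*`, so the dual case
follows from the previous one.

Independently of lifts, every contrast function induces a metric, two dual connections and a
skewness tensor (`IsContrast.exists_isInducedBy`); this is applied on `M` and on `T^r M`. In a chart
these objects are given by the derivatives of the mixed Hessian `∂₁∂₂F`, and their independence of
the chart follows from the chart-free identities that determine them.
-/

noncomputable section

set_option linter.unusedSectionVars false
-- Instances on iterated spaces such as `V →L[ℝ] V →L[ℝ] V →L[ℝ] ℝ` need a larger depth.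
set_option maxSynthPendingDepth 3

namespace ContrastLift

/-! ### Taylor coefficients depending on parameters -/

section ParametricTaylor

variable {Z W : Type*} [NormedAddCommGroup Z] [NormedSpace ℝ Z]
  [NormedAddCommGroup W] [NormedSpace ℝ W]

/-- The partial derivative in the time variable of a function of `(z, t)`. -/
def timeDeriv (h : Z × ℝ → W) : Z × ℝ → W := fun p ↦ fderiv ℝ h p (0, 1)

lemma minSmoothness_two_le_infty : minSmoothness ℝ 2 ≤ (∞ : ℕ∞ω) := by
  simpa using! natCast_le_infty 2

lemma contDiffOn_fderiv_apply_const {Y : Type*} [NormedAddCommGroup Y] [NormedSpace ℝ Y]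
    {h : Y → W} {U : Set Y} (hU : IsOpen U) (hh : ContDiffOn ℝ ∞ h U) (v : Y) :
    ContDiffOn ℝ ∞ (fun p ↦ fderiv ℝ h p v) U :=
  (hh.fderiv_of_isOpen hU (m := ∞) (by simp)).clm_apply contDiffOn_const

lemma contDiffOn_timeDeriv_iterate {h : Z × ℝ → W} {U : Set (Z × ℝ)} (hU : IsOpen U)
    (hh : ContDiffOn ℝ ∞ h U) (m : ℕ) : ContDiffOn ℝ ∞ (timeDeriv^[m] h) U := by
  induction m generalizing h with
  | zero => exact hh
  | succ m ih => exact ih (contDiffOn_fderiv_apply_const hU hh _)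

lemma timeDeriv_iterate_congr {h k : Z × ℝ → W} {U : Set (Z × ℝ)} (hU : IsOpen U)
    (hhk : EqOn h k U) (m : ℕ) : EqOn (timeDeriv^[m] h) (timeDeriv^[m] k) U := by
  induction m generalizing h k with
  | zero => exact hhk
  | succ m ih =>
    refine ih fun p hp ↦ ?_
    simp only [timeDeriv]
    rw [(hhk.eventuallyEq_of_mem (hU.mem_nhds hp)).fderiv_eq]

/-- Derivatives in time at a fixed parameter, as iterated directional derivatives of the function of
both variables; the latter are visibly smooth in the parameter. -/
lemma iteratedDeriv_eq_timeDeriv_iterate {h : Z × ℝ → W} {U : Set (Z × ℝ)} (hU : IsOpen U)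
    (hh : ContDiffOn ℝ ∞ h U) (m : ℕ) {z : Z} {t : ℝ} (hz : (z, t) ∈ U) :
    iteratedDeriv m (fun s ↦ h (z, s)) t = timeDeriv^[m] h (z, t) := by
  induction m generalizing t with
  | zero => simp
  | succ m ih =>
    have hev : iteratedDeriv m (fun s ↦ h (z, s)) =ᶠ[𝓝 t] fun s ↦ timeDeriv^[m] h (z, s) := by
      have : ∀ᶠ s in 𝓝 t, (z, s) ∈ U :=
        (Continuous.prodMk_right z).continuousAt.eventually_mem (hU.mem_nhds hz)
      filter_upwards [this] with s hs using ih hs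
    rw [iteratedDeriv_succ, hev.deriv_eq, Function.iterate_succ_apply']
    have hd : DifferentiableAt ℝ (timeDeriv^[m] h) (z, t) :=
      ((contDiffOn_timeDeriv_iterate hU hh m).contDiffAt (hU.mem_nhds hz)).differentiableAt
        (by simp)
    have hc : HasDerivAt (fun s : ℝ ↦ (z, s)) (0, 1) t :=
      (hasDerivAt_const t z).prodMk (hasDerivAt_id t)
    exact (hd.hasFDerivAt.comp_hasDerivAt t hc).deriv

/-- Directional derivatives commute with `timeDeriv`, by the symmetry of second derivatives. -/
lemma timeDeriv_iterate_fderiv_comm {h : Z × ℝ → W} {U : Set (Z × ℝ)} (hU : IsOpen U)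
    (hh : ContDiffOn ℝ ∞ h U) (m : ℕ) (v : Z × ℝ) {p : Z × ℝ} (hp : p ∈ U) :
    fderiv ℝ (timeDeriv^[m] h) p v = timeDeriv^[m] (fun q ↦ fderiv ℝ h q v) p := by
  induction m generalizing h with
  | zero => rfl
  | succ m ih =>
    rw [Function.iterate_succ_apply, Function.iterate_succ_apply,
      ih (h := timeDeriv h) (contDiffOn_fderiv_apply_const hU hh _)]
    refine timeDeriv_iterate_congr hU (fun q hq ↦ ?_) m hp
    have hq' : ContDiffAt ℝ ∞ h q := hh.contDiffAt (hU.mem_nhds hq)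
    have hd : DifferentiableAt ℝ (fderiv ℝ h) q :=
      (hq'.fderiv_right (m := ∞) (by simp)).differentiableAt (by simp)
    have hap : ∀ w w' : Z × ℝ, fderiv ℝ (fun q ↦ fderiv ℝ h q w) q w' =
        fderiv ℝ (fderiv ℝ h) q w' w := by
      intro w w'
      rw [fderiv_clm_apply hd (differentiableAt_const w)]
      simp
    change fderiv ℝ (fun q ↦ fderiv ℝ h q (0, 1)) q v = fderiv ℝ (fun q ↦ fderiv ℝ h q v) q (0, 1)
    rw [hap, hap]
    exact (hq'.isSymmSndFDerivAt minSmoothness_two_le_infty).eq v (0, 1)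

lemma contDiffOn_taylorCoeff_param {h : Z × ℝ → W} {U : Set (Z × ℝ)} (hU : IsOpen U)
    (hh : ContDiffOn ℝ ∞ h U) (m : ℕ) :
    ContDiffOn ℝ ∞ (fun z ↦ taylorCoeff m fun t ↦ h (z, t)) {z | (z, 0) ∈ U} := by
  have h1 : ContDiffOn ℝ ∞ (fun z ↦ ((m.factorial : ℝ))⁻¹ • timeDeriv^[m] h (z, 0))
      {z | (z, 0) ∈ U} :=
    contDiffOn_const.smul ((contDiffOn_timeDeriv_iterate hU hh m).comp
      (by fun_prop : ContDiff ℝ ∞ fun z : Z ↦ (z, (0 : ℝ))).contDiffOn fun z hz ↦ hz)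
  refine h1.congr fun z hz ↦ ?_
  rw [taylorCoeff_natCast, iteratedDeriv_eq_timeDeriv_iterate hU hh m hz]

/-- Taking Taylor coefficients in time commutes with differentiating in a parameter. -/
lemma fderiv_taylorCoeff_param {h : Z × ℝ → W} {U : Set (Z × ℝ)} (hU : IsOpen U)
    (hh : ContDiffOn ℝ ∞ h U) (m : ℕ) {z : Z} (hz : (z, 0) ∈ U) (v : Z) :
    fderiv ℝ (fun z ↦ taylorCoeff m fun t ↦ h (z, t)) z v =
      taylorCoeff m fun t ↦ fderiv ℝ h (z, t) (v, 0) := by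
  have hev : (fun z ↦ taylorCoeff m fun t ↦ h (z, t)) =ᶠ[𝓝 z]
      fun z ↦ ((m.factorial : ℝ))⁻¹ • timeDeriv^[m] h (z, 0) := by
    have : ∀ᶠ z' in 𝓝 z, (z', (0 : ℝ)) ∈ U :=
      (Continuous.prodMk_left (0 : ℝ)).continuousAt.eventually_mem (hU.mem_nhds hz)
    filter_upwards [this] with z' hz'
    rw [taylorCoeff_natCast, iteratedDeriv_eq_timeDeriv_iterate hU hh m hz']
  have hd : DifferentiableAt ℝ (timeDeriv^[m] h) (z, 0) :=
    ((contDiffOn_timeDeriv_iterate hU hh m).contDiffAt (hU.mem_nhds hz)).differentiableAt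
      (by simp)
  have hc : HasFDerivAt (fun z : Z ↦ (z, (0 : ℝ))) (ContinuousLinearMap.inl ℝ Z ℝ) z :=
    hasFDerivAt_prodMk_left z 0
  have hf : HasFDerivAt (fun z ↦ ((m.factorial : ℝ))⁻¹ • timeDeriv^[m] h (z, 0)) _ z :=
    (hd.hasFDerivAt.comp z hc).const_smul ((m.factorial : ℝ))⁻¹
  rw [hev.fderiv_eq, hf.fderiv, taylorCoeff_natCast,
    iteratedDeriv_eq_timeDeriv_iterate hU (contDiffOn_fderiv_apply_const hU hh (v, 0)) m hz,
    ← timeDeriv_iterate_fderiv_comm hU hh m (v, 0) hz]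
  rfl

end ParametricTaylor

/-! ### Calculus of truncated Taylor expansions -/

section Truncated

variable {V W X : Type*} [NormedAddCommGroup V] [NormedSpace ℝ V]
  [NormedAddCommGroup W] [NormedSpace ℝ W] [NormedAddCommGroup X] [NormedSpace ℝ X]

/-- Two curves have the same Taylor expansion of order `r` at `0`. -/
def TaylorEq (r : ℕ) (c₁ c₂ : ℝ → V) : Prop :=
  ∀ k ≤ r, iteratedDeriv k c₁ 0 = iteratedDeriv k c₂ 0

lemma TaylorEq.refl (r : ℕ) (c : ℝ → V) : TaylorEq r c c := fun _ _ ↦ rfl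

lemma TaylorEq.symm {r : ℕ} {c₁ c₂ : ℝ → V} (h : TaylorEq r c₁ c₂) : TaylorEq r c₂ c₁ :=
  fun k hk ↦ (h k hk).symm

lemma TaylorEq.apply_zero {r : ℕ} {c₁ c₂ : ℝ → V} (h : TaylorEq r c₁ c₂) : c₁ 0 = c₂ 0 := by
  simpa using h 0 (Nat.zero_le _)

lemma TaylorEq.taylorCoeff_eq {r : ℕ} {c₁ c₂ : ℝ → V} (h : TaylorEq r c₁ c₂) {k : ℤ}
    (hk : k ≤ r) : taylorCoeff k c₁ = taylorCoeff k c₂ := by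
  rcases lt_or_ge k 0 with h0 | h0
  · simp [taylorCoeff, h0]
  · lift k to ℕ using h0
    rw [taylorCoeff_natCast, taylorCoeff_natCast, h k (by exact_mod_cast hk)]

lemma taylorEq_of_taylorCoeff_eq {r : ℕ} {c₁ c₂ : ℝ → V}
    (h : ∀ k : ℕ, k ≤ r → taylorCoeff k c₁ = taylorCoeff k c₂) : TaylorEq r c₁ c₂ := by
  intro k hk
  have h1 := h k hk
  rw [taylorCoeff_natCast, taylorCoeff_natCast] at h1
  exact smul_right_injective V (inv_ne_zero (Nat.cast_ne_zero.2 k.factorial_ne_zero)) h1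

lemma TaylorEq.comp {r : ℕ} {c₁ c₂ : ℝ → V} (h : TaylorEq r c₁ c₂) (h₁ : ContDiffAt ℝ ∞ c₁ 0)
    (h₂ : ContDiffAt ℝ ∞ c₂ 0) {g : V → W} (hg : ContDiffAt ℝ ∞ g (c₁ 0)) :
    TaylorEq r (fun t ↦ g (c₁ t)) fun t ↦ g (c₂ t) :=
  fun _ hk ↦ iteratedDeriv_comp_congr hg h₁ h₂ h hk

lemma iteratedDeriv_prodMk {c : ℝ → V} {d : ℝ → W} (k : ℕ) (hc : ContDiffAt ℝ ∞ c 0)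
    (hd : ContDiffAt ℝ ∞ d 0) :
    iteratedDeriv k (fun t ↦ (c t, d t)) 0 = (iteratedDeriv k c 0, iteratedDeriv k d 0) := by
  simp only [iteratedDeriv]
  rw [iteratedFDeriv_prodMk hc hd (natCast_le_infty k)]
  rfl

lemma TaylorEq.prodMk {r : ℕ} {c₁ c₂ : ℝ → V} {d₁ d₂ : ℝ → W} (h : TaylorEq r c₁ c₂)
    (h' : TaylorEq r d₁ d₂) (hc₁ : ContDiffAt ℝ ∞ c₁ 0) (hc₂ : ContDiffAt ℝ ∞ c₂ 0)
    (hd₁ : ContDiffAt ℝ ∞ d₁ 0) (hd₂ : ContDiffAt ℝ ∞ d₂ 0) :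
    TaylorEq r (fun t ↦ (c₁ t, d₁ t)) fun t ↦ (c₂ t, d₂ t) := by
  intro k hk
  rw [iteratedDeriv_prodMk k hc₁ hd₁, iteratedDeriv_prodMk k hc₂ hd₂, h k hk, h' k hk]

lemma TaylorEq.pi {r : ℕ} {ι : Type*} [Fintype ι] {c₁ c₂ : ι → ℝ → V}
    (h : ∀ i, TaylorEq r (c₁ i) (c₂ i)) (h₁ : ∀ i, ContDiffAt ℝ ∞ (c₁ i) 0)
    (h₂ : ∀ i, ContDiffAt ℝ ∞ (c₂ i) 0) :
    TaylorEq r (fun t i ↦ c₁ i t) fun t i ↦ c₂ i t := by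
  have key : ∀ c : ι → ℝ → V, (∀ i, ContDiffAt ℝ ∞ (c i) 0) → ∀ k i,
      iteratedDeriv k (fun t i ↦ c i t) 0 i = iteratedDeriv k (c i) 0 := by
    intro c hc k i
    have := (ContinuousLinearMap.proj (R := ℝ) (φ := fun _ : ι ↦ V) i).iteratedFDeriv_comp_left
      (contDiffAt_pi.2 hc : ContDiffAt ℝ ∞ (fun t i ↦ c i t) 0) (natCast_le_infty k)
    simp only [iteratedDeriv]
    exact (congrArg (fun L ↦ L fun _ ↦ (1 : ℝ)) this).symm
  intro k hk
  funext i
  rw [key c₁ h₁, key c₂ h₂, h i k hk]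

lemma taylorCoeff_clm_comp {c : ℝ → V} (hc : ContDiffAt ℝ ∞ c 0) (L : V →L[ℝ] W) (k : ℤ) :
    taylorCoeff k (fun t ↦ L (c t)) = L (taylorCoeff k c) := by
  rcases lt_or_ge k 0 with h0 | h0
  · simp [taylorCoeff, h0]
  · lift k to ℕ using h0
    have := L.iteratedFDeriv_comp_left hc (natCast_le_infty k)
    rw [taylorCoeff_natCast, taylorCoeff_natCast, map_smul]
    congr 1
    simp only [iteratedDeriv]
    exact congrArg (fun L ↦ L fun _ ↦ (1 : ℝ)) this

lemma taylorCoeff_sum {ι : Type*} (s : Finset ι) {c : ι → ℝ → V}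
    (hc : ∀ i ∈ s, ContDiffAt ℝ ∞ (c i) 0) (k : ℤ) :
    taylorCoeff k (fun t ↦ ∑ i ∈ s, c i t) = ∑ i ∈ s, taylorCoeff k (c i) := by
  rcases lt_or_ge k 0 with h0 | h0
  · simp [taylorCoeff, h0]
  · lift k to ℕ using h0
    simp only [taylorCoeff_natCast]
    rw [iteratedDeriv_fun_sum fun i hi ↦ (hc i hi).of_le (natCast_le_infty k), Finset.smul_sum]

lemma taylorCoeff_zero_curve (k : ℤ) : taylorCoeff k (fun _ ↦ (0 : V)) = 0 := by
  have := taylorCoeff_clm_comp (c := fun _ ↦ (0 : V)) contDiffAt_const (0 : V →L[ℝ] V) k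
  simpa using this

lemma taylorCoeff_congr {c₁ c₂ : ℝ → V} (h : c₁ =ᶠ[𝓝 0] c₂) (k : ℤ) :
    taylorCoeff k c₁ = taylorCoeff k c₂ := by
  unfold taylorCoeff
  split_ifs
  · rfl
  · rw [h.iteratedDeriv_eq]

/-- Multiplication by `t ^ j` shifts Taylor coefficients. -/
lemma taylorCoeff_pow_smul {c : ℝ → V} (hc : ContDiffAt ℝ ∞ c 0) (k j : ℕ) :
    taylorCoeff k (fun t ↦ t ^ j • c t) = taylorCoeff ((k : ℤ) - j) c := by
  have hp : ContDiffAt ℝ k (fun t : ℝ ↦ t ^ j) 0 := by fun_prop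
  have h1 := iteratedDerivWithin_smul (mem_univ (0 : ℝ)) uniqueDiffOn_univ
    hp.contDiffWithinAt (hc.of_le (natCast_le_infty k)).contDiffWithinAt
  simp only [iteratedDerivWithin_univ, iteratedDeriv_fun_pow_zero] at h1
  rw [taylorCoeff_natCast]
  change _ • iteratedDeriv k ((fun t : ℝ ↦ t ^ j) • c) 0 = _
  rw [h1]
  rcases lt_or_ge k j with hkj | hkj
  · rw [Finset.sum_eq_zero, smul_zero, taylorCoeff, if_pos (by omega)]
    intro i hi
    have := Finset.mem_range.1 hi
    rw [if_neg (by omega)]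
    simp
  · rw [Finset.sum_eq_single_of_mem j (Finset.mem_range.2 (by omega))
      (fun i _ hij ↦ by rw [if_neg hij]; simp), if_pos rfl, ← Nat.cast_sub hkj,
      taylorCoeff_natCast, ← Nat.cast_smul_eq_nsmul ℝ, smul_smul, smul_smul,
      ← Nat.choose_mul_factorial_mul_factorial hkj]
    congr 1
    have h2 := Nat.factorial_ne_zero j
    have h3 := Nat.factorial_ne_zero (k - j)
    have h4 := (Nat.choose_pos hkj).ne'
    push_cast
    field_simp

lemma taylorCoeff_polyCurve {r : ℕ} (x : Fin (r + 1) → V) (ν : Fin (r + 1)) :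
    taylorCoeff ((ν : ℕ) : ℤ) (polyCurve x) = x ν := by
  rw [taylorCoeff_natCast, iteratedDeriv_polyCurve, dif_pos ν.2, smul_smul,
    inv_mul_cancel₀ (Nat.cast_ne_zero.2 (Nat.factorial_ne_zero _)), one_smul]

/-- The Taylor polynomial of order `r` of a curve approximates it to order `r`. -/
lemma taylorEq_polyCurve_taylorCoeff (r : ℕ) (c : ℝ → V) :
    TaylorEq r (polyCurve fun ν : Fin (r + 1) ↦ taylorCoeff ((ν : ℕ) : ℤ) c) c := by
  refine taylorEq_of_taylorCoeff_eq fun k hk ↦ ?_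
  exact taylorCoeff_polyCurve _ (⟨k, Nat.lt_succ_of_le hk⟩ : Fin (r + 1))

end Truncated

/-! ### Vector fields in charts -/

section FieldCharts

variable {V : Type*} [NormedAddCommGroup V] [NormedSpace ℝ V]
  {N : Type*} [TopologicalSpace N] [ChartedSpace V N] [IsManifold 𝓘(ℝ, V) ∞ N]

lemma chart_mdifferentiable {e : OpenPartialHomeomorph N V} (he : e ∈ atlas V N) :
    e.MDifferentiable 𝓘(ℝ, V) 𝓘(ℝ, V) :=
  mdifferentiable_of_mem_atlas he

lemma contMDiffOn_chart_of_mem {e : OpenPartialHomeomorph N V} (he : e ∈ atlas V N) :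
    ContMDiffOn 𝓘(ℝ, V) 𝓘(ℝ, V) ∞ e e.source :=
  contMDiffOn_of_mem_maximalAtlas (IsManifold.subset_maximalAtlas he)

lemma contMDiffOn_chart_symm_of_mem {e : OpenPartialHomeomorph N V} (he : e ∈ atlas V N) :
    ContMDiffOn 𝓘(ℝ, V) 𝓘(ℝ, V) ∞ e.symm e.target :=
  contMDiffOn_symm_of_mem_maximalAtlas (IsManifold.subset_maximalAtlas he)

lemma mfderiv_symm_mfderiv {e : OpenPartialHomeomorph N V} (he : e ∈ atlas V N) {x : N}
    (hx : x ∈ e.source) (u : TangentSpace 𝓘(ℝ, V) x) :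
    mfderiv 𝓘(ℝ, V) 𝓘(ℝ, V) e.symm (e x) (mfderiv 𝓘(ℝ, V) 𝓘(ℝ, V) e x u) = u :=
  DFunLike.congr_fun ((chart_mdifferentiable he).symm_comp_deriv hx) u

lemma mfderiv_mfderiv_symm {e : OpenPartialHomeomorph N V} (he : e ∈ atlas V N) {y : V}
    (hy : y ∈ e.target) (u : V) :
    mfderiv 𝓘(ℝ, V) 𝓘(ℝ, V) e (e.symm y) (mfderiv 𝓘(ℝ, V) 𝓘(ℝ, V) e.symm y u) = u :=
  DFunLike.congr_fun ((chart_mdifferentiable he).comp_symm_deriv hy) u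

lemma Field.inChart_apply {e : OpenPartialHomeomorph N V} (X : Field V N) {x : N}
    (hx : x ∈ e.source) : X.inChart e (e x) = mfderiv 𝓘(ℝ, V) 𝓘(ℝ, V) e x (X x) := by
  rw [Field.inChart, e.left_inv hx]

lemma Field.mfderiv_symm_inChart {e : OpenPartialHomeomorph N V} (he : e ∈ atlas V N)
    (X : Field V N) {y : V} (hy : y ∈ e.target) :
    mfderiv 𝓘(ℝ, V) 𝓘(ℝ, V) e.symm y (X.inChart e y) = X (e.symm y) := by
  have := mfderiv_symm_mfderiv he (e.map_target hy) (X (e.symm y))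
  rwa [e.right_inv hy] at this

lemma Field.IsSmooth.contDiffOn_inChart {X : Field V N} (hX : X.IsSmooth)
    {e : OpenPartialHomeomorph N V} (he : e ∈ atlas V N) :
    ContDiffOn ℝ ∞ (X.inChart e) e.target := by
  rw [← contMDiffOn_iff_contDiffOn]
  have h1 := (contMDiffOn_chart_of_mem he).contMDiffOn_tangentMapWithin (m := ∞) (by simp)
    e.open_source.uniqueMDiffOn
  have h2 : ContMDiffOn 𝓘(ℝ, V) _ ∞ (fun y ↦ T% X (e.symm y)) e.target :=
    hX.comp_contMDiffOn (contMDiffOn_chart_symm_of_mem he)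
  have h3 := (contMDiff_snd_tangentBundle_modelSpace V 𝓘(ℝ, V)).comp_contMDiffOn
    (h1.comp h2 fun y hy ↦ e.map_target hy)
  refine h3.congr fun y hy ↦ ?_
  simp only [Function.comp, tangentMapWithin, Field.inChart]
  rw [mfderivWithin_of_isOpen e.open_source (e.map_target hy)]

lemma Field.isSmooth_of_contDiffAt_inChart {X : Field V N}
    (hX : ∀ x : N, ∃ e ∈ atlas V N, x ∈ e.source ∧ ContDiffAt ℝ ∞ (X.inChart e) (e x)) :
    X.IsSmooth := by
  intro x
  obtain ⟨e, he, hx, hs⟩ := hX x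
  have h1 : ContMDiffAt 𝓘(ℝ, V) _ ∞
      (fun z ↦ (⟨e z, X.inChart e (e z)⟩ : TangentBundle 𝓘(ℝ, V) V)) x :=
    (contMDiffAt_vectorSpace_iff_contDiffAt.2 hs).comp x
      ((contMDiffOn_chart_of_mem he).contMDiffAt (e.open_source.mem_nhds hx))
  have h2 : ContMDiffOn _ _ ∞ (tangentMapWithin 𝓘(ℝ, V) 𝓘(ℝ, V) e.symm e.target)
      (Bundle.TotalSpace.proj ⁻¹' e.target) :=
    (contMDiffOn_chart_symm_of_mem he).contMDiffOn_tangentMapWithin (m := ∞) (by simp)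
      e.open_target.uniqueMDiffOn
  have h3 := h2.contMDiffAt (x := ⟨e x, X.inChart e (e x)⟩)
    ((e.open_target.preimage (FiberBundle.continuous_proj V _)).mem_nhds (e.map_source hx))
  refine (h3.comp x h1).congr_of_eventuallyEq ?_
  filter_upwards [e.open_source.mem_nhds hx] with z hz
  simp only [Function.comp, tangentMapWithin]
  rw [mfderivWithin_of_isOpen e.open_target (e.map_source hz),
    Field.mfderiv_symm_inChart he X (e.map_source hz), e.left_inv hz]

/-- A vector field with constant components near `x`, cut off by a bump function. -/
lemma exists_smoothField_eventuallyEq_const [FiniteDimensional ℝ V] [T2Space N]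
    {e : OpenPartialHomeomorph N V} (he : e ∈ atlas V N) {x : N} (hx : x ∈ e.source) (v : V) :
    ∃ X : Field V N, X.IsSmooth ∧ X.inChart e =ᶠ[𝓝 (e x)] fun _ ↦ v := by
  obtain ⟨ψ, -, hψ⟩ := (SmoothBumpFunction.nhds_basis_tsupport (I := 𝓘(ℝ, V)) x).mem_iff.1
    (e.open_source.mem_nhds hx)
  let X : Field V N := fun z ↦ (ψ z • mfderiv 𝓘(ℝ, V) 𝓘(ℝ, V) e.symm (e z) v : V)
  have hXe : ∀ y ∈ e.target, X.inChart e y = ψ (e.symm y) • v := by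
    intro y hy
    have h1 := mfderiv_mfderiv_symm he hy v
    simp only [Field.inChart, X]
    rw [e.right_inv hy]
    exact (map_smul (mfderiv 𝓘(ℝ, V) 𝓘(ℝ, V) e (e.symm y)) _ _).trans (congrArg _ h1)
  have hψe : ContDiffOn ℝ ∞ (fun y ↦ ψ (e.symm y)) e.target := by
    rw [← contMDiffOn_iff_contDiffOn]
    exact ψ.contMDiff.comp_contMDiffOn (contMDiffOn_chart_symm_of_mem he)
  refine ⟨X, Field.isSmooth_of_contDiffAt_inChart fun z ↦ ?_, ?_⟩
  · by_cases hz : z ∈ e.source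
    · refine ⟨e, he, hz, ?_⟩
      have ht := e.open_target.mem_nhds (e.map_source hz)
      refine ((hψe.contDiffAt ht).smul (contDiffAt_const (c := v))).congr_of_eventuallyEq ?_
      filter_upwards [ht] with y hy using hXe y hy
    · refine ⟨chartAt V z, chart_mem_atlas V z, mem_chart_source V z, ?_⟩
      have hz' : z ∈ (tsupport ψ)ᶜ := fun h ↦ hz (hψ h)
      refine (contDiffAt_const (c := (0 : V))).congr_of_eventuallyEq ?_
      have hc : ContinuousAt (chartAt V z).symm (chartAt V z z) :=
        (chartAt V z).continuousAt_symm (mem_chart_target V z)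
      have := hc.eventually_mem (((isClosed_tsupport ψ).isOpen_compl.mem_nhds
        (by simpa using! hz')))
      filter_upwards [this] with y hy
      have h0 : ψ ((chartAt V z).symm y) = 0 := image_eq_zero_of_notMem_tsupport hy
      simp only [Field.inChart, X, h0]
      exact (congrArg _ (zero_smul ℝ _)).trans (map_zero _)
  · have h1 : ContinuousAt e.symm (e x) := e.continuousAt_symm (e.map_source hx)
    have h2 : Tendsto e.symm (𝓝 (e x)) (𝓝 x) := by
      simpa [ContinuousAt, e.left_inv hx] using h1
    filter_upwards [e.open_target.mem_nhds (e.map_source hx),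
      h2.eventually ψ.eventuallyEq_one] with y hy hy1
    rw [hXe y hy, hy1]
    simp

end FieldCharts

/-! ### Two-point functions in charts -/

section TwoPoint

variable {V : Type*} [NormedAddCommGroup V] [NormedSpace ℝ V]
  {N : Type*} [TopologicalSpace N] [ChartedSpace V N]

/-- The expression of a function on `N × N` in a pair of charts of `N`. -/
def twoPoint (e e' : OpenPartialHomeomorph N V) (G : N × N → ℝ) : V × V → ℝ :=
  fun y ↦ G (e.symm y.1, e'.symm y.2)

variable [IsManifold 𝓘(ℝ, V) ∞ N]

/-- The derivative of the product of two inverse charts, as a map into `N × N`. -/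
lemma hasMFDerivAt_prodMap_symm {e e' : OpenPartialHomeomorph N V} (he : e ∈ atlas V N)
    (he' : e' ∈ atlas V N) {y : V × V} (hy : y ∈ e.target ×ˢ e'.target) :
    HasMFDerivAt 𝓘(ℝ, V × V) (𝓘(ℝ, V).prod 𝓘(ℝ, V)) (fun y : V × V ↦ (e.symm y.1, e'.symm y.2)) y
      (((mfderiv 𝓘(ℝ, V) 𝓘(ℝ, V) e.symm y.1).comp (ContinuousLinearMap.fst ℝ V V)).prod
        ((mfderiv 𝓘(ℝ, V) 𝓘(ℝ, V) e'.symm y.2).comp (ContinuousLinearMap.snd ℝ V V))) := by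
  have h1 := ((chart_mdifferentiable he).mdifferentiableAt_symm hy.1).hasMFDerivAt
  have h2 := ((chart_mdifferentiable he').mdifferentiableAt_symm hy.2).hasMFDerivAt
  have hf : HasMFDerivAt 𝓘(ℝ, V × V) 𝓘(ℝ, V) (Prod.fst : V × V → V) y
    (ContinuousLinearMap.fst ℝ V V) := hasFDerivAt_fst.hasMFDerivAt
  have hs : HasMFDerivAt 𝓘(ℝ, V × V) 𝓘(ℝ, V) (Prod.snd : V × V → V) y
    (ContinuousLinearMap.snd ℝ V V) := hasFDerivAt_snd.hasMFDerivAt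
  exact (h1.comp y hf).prodMk (h2.comp y hs)

lemma along_leftField_chart {e e' : OpenPartialHomeomorph N V} (he : e ∈ atlas V N)
    (he' : e' ∈ atlas V N) {G : N × N → ℝ} {y : V × V} (hy : y ∈ e.target ×ˢ e'.target)
    (hG : MDifferentiableAt (𝓘(ℝ, V).prod 𝓘(ℝ, V)) 𝓘(ℝ, ℝ) G (e.symm y.1, e'.symm y.2))
    (X : Field V N) :
    along (leftField X) G (e.symm y.1, e'.symm y.2) =
      fderiv ℝ (twoPoint e e' G) y (X.inChart e y.1, 0) := by
  have h := hG.hasMFDerivAt.comp y (hasMFDerivAt_prodMap_symm he he' hy)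
  have h' : fderiv ℝ (twoPoint e e' G) y = (_ : V × V →L[ℝ] ℝ) :=
    HasFDerivAt.fderiv (f := twoPoint e e' G) h.hasFDerivAt
  refine Eq.trans ?_ (congrArg (fun L : V × V →L[ℝ] ℝ ↦ L (X.inChart e y.1, 0)) h').symm
  let D : V × V →L[ℝ] ℝ := mvfderiv (𝓘(ℝ, V).prod 𝓘(ℝ, V)) G (e.symm y.1, e'.symm y.2)
  change D ((X (e.symm y.1) : V), (0 : V)) =
    D ((mfderiv 𝓘(ℝ, V) 𝓘(ℝ, V) e.symm y.1 (X.inChart e y.1) : V),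
      (mfderiv 𝓘(ℝ, V) 𝓘(ℝ, V) e'.symm y.2 (0 : V) : V))
  rw [Field.mfderiv_symm_inChart he X hy.1]
  congr 2
  exact (map_zero (mfderiv 𝓘(ℝ, V) 𝓘(ℝ, V) e'.symm y.2)).symm

lemma along_rightField_chart {e e' : OpenPartialHomeomorph N V} (he : e ∈ atlas V N)
    (he' : e' ∈ atlas V N) {G : N × N → ℝ} {y : V × V} (hy : y ∈ e.target ×ˢ e'.target)
    (hG : MDifferentiableAt (𝓘(ℝ, V).prod 𝓘(ℝ, V)) 𝓘(ℝ, ℝ) G (e.symm y.1, e'.symm y.2))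
    (X : Field V N) :
    along (rightField X) G (e.symm y.1, e'.symm y.2) =
      fderiv ℝ (twoPoint e e' G) y (0, X.inChart e' y.2) := by
  have h := hG.hasMFDerivAt.comp y (hasMFDerivAt_prodMap_symm he he' hy)
  have h' : fderiv ℝ (twoPoint e e' G) y = (_ : V × V →L[ℝ] ℝ) :=
    HasFDerivAt.fderiv (f := twoPoint e e' G) h.hasFDerivAt
  refine Eq.trans ?_ (congrArg (fun L : V × V →L[ℝ] ℝ ↦ L (0, X.inChart e' y.2)) h').symm
  let D : V × V →L[ℝ] ℝ := mvfderiv (𝓘(ℝ, V).prod 𝓘(ℝ, V)) G (e.symm y.1, e'.symm y.2)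
  change D ((0 : V), (X (e'.symm y.2) : V)) =
    D ((mfderiv 𝓘(ℝ, V) 𝓘(ℝ, V) e.symm y.1 (0 : V) : V),
      (mfderiv 𝓘(ℝ, V) 𝓘(ℝ, V) e'.symm y.2 (X.inChart e' y.2) : V))
  rw [Field.mfderiv_symm_inChart he' X hy.2]
  congr 2
  exact (map_zero (mfderiv 𝓘(ℝ, V) 𝓘(ℝ, V) e.symm y.1)).symm

variable (V) in
/-- Smooth functions on `N × N`. -/
abbrev SmoothPair (G : N × N → ℝ) : Prop :=
  ContMDiff (𝓘(ℝ, V).prod 𝓘(ℝ, V)) 𝓘(ℝ, ℝ) ∞ G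

lemma SmoothPair.contDiffOn_twoPoint {G : N × N → ℝ} (hG : SmoothPair V G)
    {e e' : OpenPartialHomeomorph N V} (he : e ∈ atlas V N) (he' : e' ∈ atlas V N) :
    ContDiffOn ℝ ∞ (twoPoint e e' G) (e.target ×ˢ e'.target) := by
  rw [← contMDiffOn_iff_contDiffOn]
  refine hG.comp_contMDiffOn (ContMDiffOn.prodMk ?_ ?_)
  · exact (contMDiffOn_chart_symm_of_mem he).comp contDiff_fst.contMDiff.contMDiffOn
      fun y hy ↦ hy.1
  · exact (contMDiffOn_chart_symm_of_mem he').comp contDiff_snd.contMDiff.contMDiffOn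
      fun y hy ↦ hy.2

lemma smoothPair_of_contDiffOn_twoPoint {G : N × N → ℝ}
    (hG : ∀ e ∈ atlas V N, ∀ e' ∈ atlas V N,
      ContDiffOn ℝ ∞ (twoPoint e e' G) (e.target ×ˢ e'.target)) : SmoothPair V G := by
  rintro ⟨x, x'⟩
  have he := chart_mem_atlas V x
  have he' := chart_mem_atlas V x'
  have hx := mem_chart_source V x
  have hx' := mem_chart_source V x'
  set e := chartAt V x
  set e' := chartAt V x'
  have h1 := (hG e he e' he').contDiffAt (x := (e x, e' x'))
    ((e.open_target.prod e'.open_target).mem_nhds ⟨e.map_source hx, e'.map_source hx'⟩)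
  have hee : ContMDiffAt (𝓘(ℝ, V).prod 𝓘(ℝ, V)) 𝓘(ℝ, V × V) ∞
      (fun z : N × N ↦ (e z.1, e' z.2)) (x, x') := by
    refine ContMDiffAt.prodMk_space ?_ ?_
    · exact ((contMDiffOn_chart_of_mem he).contMDiffAt (e.open_source.mem_nhds hx)).comp (x, x')
        contMDiffAt_fst
    · exact ((contMDiffOn_chart_of_mem he').contMDiffAt (e'.open_source.mem_nhds hx')).comp (x, x')
        contMDiffAt_snd
  refine ((contMDiffAt_iff_contDiffAt.2 h1).comp (x, x') hee).congr_of_eventuallyEq ?_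
  filter_upwards [(e.open_source.prod e'.open_source).mem_nhds ⟨hx, hx'⟩] with z hz
  simp only [Function.comp, twoPoint]
  rw [e.left_inv hz.1, e'.left_inv hz.2]

lemma SmoothPair.mdifferentiableAt {G : N × N → ℝ} (hG : SmoothPair V G) (z : N × N) :
    MDifferentiableAt (𝓘(ℝ, V).prod 𝓘(ℝ, V)) 𝓘(ℝ, ℝ) G z :=
  (hG z).mdifferentiableAt (by simp)

lemma SmoothPair.twoPoint_along_leftField {G : N × N → ℝ} (hG : SmoothPair V G)
    {e e' : OpenPartialHomeomorph N V} (he : e ∈ atlas V N) (he' : e' ∈ atlas V N)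
    (X : Field V N) :
    EqOn (twoPoint e e' (along (leftField X) G))
      (fun y ↦ fderiv ℝ (twoPoint e e' G) y (X.inChart e y.1, 0)) (e.target ×ˢ e'.target) :=
  fun _ hy ↦ along_leftField_chart he he' hy (hG.mdifferentiableAt _) X

lemma SmoothPair.twoPoint_along_rightField {G : N × N → ℝ} (hG : SmoothPair V G)
    {e e' : OpenPartialHomeomorph N V} (he : e ∈ atlas V N) (he' : e' ∈ atlas V N)
    (X : Field V N) :
    EqOn (twoPoint e e' (along (rightField X) G))
      (fun y ↦ fderiv ℝ (twoPoint e e' G) y (0, X.inChart e' y.2)) (e.target ×ˢ e'.target) :=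
  fun _ hy ↦ along_rightField_chart he he' hy (hG.mdifferentiableAt _) X

lemma isOpen_target_prod (e e' : OpenPartialHomeomorph N V) : IsOpen (e.target ×ˢ e'.target) :=
  e.open_target.prod e'.open_target

lemma SmoothPair.along_leftField {G : N × N → ℝ} (hG : SmoothPair V G) {X : Field V N}
    (hX : X.IsSmooth) : SmoothPair V (along (leftField X) G) := by
  refine smoothPair_of_contDiffOn_twoPoint fun e he e' he' ↦ ?_
  refine ContDiffOn.congr ?_ (hG.twoPoint_along_leftField he he' X)
  refine ((hG.contDiffOn_twoPoint he he').fderiv_of_isOpen (isOpen_target_prod e e') (m := ∞)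
    (by simp)).clm_apply (ContDiffOn.prodMk ?_ contDiffOn_const)
  exact (hX.contDiffOn_inChart he).comp contDiff_fst.contDiffOn fun y hy ↦ hy.1

lemma SmoothPair.along_rightField {G : N × N → ℝ} (hG : SmoothPair V G) {X : Field V N}
    (hX : X.IsSmooth) : SmoothPair V (along (rightField X) G) := by
  refine smoothPair_of_contDiffOn_twoPoint fun e he e' he' ↦ ?_
  refine ContDiffOn.congr ?_ (hG.twoPoint_along_rightField he he' X)
  refine ((hG.contDiffOn_twoPoint he he').fderiv_of_isOpen (isOpen_target_prod e e') (m := ∞)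
    (by simp)).clm_apply (ContDiffOn.prodMk contDiffOn_const ?_)
  exact (hX.contDiffOn_inChart he').comp contDiff_snd.contDiffOn fun y hy ↦ hy.2

lemma SmoothPair.sub {F G : N × N → ℝ} (hF : SmoothPair V F) (hG : SmoothPair V G) :
    SmoothPair V (fun z ↦ F z - G z) :=
  ContMDiff.sub hF hG

lemma SmoothPair.swap {G : N × N → ℝ} (hG : SmoothPair V G) :
    SmoothPair V (fun z ↦ G z.swap) :=
  hG.comp (contMDiff_snd.prodMk contMDiff_fst)

lemma along_sub {F G : N × N → ℝ} (hF : SmoothPair V F) (hG : SmoothPair V G)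
    (Z : ∀ z : N × N, TangentSpace (𝓘(ℝ, V).prod 𝓘(ℝ, V)) z) (z : N × N) :
    along Z (fun z ↦ F z - G z) z = along Z F z - along Z G z := by
  simp only [along]
  rw [show (fun z ↦ F z - G z) = F - G from rfl,
    mvfderiv_sub (hF.mdifferentiableAt z) (hG.mdifferentiableAt z)]
  rfl

lemma hasMFDerivAt_swap (z : N × N) :
    HasMFDerivAt (𝓘(ℝ, V).prod 𝓘(ℝ, V)) (𝓘(ℝ, V).prod 𝓘(ℝ, V)) (Prod.swap : N × N → N × N) z
      ((ContinuousLinearMap.snd ℝ V V).prod (ContinuousLinearMap.fst ℝ V V)) :=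
  HasMFDerivAt.prodMk (hasMFDerivAt_snd (I := 𝓘(ℝ, V)) (I' := 𝓘(ℝ, V)) z)
    (hasMFDerivAt_fst (I := 𝓘(ℝ, V)) (I' := 𝓘(ℝ, V)) z)

lemma along_leftField_swap {G : N × N → ℝ} (hG : SmoothPair V G) (X : Field V N) :
    along (leftField X) (fun z ↦ G z.swap) = fun z ↦ along (rightField X) G z.swap := by
  funext z
  have h := (hG.mdifferentiableAt z.swap).hasMFDerivAt.comp z (hasMFDerivAt_swap z)
  exact DFunLike.congr_fun (HasMFDerivAt.mfderiv h)
    ((X z.1, 0) : TangentSpace 𝓘(ℝ, V) z.1 × TangentSpace 𝓘(ℝ, V) z.2)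

lemma along_rightField_swap {G : N × N → ℝ} (hG : SmoothPair V G) (X : Field V N) :
    along (rightField X) (fun z ↦ G z.swap) = fun z ↦ along (leftField X) G z.swap := by
  funext z
  have h := (hG.mdifferentiableAt z.swap).hasMFDerivAt.comp z (hasMFDerivAt_swap z)
  exact DFunLike.congr_fun (HasMFDerivAt.mfderiv h)
    ((0, X z.2) : TangentSpace 𝓘(ℝ, V) z.1 × TangentSpace 𝓘(ℝ, V) z.2)

lemma hasMFDerivAt_diag (x : N) :
    HasMFDerivAt 𝓘(ℝ, V) (𝓘(ℝ, V).prod 𝓘(ℝ, V)) (fun x : N ↦ (x, x)) x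
      ((ContinuousLinearMap.id ℝ V).prod (ContinuousLinearMap.id ℝ V)) :=
  HasMFDerivAt.prodMk (hasMFDerivAt_id (I := 𝓘(ℝ, V)) x) (hasMFDerivAt_id (I := 𝓘(ℝ, V)) x)

/-- The derivative of the restriction of a two-point function to the diagonal. -/
lemma mvfderiv_diag {G : N × N → ℝ} (hG : SmoothPair V G) (X : Field V N) (x : N) :
    mvfderiv 𝓘(ℝ, V) (fun y ↦ G (y, y)) x (X x) =
      along (leftField X) G (x, x) + along (rightField X) G (x, x) := by
  have h := HasMFDerivAt.comp (f := fun x : N ↦ (x, x)) x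
    (hG.mdifferentiableAt (x, x)).hasMFDerivAt (hasMFDerivAt_diag x)
  have h1 : mvfderiv 𝓘(ℝ, V) (fun y ↦ G (y, y)) x (X x) =
      mvfderiv (𝓘(ℝ, V).prod 𝓘(ℝ, V)) G (x, x)
        ((X x, X x) : TangentSpace 𝓘(ℝ, V) x × TangentSpace 𝓘(ℝ, V) x) :=
    DFunLike.congr_fun (HasMFDerivAt.mfderiv h) (X x)
  rw [h1]
  let D : V × V →L[ℝ] ℝ := mvfderiv (𝓘(ℝ, V).prod 𝓘(ℝ, V)) G (x, x)
  change D ((X x : V), (X x : V)) = D ((X x : V), (0 : V)) + D ((0 : V), (X x : V))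
  have h2 : ∀ u : V, D (u, u) = D (u, 0) + D (0, u) := fun u ↦ by
    rw [← map_add, Prod.mk_add_mk, add_zero, zero_add]
  exact h2 _

end TwoPoint

/-! ### Mixed derivatives of two-point functions -/

section MixedHessian

variable {V : Type*} [NormedAddCommGroup V] [NormedSpace ℝ V]

/-- The mixed second derivative `(u, v) ↦ D²f((u, 0), (0, v))` of a function on `V × V`. -/
def mixedHess (f : V × V → ℝ) (y : V × V) : V →L[ℝ] V →L[ℝ] ℝ :=
  ((ContinuousLinearMap.compL ℝ V (V × V) ℝ).flip (ContinuousLinearMap.inr ℝ V V)).comp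
    ((fderiv ℝ (fderiv ℝ f) y).comp (ContinuousLinearMap.inl ℝ V V))

lemma mixedHess_apply (f : V × V → ℝ) (y : V × V) (u v : V) :
    mixedHess f y u v = fderiv ℝ (fderiv ℝ f) y (u, 0) (0, v) := by
  simp [mixedHess]

variable {f : V × V → ℝ} {U : Set (V × V)}

lemma contDiffOn_mixedHess (hU : IsOpen U) (hf : ContDiffOn ℝ ∞ f U) :
    ContDiffOn ℝ ∞ (mixedHess f) U := by
  have h1 : ContDiffOn ℝ ∞ (fderiv ℝ (fderiv ℝ f)) U :=
    (hf.fderiv_of_isOpen hU (m := ∞) (by simp)).fderiv_of_isOpen hU (by simp)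
  exact contDiffOn_const.clm_comp (h1.clm_comp contDiffOn_const)

lemma differentiableAt_fderiv (hU : IsOpen U) (hf : ContDiffOn ℝ ∞ f U) {y : V × V} (hy : y ∈ U) :
    DifferentiableAt ℝ (fderiv ℝ f) y :=
  ((hf.fderiv_of_isOpen hU (m := ∞) (by simp)).contDiffAt (hU.mem_nhds hy)).differentiableAt
    (by simp)

lemma fderiv_fderiv_right (hU : IsOpen U) (hf : ContDiffOn ℝ ∞ f U) {B : V → V} {y : V × V}
    (hy : y ∈ U) (hB : DifferentiableAt ℝ B y.2) (a : V) :
    fderiv ℝ (fun z : V × V ↦ fderiv ℝ f z (0, B z.2)) y (a, 0) = mixedHess f y a (B y.2) := by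
  have h1 : HasFDerivAt (fun z : V × V ↦ ((0 : V), B z.2))
      ((0 : V × V →L[ℝ] V).prod ((fderiv ℝ B y.2).comp (ContinuousLinearMap.snd ℝ V V))) y :=
    (hasFDerivAt_const _ _).prodMk (hB.hasFDerivAt.comp y hasFDerivAt_snd)
  rw [((differentiableAt_fderiv hU hf hy).hasFDerivAt.clm_apply h1).fderiv, mixedHess_apply]
  simp [← Prod.zero_eq_mk]

lemma fderiv_fderiv_left (hU : IsOpen U) (hf : ContDiffOn ℝ ∞ f U) {A : V → V} {y : V × V}
    (hy : y ∈ U) (hA : DifferentiableAt ℝ A y.1) (b : V) :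
    fderiv ℝ (fun z : V × V ↦ fderiv ℝ f z (A z.1, 0)) y (0, b) = mixedHess f y (A y.1) b := by
  have h1 : HasFDerivAt (fun z : V × V ↦ (A z.1, (0 : V)))
      (((fderiv ℝ A y.1).comp (ContinuousLinearMap.fst ℝ V V)).prod (0 : V × V →L[ℝ] V)) y :=
    (hA.hasFDerivAt.comp y hasFDerivAt_fst).prodMk (hasFDerivAt_const _ _)
  rw [((differentiableAt_fderiv hU hf hy).hasFDerivAt.clm_apply h1).fderiv, mixedHess_apply]
  have hs := ((hf.contDiffAt (hU.mem_nhds hy)).isSymmSndFDerivAt minSmoothness_two_le_infty).eq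
    (0, b) (A y.1, 0)
  simpa [← Prod.zero_eq_mk] using hs

/-- The product rule for `∂₁∂₂f(A, B)`. -/
lemma fderiv_mixedHess_apply (hU : IsOpen U) (hf : ContDiffOn ℝ ∞ f U) {A B : V → V} {y : V × V}
    (hy : y ∈ U) (hA : DifferentiableAt ℝ A y.1) (hB : DifferentiableAt ℝ B y.2) (w : V × V) :
    fderiv ℝ (fun z : V × V ↦ mixedHess f z (A z.1) (B z.2)) y w =
      fderiv ℝ (mixedHess f) y w (A y.1) (B y.2) + mixedHess f y (fderiv ℝ A y.1 w.1) (B y.2) +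
        mixedHess f y (A y.1) (fderiv ℝ B y.2 w.2) := by
  have hH : HasFDerivAt (mixedHess f) (fderiv ℝ (mixedHess f) y) y :=
    (((contDiffOn_mixedHess hU hf).contDiffAt (hU.mem_nhds hy)).differentiableAt
      (by simp)).hasFDerivAt
  have h1 := hA.hasFDerivAt.comp y hasFDerivAt_fst
  have h2 := hB.hasFDerivAt.comp y hasFDerivAt_snd
  have h3 : HasFDerivAt (fun z : V × V ↦ mixedHess f z (A z.1) (B z.2)) _ y :=
    (hH.clm_apply h1).clm_apply h2
  rw [h3.fderiv]
  simp
  ring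

/-- If the first derivative of `f` vanishes on the diagonal, then its mixed second derivative is
symmetric there. -/
lemma mixedHess_diag_symm {T : Set V} (hT : IsOpen T) (hf : ContDiffOn ℝ ∞ f (T ×ˢ T))
    (hd : ∀ y ∈ T, fderiv ℝ f (y, y) = 0) {y : V} (hy : y ∈ T) (u v : V) :
    mixedHess f (y, y) u v = mixedHess f (y, y) v u := by
  have hU := hT.prod hT
  have hyy : (y, y) ∈ T ×ˢ T := ⟨hy, hy⟩
  -- Differentiating `Df(y, y) = 0` gives `D²f(w, w) = 0`, so `D²f(w, 0) = -D²f(0, w)`.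
  have hz : ∀ w : V, fderiv ℝ (fderiv ℝ f) (y, y) (w, w) = 0 := by
    intro w
    have h1 : HasFDerivAt (fun y : V ↦ (y, y))
        ((ContinuousLinearMap.id ℝ V).prod (ContinuousLinearMap.id ℝ V)) y :=
      (hasFDerivAt_id y).prodMk (hasFDerivAt_id y)
    have h2 : HasFDerivAt (fun y : V ↦ fderiv ℝ f (y, y)) _ y :=
      HasFDerivAt.comp y (g := fderiv ℝ f) (f := fun y : V ↦ (y, y))
        (differentiableAt_fderiv hU hf hyy).hasFDerivAt h1
    have h3 : (fun y : V ↦ fderiv ℝ f (y, y)) =ᶠ[𝓝 y] fun _ ↦ 0 := by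
      filter_upwards [hT.mem_nhds hy] with z hz using hd z hz
    have h4 := h2.unique ((hasFDerivAt_const (0 : V × V →L[ℝ] ℝ) y).congr_of_eventuallyEq h3)
    exact DFunLike.congr_fun h4 w
  have hsplit : ∀ w : V, fderiv ℝ (fderiv ℝ f) (y, y) (w, 0) =
      -fderiv ℝ (fderiv ℝ f) (y, y) (0, w) := by
    intro w
    rw [eq_neg_iff_add_eq_zero, ← map_add, Prod.mk_add_mk, add_zero, zero_add, hz]
  have hs := ((hf.contDiffAt (hU.mem_nhds hyy)).isSymmSndFDerivAt minSmoothness_two_le_infty).eq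
    (0, u) (0, v)
  rw [mixedHess_apply, mixedHess_apply, hsplit, hsplit]
  simpa using hs

end MixedHessian

/-! ### Brackets of vector fields in charts -/

section Brackets

variable {V : Type*} [NormedAddCommGroup V] [NormedSpace ℝ V]
  {N : Type*} [TopologicalSpace N] [ChartedSpace V N] [IsManifold 𝓘(ℝ, V) ∞ N]

lemma Field.IsSmooth.differentiableAt_inChart {X : Field V N} (hX : X.IsSmooth)
    {e : OpenPartialHomeomorph N V} (he : e ∈ atlas V N) {y : V} (hy : y ∈ e.target) :
    DifferentiableAt ℝ (X.inChart e) y :=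
  ((hX.contDiffOn_inChart he).contDiffAt (e.open_target.mem_nhds hy)).differentiableAt (by simp)

variable {F : N × N → ℝ} {e e' : OpenPartialHomeomorph N V}

lemma along_left_along_right_chart (hF : SmoothPair V F) (he : e ∈ atlas V N)
    (he' : e' ∈ atlas V N) (X : Field V N) {Y : Field V N} (hY : Y.IsSmooth) :
    EqOn (twoPoint e e' (along (leftField X) (along (rightField Y) F)))
      (fun y ↦ mixedHess (twoPoint e e' F) y (X.inChart e y.1) (Y.inChart e' y.2))
      (e.target ×ˢ e'.target) := by
  intro y hy
  have hU := isOpen_target_prod e e'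
  rw [(hF.along_rightField hY).twoPoint_along_leftField he he' X hy]
  simp only
  rw [((hF.twoPoint_along_rightField he he' Y).eventuallyEq_of_mem (hU.mem_nhds hy)).fderiv_eq,
    fderiv_fderiv_right hU (hF.contDiffOn_twoPoint he he') hy
      (hY.differentiableAt_inChart he' hy.2)]

lemma along_right_along_left_chart (hF : SmoothPair V F) (he : e ∈ atlas V N)
    (he' : e' ∈ atlas V N) {X : Field V N} (hX : X.IsSmooth) (Y : Field V N) :
    EqOn (twoPoint e e' (along (rightField Y) (along (leftField X) F)))
      (fun y ↦ mixedHess (twoPoint e e' F) y (X.inChart e y.1) (Y.inChart e' y.2))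
      (e.target ×ˢ e'.target) := by
  intro y hy
  have hU := isOpen_target_prod e e'
  rw [(hF.along_leftField hX).twoPoint_along_rightField he he' Y hy]
  simp only
  rw [((hF.twoPoint_along_leftField he he' X).eventuallyEq_of_mem (hU.mem_nhds hy)).fderiv_eq,
    fderiv_fderiv_left hU (hF.contDiffOn_twoPoint he he') hy
      (hX.differentiableAt_inChart he hy.1)]

lemma bracket_two_one_chart (hF : SmoothPair V F) (he : e ∈ atlas V N)
    (he' : e' ∈ atlas V N) (X : Field V N) {Y Z : Field V N} (hY : Y.IsSmooth)
    (hZ : Z.IsSmooth) {y : V × V} (hy : y ∈ e.target ×ˢ e'.target) :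
    bracket F [X, Y] [Z] (e.symm y.1, e'.symm y.2) =
      fderiv ℝ (mixedHess (twoPoint e e' F)) y (X.inChart e y.1, 0) (Y.inChart e y.1)
        (Z.inChart e' y.2) +
      mixedHess (twoPoint e e' F) y (fderiv ℝ (Y.inChart e) y.1 (X.inChart e y.1))
        (Z.inChart e' y.2) := by
  have hU := isOpen_target_prod e e'
  have h1 := ((hF.along_rightField hZ).along_leftField hY).twoPoint_along_leftField he he' X hy
  change bracket F [X, Y] [Z] (e.symm y.1, e'.symm y.2) = _ at h1
  rw [h1]
  simp only
  rw [((along_left_along_right_chart hF he he' Y hZ).eventuallyEq_of_mem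
    (hU.mem_nhds hy)).fderiv_eq, fderiv_mixedHess_apply hU (hF.contDiffOn_twoPoint he he') hy
      (hY.differentiableAt_inChart he hy.1) (hZ.differentiableAt_inChart he' hy.2)]
  simp

end Brackets

/-! ### Symmetries of brackets -/

section BracketIdentities

variable {V : Type*} [NormedAddCommGroup V] [NormedSpace ℝ V]
  {N : Type*} [TopologicalSpace N] [ChartedSpace V N] [IsManifold 𝓘(ℝ, V) ∞ N]
  {F : N × N → ℝ}

/-- Vector fields on different factors commute, by the symmetry of second derivatives. -/
lemma along_left_right_comm (hF : SmoothPair V F) {X Y : Field V N} (hX : X.IsSmooth)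
    (hY : Y.IsSmooth) :
    along (leftField X) (along (rightField Y) F) = along (rightField Y) (along (leftField X) F) := by
  funext z
  have he := chart_mem_atlas V z.1
  have he' := chart_mem_atlas V z.2
  have hz : (chartAt V z.1 z.1, chartAt V z.2 z.2) ∈
      (chartAt V z.1).target ×ˢ (chartAt V z.2).target :=
    ⟨mem_chart_target V z.1, mem_chart_target V z.2⟩
  have h1 := (along_left_along_right_chart hF he he' X hY hz).trans
    (along_right_along_left_chart hF he he' hX Y hz).symm
  simpa only [twoPoint, (chartAt V z.1).left_inv (mem_chart_source V z.1),
    (chartAt V z.2).left_inv (mem_chart_source V z.2)] using h1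

lemma bracket_one_two_chart (hF : SmoothPair V F) {e e' : OpenPartialHomeomorph N V}
    (he : e ∈ atlas V N) (he' : e' ∈ atlas V N) {X Y Z : Field V N} (hX : X.IsSmooth)
    (hY : Y.IsSmooth) (hZ : Z.IsSmooth) {y : V × V} (hy : y ∈ e.target ×ˢ e'.target) :
    bracket F [X] [Y, Z] (e.symm y.1, e'.symm y.2) =
      fderiv ℝ (mixedHess (twoPoint e e' F)) y (0, Y.inChart e' y.2) (X.inChart e y.1)
        (Z.inChart e' y.2) +
      mixedHess (twoPoint e e' F) y (X.inChart e y.1)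
        (fderiv ℝ (Z.inChart e') y.2 (Y.inChart e' y.2)) := by
  have hU := isOpen_target_prod e e'
  have h0 : bracket F [X] [Y, Z] =
      along (rightField Y) (along (leftField X) (along (rightField Z) F)) :=
    along_left_right_comm (hF.along_rightField hZ) hX hY
  have h1 := ((hF.along_rightField hZ).along_leftField hX).twoPoint_along_rightField he he' Y hy
  rw [← h0] at h1
  change bracket F [X] [Y, Z] (e.symm y.1, e'.symm y.2) = _ at h1
  rw [h1]
  simp only
  rw [((along_left_along_right_chart hF he he' X hZ).eventuallyEq_of_mem
    (hU.mem_nhds hy)).fderiv_eq, fderiv_mixedHess_apply hU (hF.contDiffOn_twoPoint he he') hy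
      (hX.differentiableAt_inChart he hy.1) (hZ.differentiableAt_inChart he' hy.2)]
  simp

lemma bracket_swap_one_one (hF : SmoothPair V F) {X Y : Field V N} (hX : X.IsSmooth)
    (hY : Y.IsSmooth) :
    bracket (fun z ↦ F z.swap) [X] [Y] = fun z ↦ bracket F [Y] [X] z.swap := by
  change along (leftField X) (along (rightField Y) fun z ↦ F z.swap) =
    fun z ↦ along (leftField Y) (along (rightField X) F) z.swap
  rw [along_rightField_swap hF, along_leftField_swap (hF.along_leftField hY),
    along_left_right_comm hF hY hX]

/-- `F*[XY|Z] = F[Z|XY]` with arguments exchanged. -/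
lemma bracket_swap_two_one (hF : SmoothPair V F) {X Y Z : Field V N} (hX : X.IsSmooth)
    (hY : Y.IsSmooth) (hZ : Z.IsSmooth) :
    bracket (fun z ↦ F z.swap) [X, Y] [Z] = fun z ↦ bracket F [Z] [X, Y] z.swap := by
  change along (leftField X) (along (leftField Y) (along (rightField Z) fun z ↦ F z.swap)) =
    fun z ↦ along (leftField Z) (along (rightField X) (along (rightField Y) F)) z.swap
  rw [along_rightField_swap hF, along_leftField_swap (hF.along_leftField hZ),
    along_leftField_swap ((hF.along_leftField hZ).along_rightField hY),
    along_left_right_comm (hF.along_rightField hY) hZ hX, along_left_right_comm hF hZ hY]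

/-- The derivative of `x ↦ F[Y|Z](x, x)`. -/
lemma mvfderiv_bracket_diag (hF : SmoothPair V F) {X Y Z : Field V N} (hX : X.IsSmooth)
    (hY : Y.IsSmooth) (hZ : Z.IsSmooth) (x : N) :
    mvfderiv 𝓘(ℝ, V) (fun y ↦ bracket F [Y] [Z] (y, y)) x (X x) =
      bracket F [X, Y] [Z] (x, x) + bracket F [Y] [X, Z] (x, x) := by
  have hG : SmoothPair V (bracket F [Y] [Z]) := (hF.along_rightField hZ).along_leftField hY
  rw [mvfderiv_diag hG X x]
  have h0 : bracket F [Y] [X, Z] =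
      along (rightField X) (along (leftField Y) (along (rightField Z) F)) :=
    along_left_right_comm (hF.along_rightField hZ) hY hX
  rw [h0]
  rfl

end BracketIdentities

/-! ### Existence of the induced tensor fields -/

section TensorExistence

variable {V : Type*} [NormedAddCommGroup V] [NormedSpace ℝ V]

variable (V) in
/-- Bilinear forms as multilinear forms. -/
def bilinToMultilin : (V →L[ℝ] V →L[ℝ] ℝ) →L[ℝ] (V [×2]→L[ℝ] ℝ) :=
  ((continuousMultilinearCurryLeftEquiv ℝ (fun _ : Fin 2 ↦ V) ℝ).symm :
      (V →L[ℝ] (V [×1]→L[ℝ] ℝ)) →L[ℝ] (V [×2]→L[ℝ] ℝ)).comp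
    (ContinuousLinearMap.compL ℝ V (V →L[ℝ] ℝ) (V [×1]→L[ℝ] ℝ)
      ((continuousMultilinearCurryFin1 ℝ V ℝ).symm : (V →L[ℝ] ℝ) →L[ℝ] (V [×1]→L[ℝ] ℝ)))

variable (V) in
/-- Trilinear forms as multilinear forms. -/
def trilinToMultilin : (V →L[ℝ] V →L[ℝ] V →L[ℝ] ℝ) →L[ℝ] (V [×3]→L[ℝ] ℝ) :=
  ((continuousMultilinearCurryLeftEquiv ℝ (fun _ : Fin 3 ↦ V) ℝ).symm :
      (V →L[ℝ] (V [×2]→L[ℝ] ℝ)) →L[ℝ] (V [×3]→L[ℝ] ℝ)).comp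
    (ContinuousLinearMap.compL ℝ V (V →L[ℝ] V →L[ℝ] ℝ) (V [×2]→L[ℝ] ℝ) (bilinToMultilin V))

variable [FiniteDimensional ℝ V]
  {N : Type*} [TopologicalSpace N] [ChartedSpace V N] [IsManifold 𝓘(ℝ, V) ∞ N] [T2Space N]

lemma exists_smoothField_apply_eq (x : N) (u : TangentSpace 𝓘(ℝ, V) x) :
    ∃ X : Field V N, X.IsSmooth ∧ X x = u := by
  have hx := mem_chart_source V x
  have he := chart_mem_atlas V x
  obtain ⟨X, hX, hXe⟩ := exists_smoothField_eventuallyEq_const he hx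
    (mfderiv 𝓘(ℝ, V) 𝓘(ℝ, V) (chartAt V x) x u)
  refine ⟨X, hX, ?_⟩
  have h1 := hXe.self_of_nhds
  rw [Field.inChart_apply X hx] at h1
  exact (chart_mdifferentiable he).mfderiv_injective hx h1

lemma exists_smoothField_inChart_eq {e : OpenPartialHomeomorph N V} (he : e ∈ atlas V N) {y : V}
    (hy : y ∈ e.target) (v : V) :
    ∃ X : Field V N, X.IsSmooth ∧ X.inChart e =ᶠ[𝓝 y] fun _ ↦ v := by
  obtain ⟨X, hX, hXe⟩ := exists_smoothField_eventuallyEq_const he (e.map_target hy) v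
  rw [e.right_inv hy] at hXe
  exact ⟨X, hX, hXe⟩

/-- A tensor field may be constructed from its components `κ e` in each chart `e`, provided these
represent a chart-independent expression `b` in smooth vector fields. -/
lemma exists_covTensor_of_charts {k : ℕ} (κ : OpenPartialHomeomorph N V → V → V [×k]→L[ℝ] ℝ)
    (hκ : ∀ e ∈ atlas V N, ContDiffOn ℝ ∞ (κ e) e.target)
    (b : (Fin k → Field V N) → N → ℝ)
    (hb : ∀ e ∈ atlas V N, ∀ X : Fin k → Field V N, (∀ i, (X i).IsSmooth) → ∀ y ∈ e.target,
      κ e y (fun i ↦ (X i).inChart e y) = b X (e.symm y)) :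
    ∃ K : CovTensor V N k, K.IsSmooth ∧
      ∀ X : Fin k → Field V N, (∀ i, (X i).IsSmooth) → ∀ x, K x (fun i ↦ X i x) = b X x := by
  let K : CovTensor V N k := fun x ↦
    (κ (chartAt V x) (chartAt V x x)).compContinuousLinearMap fun _ ↦
      mfderiv 𝓘(ℝ, V) 𝓘(ℝ, V) (chartAt V x) x
  have hK : ∀ X : Fin k → Field V N, (∀ i, (X i).IsSmooth) → ∀ x, K x (fun i ↦ X i x) = b X x := by
    intro X hX x
    have h1 := hb _ (chart_mem_atlas V x) X hX _ (mem_chart_target V x)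
    rw [(chartAt V x).left_inv (mem_chart_source V x)] at h1
    rw [← h1]
    change κ (chartAt V x) (chartAt V x x) _ = _
    congr 1
    funext i
    exact ((X i).inChart_apply (mem_chart_source V x)).symm
  refine ⟨K, fun e he ↦ (hκ e he).congr fun y hy ↦ ?_, hK⟩
  ext w
  choose X hX hXe using fun i ↦ exists_smoothField_inChart_eq he hy (w i)
  have h1 := hb e he X hX y hy
  rw [← hK X hX] at h1
  have h2 : (fun i ↦ (X i).inChart e y) = w := funext fun i ↦ (hXe i).self_of_nhds
  rw [← h2, h1]
  change K (e.symm y) _ = K (e.symm y) _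
  congr 1
  funext i
  exact (X i).mfderiv_symm_inChart he hy

lemma contDiffOn_diag {W : Type*} [NormedAddCommGroup W] [NormedSpace ℝ W] {T : Set V}
    {f : V × V → W} (hf : ContDiffOn ℝ ∞ f (T ×ˢ T)) : ContDiffOn ℝ ∞ (fun y ↦ f (y, y)) T :=
  hf.comp (contDiff_id.prodMk contDiff_id).contDiffOn fun _ hy ↦ ⟨hy, hy⟩

lemma bracket_one_one_chart {F : N × N → ℝ} (hF : SmoothPair V F)
    {e : OpenPartialHomeomorph N V} (he : e ∈ atlas V N) (X : Field V N) {Y : Field V N}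
    (hY : Y.IsSmooth) {y : V} (hy : y ∈ e.target) :
    bracket F [X] [Y] (e.symm y, e.symm y) =
      mixedHess (twoPoint e e F) (y, y) (X.inChart e y) (Y.inChart e y) :=
  along_left_along_right_chart hF he he X hY (x := (y, y)) ⟨hy, hy⟩

/-- The mixed second derivatives of a smooth two-point function along the diagonal form a tensor
field. -/
lemma exists_inducedMetric {F : N × N → ℝ} (hF : SmoothPair V F) :
    ∃ g : CovTensor V N 2, g.IsSmooth ∧ IsInducedMetric F g := by
  obtain ⟨g, hg, hgX⟩ := exists_covTensor_of_charts (N := N) (k := 2)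
    (fun e y ↦ -bilinToMultilin V (mixedHess (twoPoint e e F) (y, y)))
    (fun e he ↦ ((bilinToMultilin V).contDiff.comp_contDiffOn (contDiffOn_diag
      (contDiffOn_mixedHess (isOpen_target_prod e e) (hF.contDiffOn_twoPoint he he)))).neg)
    (fun X x ↦ -bracket F [X 0] [X 1] (x, x))
    (fun e he X hX y hy ↦ by
      rw [bracket_one_one_chart hF he _ (hX 1) hy]
      rfl)
  refine ⟨g, hg, fun X Y hX hY x ↦ ?_⟩
  have h1 := hgX ![X, Y] (fun i ↦ by fin_cases i; exacts [hX, hY]) x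
  refine Eq.trans (congrArg _ ?_) h1
  funext i
  fin_cases i <;> rfl

/-- If the mixed second derivatives of a two-point function vanish along the diagonal, then its
third derivatives `[X|YZ]` form a tensor field. -/
lemma exists_inducedSkewness {F : N × N → ℝ} (hF : SmoothPair V F)
    (h0 : ∀ X Y : Field V N, X.IsSmooth → Y.IsSmooth → ∀ x : N, bracket F [X] [Y] (x, x) = 0) :
    ∃ T : CovTensor V N 3, T.IsSmooth ∧ ∀ X Y Z : Field V N, X.IsSmooth → Y.IsSmooth →
      Z.IsSmooth → ∀ x : N, T x ![X x, Y x, Z x] = bracket F [X] [Y, Z] (x, x) := by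
  obtain ⟨T, hT, hTX⟩ := exists_covTensor_of_charts (N := N) (k := 3)
    (fun e y ↦ trilinToMultilin V (((fderiv ℝ (mixedHess (twoPoint e e F)) (y, y)).comp
      (ContinuousLinearMap.inr ℝ V V)).flip))
    (fun e he ↦ (trilinToMultilin V).contDiff.comp_contDiffOn
      ((ContinuousLinearMap.flipₗᵢ ℝ V V (V →L[ℝ] ℝ)).contDiff.comp_contDiffOn
        ((contDiffOn_diag ((contDiffOn_mixedHess (isOpen_target_prod e e)
          (hF.contDiffOn_twoPoint he he)).fderiv_of_isOpen (isOpen_target_prod e e) (m := ∞)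
            (by simp))).clm_comp contDiffOn_const)))
    (fun X x ↦ bracket F [X 0] [X 1, X 2] (x, x))
    (fun e he X hX y hy ↦ by
      have h1 := bracket_one_two_chart hF he he (hX 0) (hX 1) (hX 2) (y := (y, y)) ⟨hy, hy⟩
      -- The term that is not tensorial involves only the mixed Hessian, which vanishes.
      have h2 : mixedHess (twoPoint e e F) (y, y) ((X 0).inChart e y)
          (fderiv ℝ ((X 2).inChart e) y ((X 1).inChart e y)) = 0 := by
        obtain ⟨W, hW, hWe⟩ := exists_smoothField_inChart_eq he hy
          (fderiv ℝ ((X 2).inChart e) y ((X 1).inChart e y))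
        have h3 := bracket_one_one_chart hF he (X 0) hW hy
        rwa [h0 _ _ (hX 0) hW, hWe.self_of_nhds, eq_comm] at h3
      rw [h1, h2, add_zero]
      rfl)
  refine ⟨T, hT, fun X Y Z hX hY hZ x ↦ ?_⟩
  have h1 := hTX ![X, Y, Z] (fun i ↦ by fin_cases i; exacts [hX, hY, hZ]) x
  refine Eq.trans (congrArg _ ?_) h1
  funext i
  fin_cases i <;> rfl

end TensorExistence

/-! ### Existence of the induced connections -/

section ConnectionExistence

variable {V : Type*} [NormedAddCommGroup V] [NormedSpace ℝ V] [FiniteDimensional ℝ V]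

lemma isInvertible_of_forall_apply_eq_zero {B : V →L[ℝ] V →L[ℝ] ℝ}
    (hB : ∀ u, (∀ v, B u v = 0) → u = 0) : B.IsInvertible := by
  have hinj : Function.Injective (B : V →ₗ[ℝ] V →L[ℝ] ℝ) := by
    rw [← LinearMap.ker_eq_bot, LinearMap.ker_eq_bot']
    exact fun u hu ↦ hB u fun v ↦ DFunLike.congr_fun hu v
  have hdim : Module.finrank ℝ V = Module.finrank ℝ (V →L[ℝ] ℝ) := by
    rw [← (LinearMap.toContinuousLinearMap (𝕜 := ℝ) (E := V) (F' := ℝ)).finrank_eq]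
    exact Subspace.dual_finrank_eq.symm
  exact ⟨((B : V →ₗ[ℝ] V →L[ℝ] ℝ).linearEquivOfInjective hinj hdim).toContinuousLinearEquiv,
    by ext; rfl⟩

variable {N : Type*} [TopologicalSpace N] [ChartedSpace V N] [IsManifold 𝓘(ℝ, V) ∞ N]

/-- The Christoffel form `Γ(u, v)` of the connection induced by a two-point function, in a chart: it
is determined by `∂₁∂₂F(Γ(u, v), w) = ∂₁∂₁∂₂F(u, v, w)` on the diagonal. It is meaningful where
`∂₁∂₂F` is invertible, and `0` elsewhere. -/
def christoffel (F : N × N → ℝ) (e : OpenPartialHomeomorph N V) (y : V) : V →L[ℝ] V →L[ℝ] V :=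
  (ContinuousLinearMap.compL ℝ V (V →L[ℝ] ℝ) V
      (mixedHess (twoPoint e e F) (y, y)).inverse).comp
    ((fderiv ℝ (mixedHess (twoPoint e e F)) (y, y)).comp (ContinuousLinearMap.inl ℝ V V))

lemma christoffel_apply (F : N × N → ℝ) (e : OpenPartialHomeomorph N V) (y u v : V) :
    christoffel F e y u v = (mixedHess (twoPoint e e F) (y, y)).inverse
      (fderiv ℝ (mixedHess (twoPoint e e F)) (y, y) (u, 0) v) :=
  rfl

/-- The covariant derivative `u ↦ D_u s + Γ(u, s)` of a vector field `s` in a chart. -/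
def chartCov (F : N × N → ℝ) (e : OpenPartialHomeomorph N V) (s : V → V) (y : V) : V →L[ℝ] V :=
  fderiv ℝ s y + (christoffel F e y).flip (s y)

lemma chartCov_apply (F : N × N → ℝ) (e : OpenPartialHomeomorph N V) (s : V → V) (y u : V) :
    chartCov F e s y u = fderiv ℝ s y u + christoffel F e y u (s y) :=
  rfl

/-- The operator `σ ↦ ∇σ` given at each point by the expression in the preferred chart there. Its
independence of the chart is only available when `∂₁∂₂F` is non-degenerate: see
`mfderiv_inducedCov`. -/
def inducedCov (F : N × N → ℝ) (σ : Field V N) (x : N) :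
    TangentSpace 𝓘(ℝ, V) x →L[ℝ] TangentSpace 𝓘(ℝ, V) x :=
  let L : V →L[ℝ] V := mfderiv 𝓘(ℝ, V) 𝓘(ℝ, V) (chartAt V x).symm (chartAt V x x)
  let R : V →L[ℝ] V := mfderiv 𝓘(ℝ, V) 𝓘(ℝ, V) (chartAt V x) x
  (L.comp ((chartCov F (chartAt V x) (σ.inChart (chartAt V x)) (chartAt V x x)).comp R) :
    V →L[ℝ] V)

lemma inducedCov_apply (F : N × N → ℝ) (X σ : Field V N) (x : N) :
    inducedCov F σ x (X x) =
      mfderiv 𝓘(ℝ, V) 𝓘(ℝ, V) (chartAt V x).symm (chartAt V x x)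
        (chartCov F (chartAt V x) (σ.inChart (chartAt V x)) (chartAt V x x)
          (X.inChart (chartAt V x) (chartAt V x x))) := by
  rw [X.inChart_apply (mem_chart_source V x)]
  rfl

/-- Differentiability of a section of the tangent bundle, in terms of its components in the chart. -/
lemma mdifferentiableAt_inChart {σ : Field V N} {x : N}
    (hσ : MDifferentiableAt 𝓘(ℝ, V) (𝓘(ℝ, V).prod 𝓘(ℝ, V)) (T% σ) x) :
    DifferentiableAt ℝ (σ.inChart (chartAt V x)) (chartAt V x x) := by
  rw [mdifferentiableAt_section] at hσ
  have hx := mem_chart_source V x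
  have he := chart_mem_atlas V x
  set e := chartAt V x with hedef
  have h1 : MDifferentiableAt 𝓘(ℝ, V) 𝓘(ℝ, V) (fun y ↦ (trivializationAt V
      (TangentSpace 𝓘(ℝ, V)) x ⟨e.symm y, σ (e.symm y)⟩).2) (e x) := by
    refine MDifferentiableAt.comp (g := fun b ↦ (trivializationAt V
      (TangentSpace 𝓘(ℝ, V)) x ⟨b, σ b⟩).2) (f := e.symm) (e x) ?_
      ((chart_mdifferentiable he).mdifferentiableAt_symm (e.map_source hx))
    rwa [e.left_inv hx]
  rw [mdifferentiableAt_iff_differentiableAt] at h1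
  refine h1.congr_of_eventuallyEq ?_
  filter_upwards [e.open_target.mem_nhds (e.map_source hx)] with y hy
  have h2 := TangentBundle.continuousLinearMapAt_trivializationAt (I := 𝓘(ℝ, V))
    (e.map_target hy : e.symm y ∈ (chartAt V x).source)
  have h3 := DFunLike.congr_fun h2 (σ (e.symm y))
  have hb : e.symm y ∈ (trivializationAt V (TangentSpace 𝓘(ℝ, V)) x).baseSet := by
    rw [TangentBundle.trivializationAt_baseSet]
    exact e.map_target hy
  rw [Bundle.Trivialization.continuousLinearMapAt_apply,
    Bundle.Trivialization.linearMapAt_apply, if_pos hb] at h3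
  rw [h3, Field.inChart]
  have h4 : (extChartAt 𝓘(ℝ, V) x : N → V) = e := by simp [hedef, mfld_simps]
  rw [h4]
  rfl

lemma mvfderiv_eq_fderiv_comp_symm {e : OpenPartialHomeomorph N V} (he : e ∈ atlas V N)
    {g : N → ℝ} {x : N} (hx : x ∈ e.source) (hg : MDifferentiableAt 𝓘(ℝ, V) 𝓘(ℝ, ℝ) g x)
    (u : TangentSpace 𝓘(ℝ, V) x) :
    mvfderiv 𝓘(ℝ, V) g x u =
      fderiv ℝ (g ∘ e.symm) (e x) (mfderiv 𝓘(ℝ, V) 𝓘(ℝ, V) e x u) := by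
  let D : V →L[ℝ] ℝ := mfderiv 𝓘(ℝ, V) 𝓘(ℝ, ℝ) g x
  have hD : HasMFDerivAt 𝓘(ℝ, V) 𝓘(ℝ, ℝ) g (e.symm (e x)) D := by
    rw [e.left_inv hx]
    exact hg.hasMFDerivAt
  have h1 := HasMFDerivAt.comp (e x) hD
    ((chart_mdifferentiable he).mdifferentiableAt_symm (e.map_source hx)).hasMFDerivAt
  have h2 : fderiv ℝ (g ∘ e.symm) (e x) = (_ : V →L[ℝ] ℝ) :=
    HasFDerivAt.fderiv (f := g ∘ e.symm) h1.hasFDerivAt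
  refine Eq.trans ?_ (congrArg (fun L : V →L[ℝ] ℝ ↦
    L (mfderiv 𝓘(ℝ, V) 𝓘(ℝ, V) e x u)) h2).symm
  change D u = D (mfderiv 𝓘(ℝ, V) 𝓘(ℝ, V) e.symm (e x) (mfderiv 𝓘(ℝ, V) 𝓘(ℝ, V) e x u) : V)
  congr 1
  exact (mfderiv_symm_mfderiv he hx u).symm

lemma chartCov_add (F : N × N → ℝ) (e : OpenPartialHomeomorph N V) {s s' : V → V} {y : V}
    (hs : DifferentiableAt ℝ s y) (hs' : DifferentiableAt ℝ s' y) :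
    chartCov F e (fun z ↦ s z + s' z) y = chartCov F e s y + chartCov F e s' y := by
  ext u
  simp only [add_apply, chartCov_apply]
  rw [fderiv_fun_add hs hs', map_add, add_apply]
  abel

lemma chartCov_smul (F : N × N → ℝ) (e : OpenPartialHomeomorph N V) {f : V → ℝ} {s : V → V} {y : V}
    (hf : DifferentiableAt ℝ f y) (hs : DifferentiableAt ℝ s y) :
    chartCov F e (fun z ↦ f z • s z) y =
      f y • chartCov F e s y + (fderiv ℝ f y).smulRight (s y) := by
  ext u
  simp only [add_apply, smul_apply, chartCov_apply, ContinuousLinearMap.smulRight_apply]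
  rw [fderiv_fun_smul hf hs, map_smul]
  simp only [add_apply, smul_apply, ContinuousLinearMap.smulRight_apply]
  rw [smul_add]
  abel

/-- The connection induced by a two-point function. The axioms of a connection are pointwise, so they
hold without any assumption on the function. -/
def inducedConnection (F : N × N → ℝ) : Connection V N where
  toFun := inducedCov F
  isCovariantDerivativeOnUniv :=
    { add := by
        intro σ σ' x hσ hσ' _
        have h1 : Field.inChart (σ + σ') (chartAt V x) =
            fun z ↦ Field.inChart σ (chartAt V x) z + Field.inChart σ' (chartAt V x) z :=
          funext fun z ↦ map_add (mfderiv 𝓘(ℝ, V) 𝓘(ℝ, V) (chartAt V x) ((chartAt V x).symm z)) _ _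
        have h2 := chartCov_add F (chartAt V x) (mdifferentiableAt_inChart hσ)
          (mdifferentiableAt_inChart hσ')
        rw [← h1] at h2
        ext u
        let L : V →L[ℝ] V := mfderiv 𝓘(ℝ, V) 𝓘(ℝ, V) (chartAt V x).symm (chartAt V x x)
        exact (congrArg (fun C : V →L[ℝ] V ↦
          L (C (mfderiv 𝓘(ℝ, V) 𝓘(ℝ, V) (chartAt V x) x u))) h2).trans (map_add L _ _)
      leibniz := by
        intro σ g x hσ hg _
        have hx := mem_chart_source V x
        have he := chart_mem_atlas V x
        have h1 : Field.inChart (g • σ) (chartAt V x) =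
            fun z ↦ (g ∘ (chartAt V x).symm) z • Field.inChart σ (chartAt V x) z :=
          funext fun z ↦ map_smul (mfderiv 𝓘(ℝ, V) 𝓘(ℝ, V) (chartAt V x)
            ((chartAt V x).symm z)) _ _
        have hg' : DifferentiableAt ℝ (g ∘ (chartAt V x).symm) (chartAt V x x) := by
          rw [← mdifferentiableAt_iff_differentiableAt]
          refine MDifferentiableAt.comp (I' := 𝓘(ℝ, V)) _ ?_
            ((chart_mdifferentiable he).mdifferentiableAt_symm (mem_chart_target V x))
          rwa [(chartAt V x).left_inv hx]
        have h2 := chartCov_smul F (chartAt V x) hg' (mdifferentiableAt_inChart hσ)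
        rw [← h1] at h2
        ext u
        let L : V →L[ℝ] V := mfderiv 𝓘(ℝ, V) 𝓘(ℝ, V) (chartAt V x).symm (chartAt V x x)
        refine (congrArg (fun C : V →L[ℝ] V ↦
          L (C (mfderiv 𝓘(ℝ, V) 𝓘(ℝ, V) (chartAt V x) x u))) h2).trans ?_
        have h3 : L (Field.inChart σ (chartAt V x) (chartAt V x x)) = σ x :=
          (Field.mfderiv_symm_inChart he σ (mem_chart_target V x)).trans (by
            rw [(chartAt V x).left_inv hx])
        refine (map_add L _ _).trans (congrArg₂ (· + ·) ?_ ?_)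
        · refine (map_smul L _ _).trans ?_
          rw [Function.comp_apply, (chartAt V x).left_inv hx]
          rfl
        · refine (map_smul L _ _).trans ?_
          rw [h3]
          exact congrArg (fun c : ℝ ↦ c • σ x) (mvfderiv_eq_fderiv_comp_symm he hx hg u).symm }

/-- `D` is the connection determined by `g(D_X Y, Z) = -F[XY|Z]`. -/
def IsInducedConnection (F : N × N → ℝ) (g : CovTensor V N 2) (D : Connection V N) : Prop :=
  ∀ X Y Z : Field V N, X.IsSmooth → Y.IsSmooth → Z.IsSmooth → ∀ x : N,
    g x ![D.apply X Y x, Z x] = -bracket F [X, Y] [Z] (x, x)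

variable [T2Space N]

section Nondegenerate

variable {F : N × N → ℝ} {g : CovTensor V N 2}

lemma exists_mfderiv_symm_eq {e : OpenPartialHomeomorph N V} (he : e ∈ atlas V N) {y : V}
    (hy : y ∈ e.target) (u : TangentSpace 𝓘(ℝ, V) (e.symm y)) :
    ∃ w : V, mfderiv 𝓘(ℝ, V) 𝓘(ℝ, V) e.symm y w = u ∧
      mfderiv 𝓘(ℝ, V) 𝓘(ℝ, V) e (e.symm y) u = w := by
  have h1 := mfderiv_symm_mfderiv he (e.map_target hy) u
  rw [e.right_inv hy] at h1
  exact ⟨_, h1, rfl⟩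

lemma metric_mfderiv_symm (hF : SmoothPair V F) (hgF : IsInducedMetric F g)
    {e : OpenPartialHomeomorph N V} (he : e ∈ atlas V N) {y : V} (hy : y ∈ e.target) (u v : V) :
    g (e.symm y) ![mfderiv 𝓘(ℝ, V) 𝓘(ℝ, V) e.symm y u, mfderiv 𝓘(ℝ, V) 𝓘(ℝ, V) e.symm y v] =
      -mixedHess (twoPoint e e F) (y, y) u v := by
  obtain ⟨X, hX, hXe⟩ := exists_smoothField_inChart_eq he hy u
  obtain ⟨Y, hY, hYe⟩ := exists_smoothField_inChart_eq he hy v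
  have h1 := hgF X Y hX hY (e.symm y)
  rw [bracket_one_one_chart hF he X hY hy, ← X.mfderiv_symm_inChart he hy,
    ← Y.mfderiv_symm_inChart he hy, hXe.self_of_nhds, hYe.self_of_nhds] at h1
  exact h1

/-- Up to sign, the mixed Hessian on the diagonal is the matrix of the metric. -/
lemma isInvertible_mixedHess (hF : SmoothPair V F) (hg : IsPseudoRiemannian g)
    (hgF : IsInducedMetric F g) {e : OpenPartialHomeomorph N V} (he : e ∈ atlas V N) {y : V}
    (hy : y ∈ e.target) : (mixedHess (twoPoint e e F) (y, y)).IsInvertible := by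
  refine isInvertible_of_forall_apply_eq_zero fun u hu ↦ ?_
  have h1 : mfderiv 𝓘(ℝ, V) 𝓘(ℝ, V) e.symm y u = 0 := by
    refine hg.nondegenerate _ _ fun v ↦ ?_
    obtain ⟨w, hw⟩ := exists_mfderiv_symm_eq he hy v
    have h2 := metric_mfderiv_symm hF hgF he hy u w
    rw [hw.1, hu, neg_zero] at h2
    exact h2
  have h2 := mfderiv_mfderiv_symm he hy u
  rw [h1] at h2
  exact h2.symm.trans (map_zero _)

/-- In a chart, `h(D_u s + Γ(u, s), w) = ∂₁∂₁∂₂F(u, s, w) + ∂₁∂₂F(D_u s, w)`, where `h = ∂₁∂₂F`. -/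
lemma mixedHess_chartCov (hF : SmoothPair V F) (hg : IsPseudoRiemannian g)
    (hgF : IsInducedMetric F g) {e : OpenPartialHomeomorph N V} (he : e ∈ atlas V N)
    (X : Field V N) {Y Z : Field V N} (hY : Y.IsSmooth) (hZ : Z.IsSmooth) {y : V}
    (hy : y ∈ e.target) :
    mixedHess (twoPoint e e F) (y, y) (chartCov F e (Y.inChart e) y (X.inChart e y))
      (Z.inChart e y) = bracket F [X, Y] [Z] (e.symm y, e.symm y) := by
  have h1 := bracket_two_one_chart hF he he X hY hZ (y := (y, y)) ⟨hy, hy⟩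
  rw [h1, chartCov_apply, christoffel_apply, map_add,
    (isInvertible_mixedHess hF hg hgF he hy).self_apply_inverse, add_apply, add_comm]

lemma isInducedConnection_inducedConnection (hF : SmoothPair V F) (hg : IsPseudoRiemannian g)
    (hgF : IsInducedMetric F g) : IsInducedConnection F g (inducedConnection F) := by
  intro X Y Z hX hY hZ x
  have he := chart_mem_atlas V x
  have hx := mem_chart_source V x
  have hy := mem_chart_target V x
  have h1 := mixedHess_chartCov hF hg hgF he X hY hZ hy
  have h2 := metric_mfderiv_symm hF hgF he hy (chartCov F (chartAt V x)
    (Y.inChart (chartAt V x)) (chartAt V x x) (X.inChart (chartAt V x) (chartAt V x x)))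
    (Z.inChart (chartAt V x) (chartAt V x x))
  rw [h1, Z.mfderiv_symm_inChart he hy, ← inducedCov_apply, (chartAt V x).left_inv hx] at h2
  exact h2

/-- The induced connection has the same expression in all charts. -/
lemma mfderiv_inducedCov (hF : SmoothPair V F) (hg : IsPseudoRiemannian g)
    (hgF : IsInducedMetric F g) {e : OpenPartialHomeomorph N V} (he : e ∈ atlas V N)
    {σ : Field V N} (hσ : σ.IsSmooth) {y : V} (hy : y ∈ e.target) (u : V) :
    mfderiv 𝓘(ℝ, V) 𝓘(ℝ, V) e (e.symm y)
      (inducedCov F σ (e.symm y) (mfderiv 𝓘(ℝ, V) 𝓘(ℝ, V) e.symm y u)) =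
      chartCov F e (σ.inChart e) y u := by
  obtain ⟨X, hX, hXe⟩ := exists_smoothField_inChart_eq he hy u
  -- Both sides have the same pairing with every `w`, as prescribed by `F[Xσ|Z]`.
  refine (isInvertible_mixedHess hF hg hgF he hy).injective ?_
  ext w
  obtain ⟨Z, hZ, hZe⟩ := exists_smoothField_inChart_eq he hy w
  have h1 := mixedHess_chartCov hF hg hgF he X hσ hZ hy
  have h2 := isInducedConnection_inducedConnection hF hg hgF X σ Z hX hσ hZ (e.symm y)
  have hXy : mfderiv 𝓘(ℝ, V) 𝓘(ℝ, V) e.symm y u = X (e.symm y) := by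
    rw [← X.mfderiv_symm_inChart he hy, hXe.self_of_nhds]
  have hZy : mfderiv 𝓘(ℝ, V) 𝓘(ℝ, V) e.symm y w = Z (e.symm y) := by
    rw [← Z.mfderiv_symm_inChart he hy, hZe.self_of_nhds]
  obtain ⟨a, ha, ha'⟩ := exists_mfderiv_symm_eq he hy (inducedCov F σ (e.symm y) (X (e.symm y)))
  have h3 := metric_mfderiv_symm hF hgF he hy a w
  rw [hXe.self_of_nhds, hZe.self_of_nhds] at h1
  rw [ha, hZy] at h3
  rw [hXy, ha']
  exact neg_injective (h3.symm.trans (h2.trans (congrArg Neg.neg h1.symm)))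

lemma contDiffOn_chartCov (hF : SmoothPair V F) (hg : IsPseudoRiemannian g)
    (hgF : IsInducedMetric F g) {e : OpenPartialHomeomorph N V} (he : e ∈ atlas V N)
    {σ : Field V N} (hσ : σ.IsSmooth) :
    ContDiffOn ℝ ∞ (chartCov F e (σ.inChart e)) e.target := by
  have hU := isOpen_target_prod e e
  have hH := contDiffOn_mixedHess hU (hF.contDiffOn_twoPoint he he)
  have h1 : ContDiffOn ℝ ∞ (fun y ↦ (mixedHess (twoPoint e e F) (y, y)).inverse) e.target := by
    intro y hy
    obtain ⟨E, hE⟩ := isInvertible_mixedHess hF hg hgF he hy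
    have h2 := contDiffAt_map_inverse (𝕜 := ℝ) (n := ∞) E
    rw [hE] at h2
    exact ContDiffAt.comp_contDiffWithinAt (g := ContinuousLinearMap.inverse)
      (f := fun y ↦ mixedHess (twoPoint e e F) (y, y)) y h2 (contDiffOn_diag hH y hy)
  have h2 : ContDiffOn ℝ ∞ (christoffel F e) e.target :=
    ((ContinuousLinearMap.compL ℝ V (V →L[ℝ] ℝ) V).contDiff.comp_contDiffOn h1).clm_comp
      ((contDiffOn_diag (hH.fderiv_of_isOpen hU (m := ∞) (by simp))).clm_comp contDiffOn_const)
  have hσe := hσ.contDiffOn_inChart he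
  exact (hσe.fderiv_of_isOpen e.open_target (m := ∞) (by simp)).add
    (((ContinuousLinearMap.flipₗᵢ ℝ V V V).contDiff.comp_contDiffOn h2).clm_apply hσe)

/-- The induced connection is smooth: near `x` it is given by its expression in the chart at `x`. -/
lemma contMDiff_inducedConnection (hF : SmoothPair V F) (hg : IsPseudoRiemannian g)
    (hgF : IsInducedMetric F g) :
    CovariantDerivative.ContMDiffCovariantDerivative (inducedConnection F : Connection V N) ∞ := by
  refine ⟨⟨fun {σ} hσ ↦ ?_⟩⟩
  have hσ' : Field.IsSmooth σ := by
    rw [contMDiffOn_univ] at hσ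
    exact hσ.of_le (by simp)
  rw [contMDiffOn_univ]
  intro x
  rw [contMDiffAt_hom_bundle]
  refine ⟨contMDiffAt_id, ?_⟩
  have he := chart_mem_atlas V x
  have hx := mem_chart_source V x
  have h1 : ContMDiffAt 𝓘(ℝ, V) 𝓘(ℝ, V →L[ℝ] V) ∞
      (fun z ↦ chartCov F (chartAt V x) (Field.inChart σ (chartAt V x)) (chartAt V x z)) x := by
    refine ContMDiffAt.comp (g := chartCov F (chartAt V x) (Field.inChart σ (chartAt V x))) x
      (contMDiffAt_iff_contDiffAt.2 ((contDiffOn_chartCov hF hg hgF he hσ').contDiffAt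
        ((chartAt V x).open_target.mem_nhds (mem_chart_target V x)))) ?_
    exact (contMDiffOn_chart_of_mem he).contMDiffAt ((chartAt V x).open_source.mem_nhds hx)
  refine h1.congr_of_eventuallyEq ?_
  filter_upwards [(chartAt V x).open_source.mem_nhds hx] with z hz
  have h2 := inTangentCoordinates_eq_mfderiv_comp (I := 𝓘(ℝ, V)) (I' := 𝓘(ℝ, V)) (f := id)
    (g := id) (ϕ := fun z ↦ inducedCov F σ z) (x₀ := x) (x := z) hz hz
  refine Eq.trans h2 ?_
  have h3 : (extChartAt 𝓘(ℝ, V) x : N → V) = chartAt V x := by simp [mfld_simps]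
  have h4 : ((extChartAt 𝓘(ℝ, V) x).symm : V → N) = (chartAt V x).symm := by simp [mfld_simps]
  have h5 : mfderivWithin 𝓘(ℝ, V) 𝓘(ℝ, V) (extChartAt 𝓘(ℝ, V) x).symm (range 𝓘(ℝ, V))
      (extChartAt 𝓘(ℝ, V) x z) = mfderiv 𝓘(ℝ, V) 𝓘(ℝ, V) (chartAt V x).symm (chartAt V x z) := by
    rw [modelWithCornersSelf_coe, range_id, mfderivWithin_univ, h3, h4]
  have h6 := mfderiv_inducedCov hF hg hgF he hσ' ((chartAt V x).map_source hz)
  rw [(chartAt V x).left_inv hz] at h6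
  ext u
  refine Eq.trans ?_ (h6 u)
  have h7 : mfderiv 𝓘(ℝ, V) 𝓘(ℝ, V) (extChartAt 𝓘(ℝ, V) x) z =
      mfderiv 𝓘(ℝ, V) 𝓘(ℝ, V) (chartAt V x) z := by rw [h3]
  exact congrArg₂ (fun A B : V →L[ℝ] V ↦ A (inducedCov F σ z (B u))) h7 h5

end Nondegenerate

/-! ### Contrast functions and the dual connection -/

section Contrast

variable {F : N × N → ℝ} {g : CovTensor V N 2}

lemma isInducedMetric_swap (hF : SmoothPair V F) (hg : IsPseudoRiemannian g)
    (hgF : IsInducedMetric F g) : IsInducedMetric (fun z ↦ F z.swap) g := by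
  intro X Y hX hY x
  rw [bracket_swap_one_one hF hX hY, hg.symm, hgF Y X hY hX]
  rfl

/-- The connection induced by `F* = F ∘ swap` is dual to the one induced by `F`. -/
lemma isInducedConnection_swap_iff (hF : SmoothPair V F) (hg : IsPseudoRiemannian g)
    (hgF : IsInducedMetric F g) {D D' : Connection V N} (hD : IsInducedConnection F g D) :
    IsInducedConnection (fun z ↦ F z.swap) g D' ↔ IsDualConnection g D D' := by
  refine forall₃_congr fun X Y Z ↦ forall₃_congr fun hX hY hZ ↦ forall_congr' fun x ↦ ?_
  have h1 : mvfderiv 𝓘(ℝ, V) (fun y ↦ g y ![Y y, Z y]) x (X x) =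
      -(bracket F [X, Z] [Y] (x, x) + bracket F [Z] [X, Y] (x, x)) := by
    have h2 : (fun y ↦ g y ![Y y, Z y]) = -fun y ↦ bracket F [Z] [Y] (y, y) := by
      funext y
      rw [hg.symm, hgF Z Y hZ hY]
      rfl
    rw [h2, mvfderiv_neg, neg_apply, mvfderiv_bracket_diag hF hX hZ hY]
  rw [bracket_swap_two_one hF hX hY hZ, h1, hg.symm x (Y x), hD X Z Y hX hZ hY x]
  change _ = -bracket F [Z] [X, Y] (x, x) ↔ _
  constructor <;> intro h <;> linarith

/-- The mixed second derivatives of a two-point function with vanishing first derivative on the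
diagonal are symmetric there. -/
lemma bracket_diag_symm (hF : SmoothPair V F)
    (hd : ∀ x : N, mvfderiv (𝓘(ℝ, V).prod 𝓘(ℝ, V)) F (x, x) = 0) {X Y : Field V N}
    (hX : X.IsSmooth) (hY : Y.IsSmooth) (x : N) :
    bracket F [X] [Y] (x, x) = bracket F [Y] [X] (x, x) := by
  have he := chart_mem_atlas V x
  have hy := mem_chart_target V x
  have hd' : ∀ y ∈ (chartAt V x).target,
      fderiv ℝ (twoPoint (chartAt V x) (chartAt V x) F) (y, y) = 0 := by
    intro y hy
    have h := (hF.mdifferentiableAt _).hasMFDerivAt.comp (y, y)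
      (hasMFDerivAt_prodMap_symm he he (y := (y, y)) ⟨hy, hy⟩)
    have h' : fderiv ℝ (twoPoint (chartAt V x) (chartAt V x) F) (y, y) = (_ : V × V →L[ℝ] ℝ) :=
      HasFDerivAt.fderiv (f := twoPoint (chartAt V x) (chartAt V x) F) h.hasFDerivAt
    rw [h']
    ext w
    · exact DFunLike.congr_fun (hd ((chartAt V x).symm y)) _
    · exact DFunLike.congr_fun (hd ((chartAt V x).symm y)) _
  have h1 := bracket_one_one_chart hF he X hY hy
  have h2 := bracket_one_one_chart hF he Y hX hy
  rw [(chartAt V x).left_inv (mem_chart_source V x)] at h1 h2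
  rw [h1, h2, mixedHess_diag_symm (chartAt V x).open_target (hF.contDiffOn_twoPoint he he) hd' hy]

/-- A smooth two-point function whose first jet vanishes on the diagonal is a contrast function as
soon as the induced tensor is non-degenerate. -/
lemma isContrast_of_nondegenerate (hF : SmoothPair V F) (h0 : ∀ x : N, F (x, x) = 0)
    (hd : ∀ x : N, mvfderiv (𝓘(ℝ, V).prod 𝓘(ℝ, V)) F (x, x) = 0)
    (hnd : ∀ g : CovTensor V N 2, IsInducedMetric F g →
      ∀ (x : N) (u : TangentSpace 𝓘(ℝ, V) x), (∀ v, g x ![u, v] = 0) → u = 0) :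
    IsContrast V F := by
  obtain ⟨g, hg, hgF⟩ := exists_inducedMetric hF
  refine ⟨hF, h0, hd, g, ⟨hg, fun x u v ↦ ?_, hnd g hgF⟩, hgF⟩
  obtain ⟨X, hX, rfl⟩ := exists_smoothField_apply_eq x u
  obtain ⟨Y, hY, rfl⟩ := exists_smoothField_apply_eq x v
  rw [hgF X Y hX hY, hgF Y X hY hX, bracket_diag_symm hF hd hX hY]

/-- A contrast function induces a metric, a pair of dual connections and a skewness tensor. -/
theorem IsContrast.exists_isInducedBy (hF : IsContrast V F) :
    ∃ S : StatisticalData V N, S.IsInducedBy F := by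
  obtain ⟨g, hg, hgF⟩ := hF.metric
  have hs : SmoothPair V F := hF.smooth
  have hgF' := isInducedMetric_swap hs hg hgF
  have hD := isInducedConnection_inducedConnection hs hg hgF
  obtain ⟨T, hT, hTF⟩ := exists_inducedSkewness (hs.sub hs.swap) (by
    intro X Y hX hY x
    have h1 : bracket (fun z ↦ F z - F z.swap) [X] [Y] (x, x) =
        bracket F [X] [Y] (x, x) - bracket (fun z ↦ F z.swap) [X] [Y] (x, x) := by
      have h2 : along (rightField Y) (fun z ↦ F z - F z.swap) =
          fun z ↦ along (rightField Y) F z - along (rightField Y) (fun z ↦ F z.swap) z :=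
        funext (along_sub hs hs.swap _)
      change along (leftField X) (along (rightField Y) (fun z ↦ F z - F z.swap)) (x, x) = _
      rw [h2, along_sub (hs.along_rightField hY) (hs.swap.along_rightField hY)]
      rfl
    rw [h1, ← neg_eq_iff_eq_neg.2 (hgF X Y hX hY x), ← neg_eq_iff_eq_neg.2 (hgF' X Y hX hY x),
      sub_self])
  exact ⟨⟨g, inducedConnection F, inducedConnection fun z ↦ F z.swap, T⟩,
    { pseudoRiemannian := hg
      metric_eq := hgF
      conn_smooth := contMDiff_inducedConnection hs hg hgF
      conn_eq := hD
      dual_smooth := contMDiff_inducedConnection hs.swap hg hgF'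
      dual_eq := (isInducedConnection_swap_iff hs hg hgF hD).1
        (isInducedConnection_inducedConnection hs.swap hg hgF')
      skewness_smooth := hT
      skewness_eq := hTF }⟩

end Contrast

end ConnectionExistence

/-! ### Transition maps -/

section Transition

variable {V : Type*} [NormedAddCommGroup V] [NormedSpace ℝ V]
  {N : Type*} [TopologicalSpace N] [ChartedSpace V N] [IsManifold 𝓘(ℝ, V) ∞ N]
  {e e' : OpenPartialHomeomorph N V}

lemma mfderiv_chart_comp_symm (he : e ∈ atlas V N) (he' : e' ∈ atlas V N) {y : V}
    (hy : y ∈ e.target) (hy' : e.symm y ∈ e'.source) (v : V) :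
    mfderiv 𝓘(ℝ, V) 𝓘(ℝ, V) e' (e.symm y) (mfderiv 𝓘(ℝ, V) 𝓘(ℝ, V) e.symm y v) =
      fderiv ℝ (fun z ↦ e' (e.symm z)) y v := by
  have h := ((chart_mdifferentiable he').mdifferentiableAt hy').hasMFDerivAt.comp y
    ((chart_mdifferentiable he).mdifferentiableAt_symm hy).hasMFDerivAt
  have h1 : fderiv ℝ (fun z ↦ e' (e.symm z)) y = (_ : V →L[ℝ] V) :=
    HasFDerivAt.fderiv (f := fun z ↦ e' (e.symm z)) h.hasFDerivAt
  rw [h1]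
  rfl

/-- The transformation rule for the components of a vector field. -/
lemma Field.inChart_transition (he : e ∈ atlas V N) (he' : e' ∈ atlas V N) (X : Field V N) {y : V}
    (hy : y ∈ e.target) (hy' : e.symm y ∈ e'.source) :
    X.inChart e' (e' (e.symm y)) = fderiv ℝ (fun z ↦ e' (e.symm z)) y (X.inChart e y) := by
  rw [Field.inChart_apply X hy', ← mfderiv_chart_comp_symm he he' hy hy',
    Field.mfderiv_symm_inChart he X hy]

lemma contDiffOn_transition (he : e ∈ atlas V N) (he' : e' ∈ atlas V N) :
    ContDiffOn ℝ ∞ (fun z ↦ e' (e.symm z)) (e.symm.trans e').source := by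
  rw [← contMDiffOn_iff_contDiffOn]
  exact (contMDiffOn_chart_of_mem he').comp
    ((contMDiffOn_chart_symm_of_mem he).mono fun _ hx ↦ hx.1) fun _ hx ↦ hx.2

lemma mfderiv_chart_inverse (he : e ∈ atlas V N) {x : N} (hx : x ∈ e.source) (v : V) :
    (mfderiv 𝓘(ℝ, V) 𝓘(ℝ, V) e x).inverse v = mfderiv 𝓘(ℝ, V) 𝓘(ℝ, V) e.symm (e x) v := by
  have h1 := (chart_mdifferentiable he).symm_comp_deriv hx
  have h2 := (chart_mdifferentiable he).comp_symm_deriv (e.map_source hx)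
  rw [e.left_inv hx] at h2
  exact DFunLike.congr_fun (ContinuousLinearMap.inverse_eq h2 h1) v

end Transition

/-! ### Further calculus of truncated Taylor expansions -/

section TruncatedMore

variable {V W : Type*} [NormedAddCommGroup V] [NormedSpace ℝ V]
  [NormedAddCommGroup W] [NormedSpace ℝ W] {r : ℕ}

lemma TaylorEq.pow_smul {c d : ℝ → V} (h : TaylorEq r c d) (hc : ContDiffAt ℝ ∞ c 0)
    (hd : ContDiffAt ℝ ∞ d 0) (j : ℕ) :
    TaylorEq r (fun t ↦ t ^ j • c t) fun t ↦ t ^ j • d t := by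
  refine taylorEq_of_taylorCoeff_eq fun k hk ↦ ?_
  rw [taylorCoeff_pow_smul hc, taylorCoeff_pow_smul hd]
  exact h.taylorCoeff_eq (by omega)

lemma TaylorEq.clm_apply {L : ℝ → V →L[ℝ] W} {c d : ℝ → V} (h : TaylorEq r c d)
    (hL : ContDiffAt ℝ ∞ L 0) (hc : ContDiffAt ℝ ∞ c 0) (hd : ContDiffAt ℝ ∞ d 0) :
    TaylorEq r (fun t ↦ L t (c t)) fun t ↦ L t (d t) :=
  ((TaylorEq.refl r L).prodMk h hL hL hc hd).comp (hL.prodMk hc) (hL.prodMk hd)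
    (g := fun q : (V →L[ℝ] W) × V ↦ q.1 q.2) isBoundedBilinearMap_apply.contDiff.contDiffAt

lemma taylorCoeff_sub {c d : ℝ → V} (hc : ContDiffAt ℝ ∞ c 0) (hd : ContDiffAt ℝ ∞ d 0) (k : ℤ) :
    taylorCoeff k (fun t ↦ c t - d t) = taylorCoeff k c - taylorCoeff k d := by
  have h := taylorCoeff_clm_comp (hc.prodMk hd) (ContinuousLinearMap.fst ℝ V V -
    ContinuousLinearMap.snd ℝ V V) k
  have h1 := taylorCoeff_clm_comp (hc.prodMk hd) (ContinuousLinearMap.fst ℝ V V) k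
  have h2 := taylorCoeff_clm_comp (hc.prodMk hd) (ContinuousLinearMap.snd ℝ V V) k
  simp only [sub_apply, ContinuousLinearMap.coe_fst', ContinuousLinearMap.coe_snd'] at h h1 h2
  rw [h, ← h1, ← h2]

lemma contDiff_polyCurve_uncurry : ContDiff ℝ ∞ fun p : (Fin (r + 1) → V) × ℝ ↦
    polyCurve p.1 p.2 := by
  unfold polyCurve
  fun_prop

lemma hasFDerivAt_polyCurve (x : Fin (r + 1) → V) (t : ℝ) :
    HasFDerivAt (fun x : Fin (r + 1) → V ↦ polyCurve x t)
      (∑ ν : Fin (r + 1), t ^ (ν : ℕ) • (ContinuousLinearMap.proj ν : (Fin (r + 1) → V) →L[ℝ] V))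
      x := by
  unfold polyCurve
  exact HasFDerivAt.fun_sum fun ν _ ↦ (hasFDerivAt_apply ν x).const_smul (t ^ (ν : ℕ))

/-- Composition of truncated polynomial curves with a smooth map `g`, weighted by `t ^ i`: the
derivative with respect to the coefficients is given by Taylor coefficients of `Dg`. -/
lemma fderiv_taylorCoeff_comp_polyCurve {g : V → W} {U : Set V} (hU : IsOpen U)
    (hg : ContDiffOn ℝ ∞ g U) (i m : ℕ) {x : Fin (r + 1) → V} (hx : x 0 ∈ U)
    (u : Fin (r + 1) → V) :
    fderiv ℝ (fun x : Fin (r + 1) → V ↦ taylorCoeff m fun t ↦ t ^ i • g (polyCurve x t)) x u =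
      taylorCoeff m fun t ↦ t ^ i • fderiv ℝ g (polyCurve x t) (polyCurve u t) := by
  let h : (Fin (r + 1) → V) × ℝ → W := fun p ↦ p.2 ^ i • g (polyCurve p.1 p.2)
  let O : Set ((Fin (r + 1) → V) × ℝ) := {p | polyCurve p.1 p.2 ∈ U}
  have hO : IsOpen O := hU.preimage contDiff_polyCurve_uncurry.continuous
  have hh : ContDiffOn ℝ ∞ h O :=
    (contDiff_snd.pow i).contDiffOn.smul (hg.comp contDiff_polyCurve_uncurry.contDiffOn
      fun p hp ↦ hp)
  have hx0 : (x, (0 : ℝ)) ∈ O := by simpa [O] using hx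
  refine (fderiv_taylorCoeff_param hO hh m hx0 u).trans (taylorCoeff_congr ?_ _)
  have hev : ∀ᶠ t in 𝓝 (0 : ℝ), (x, t) ∈ O :=
    (Continuous.prodMk_right x).continuousAt.eventually_mem (hO.mem_nhds hx0)
  filter_upwards [hev] with t ht
  have h1 : HasFDerivAt h (fderiv ℝ h (x, t)) (x, t) :=
    ((hh.contDiffAt (hO.mem_nhds ht)).differentiableAt (by simp)).hasFDerivAt
  have h2 := HasFDerivAt.comp (g := h) (f := fun x ↦ (x, t)) x h1 (hasFDerivAt_prodMk_left x t)
  have h3 : HasFDerivAt (fun x ↦ h (x, t)) _ x :=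
    (((hg.contDiffAt (hU.mem_nhds ht)).differentiableAt (by simp)).hasFDerivAt.comp x
      (hasFDerivAt_polyCurve x t)).const_smul (t ^ i)
  have h4 := DFunLike.congr_fun (h2.unique h3) u
  simpa [polyCurve, _root_.sum_apply] using h4

/-- Taylor coefficients of `t ^ i g(x(t))` are smooth functions of the coefficients of `x`. -/
lemma contDiffOn_taylorCoeff_comp_polyCurve {g : V → W} {U : Set V} (hU : IsOpen U)
    (hg : ContDiffOn ℝ ∞ g U) (i m : ℕ) :
    ContDiffOn ℝ ∞ (fun x : Fin (r + 1) → V ↦ taylorCoeff m fun t ↦ t ^ i • g (polyCurve x t))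
      {x | x 0 ∈ U} := by
  have hO : IsOpen {p : (Fin (r + 1) → V) × ℝ | polyCurve p.1 p.2 ∈ U} :=
    hU.preimage contDiff_polyCurve_uncurry.continuous
  refine (contDiffOn_taylorCoeff_param hO (h := fun p ↦ p.2 ^ i • g (polyCurve p.1 p.2))
    ((contDiff_snd.pow i).contDiffOn.smul (hg.comp contDiff_polyCurve_uncurry.contDiffOn
      fun p hp ↦ hp)) m).mono fun x hx ↦ ?_
  simpa using hx

end TruncatedMore

/-! ### The atlas of the higher tangent bundle -/

section JetChart

variable {E : Type*} [NormedAddCommGroup E] [NormedSpace ℝ E] [FiniteDimensional ℝ E]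
  {M : Type*} [TopologicalSpace M] [ChartedSpace E M] [IsManifold 𝓘(ℝ, E) ∞ M] [T2Space M]

/-- The adapted chart of `T^r M` as a chart of the manifold. -/
def jetChart (r : ℕ) {e : OpenPartialHomeomorph M E} (he : e ∈ atlas E M) :
    OpenPartialHomeomorph (HigherTangent 𝓘(ℝ, E) r M) (Fin (r + 1) → E) :=
  (adaptedCore E M r).openPartialHomeomorph (adaptedChart r he) ⟨e, he, rfl⟩

variable {r : ℕ} {e e' : OpenPartialHomeomorph M E} (he : e ∈ atlas E M) (he' : e' ∈ atlas E M)

lemma jetChart_mem_atlas :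
    jetChart r he ∈ atlas (Fin (r + 1) → E) (HigherTangent 𝓘(ℝ, E) r M) :=
  mem_iUnion₂.2 ⟨adaptedChart r he, ⟨e, he, rfl⟩, rfl⟩

lemma exists_eq_jetChart_of_mem_atlas
    {f : OpenPartialHomeomorph (HigherTangent 𝓘(ℝ, E) r M) (Fin (r + 1) → E)}
    (hf : f ∈ atlas (Fin (r + 1) → E) (HigherTangent 𝓘(ℝ, E) r M)) :
    ∃ (e : OpenPartialHomeomorph M E) (he : e ∈ atlas E M), f = jetChart r he := by
  obtain ⟨_, ⟨e, he, rfl⟩, hfe⟩ := mem_iUnion₂.1 hf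
  exact ⟨e, he, hfe⟩

lemma mem_jetChart_source {p : HigherTangent 𝓘(ℝ, E) r M} :
    p ∈ (jetChart r he).source ↔ p.base ∈ e.source :=
  Iff.rfl

lemma mem_jetChart_target {x : Fin (r + 1) → E} : x ∈ (jetChart r he).target ↔ x 0 ∈ e.target :=
  Iff.rfl

lemma jetChart_jet {γ : Curve 𝓘(ℝ, E) M} (hγ : γ 0 ∈ e.source) :
    jetChart r he (jet r γ) = fun ν : Fin (r + 1) ↦ taylorCoeff ((ν : ℕ) : ℤ) (e ∘ γ) := by
  funext ν
  rw [taylorCoeff_natCast]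
  exact adaptedCoord_jet he hγ ν

/-- Every jet is represented, in a given chart at its base point, by a polynomial curve. -/
lemma exists_jet_symm_eq {x : Fin (r + 1) → E} (hx : x 0 ∈ e.target) :
    ∃ γ : Curve 𝓘(ℝ, E) M, (jetChart r he).symm x = jet r γ ∧
      γ =ᶠ[𝓝 0] fun t ↦ e.symm (polyCurve x t) := by
  obtain ⟨γ, h1, -, h2, -⟩ := polyJet_spec (r := r) he hx
  exact ⟨γ, h1, h2⟩

lemma base_jetChart_symm {x : Fin (r + 1) → E} (hx : x 0 ∈ e.target) :
    ((jetChart r he).symm x).base = e.symm (x 0) := by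
  obtain ⟨γ, h1, h2⟩ := exists_jet_symm_eq (r := r) he hx
  rw [h1, base_jet]
  exact h2.self_of_nhds.trans (by simp)

/-- The coefficient of index `0` is the coordinate of the base point. -/
lemma jetChart_apply_zero {p : HigherTangent 𝓘(ℝ, E) r M} (hp : p.base ∈ e.source) :
    jetChart r he p 0 = e p.base := by
  obtain ⟨γ, rfl⟩ := Quotient.exists_rep p
  exact adaptedCoord_jet_zero he hp

/-- The transition maps of `T^r M` are given by Taylor expansion of those of `M`. -/
lemma jetChart_transition {x : Fin (r + 1) → E} (hx : x 0 ∈ (e.symm.trans e').source) :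
    jetChart r he' ((jetChart r he).symm x) =
      fun ν : Fin (r + 1) ↦ taylorCoeff ((ν : ℕ) : ℤ) fun t ↦ e' (e.symm (polyCurve x t)) := by
  obtain ⟨γ, h1, h2⟩ := exists_jet_symm_eq (r := r) he hx.1
  have h3 : γ 0 ∈ e'.source := by
    have : γ 0 = e.symm (x 0) := h2.self_of_nhds.trans (by simp)
    exact this ▸ hx.2
  rw [h1, jetChart_jet he' h3]
  funext ν
  exact taylorCoeff_congr (h2.fun_comp e') _

/-- The derivative of a transition map of `T^r M` maps the class of `u(t)` to that of `Dτ(x(t)) u(t)`,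
where `τ` is the transition map of `M`. -/
lemma fderiv_jetChart_transition {x : Fin (r + 1) → E} (hx : x 0 ∈ (e.symm.trans e').source)
    (u : Fin (r + 1) → E) :
    fderiv ℝ (fun x ↦ jetChart r he' ((jetChart r he).symm x)) x u =
      fun ν : Fin (r + 1) ↦ taylorCoeff ((ν : ℕ) : ℤ) fun t ↦
        fderiv ℝ (fun z ↦ e' (e.symm z)) (polyCurve x t) (polyCurve u t) := by
  have hτ := contDiffOn_transition he he'
  have hO := (e.symm.trans e').open_source
  have hev : (fun x ↦ jetChart r he' ((jetChart r he).symm x)) =ᶠ[𝓝 x]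
      fun x (ν : Fin (r + 1)) ↦ taylorCoeff ((ν : ℕ) : ℤ) fun t ↦
        t ^ 0 • e' (e.symm (polyCurve x t)) := by
    filter_upwards [(hO.preimage (continuous_apply (0 : Fin (r + 1)))).mem_nhds hx] with z hz
    simpa using jetChart_transition he he' hz
  have hd : ∀ ν : Fin (r + 1), DifferentiableAt ℝ (fun x : Fin (r + 1) → E ↦
      taylorCoeff ((ν : ℕ) : ℤ) fun t ↦ t ^ 0 • e' (e.symm (polyCurve x t))) x := fun ν ↦
    ((contDiffOn_taylorCoeff_comp_polyCurve hO hτ 0 ν).contDiffAt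
      ((hO.preimage (continuous_apply (0 : Fin (r + 1)))).mem_nhds hx)).differentiableAt (by simp)
  rw [hev.fderiv_eq, fderiv_pi hd]
  funext ν
  refine (fderiv_taylorCoeff_comp_polyCurve hO hτ 0 ν hx u).trans ?_
  simp

variable (E M r) in
lemma continuous_base : Continuous (HigherTangent.base : HigherTangent 𝓘(ℝ, E) r M → M) := by
  rw [continuous_iff_continuousAt]
  intro p
  have hp : p.base ∈ (chartAt E p.base).source := mem_chart_source E p.base
  have he := chart_mem_atlas E p.base
  have hp' : p ∈ (jetChart r he).source := hp
  have h1 : ContinuousAt (fun q ↦ (chartAt E p.base).symm (jetChart r he q 0)) p := by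
    refine ContinuousAt.comp (g := (chartAt E p.base).symm) ?_ ?_
    · rw [jetChart_apply_zero he hp]
      exact (chartAt E p.base).symm.continuousAt ((chartAt E p.base).map_source hp)
    · exact (continuous_apply (0 : Fin (r + 1))).continuousAt.comp
        ((jetChart r he).continuousAt hp')
  refine h1.congr ?_
  filter_upwards [(jetChart r he).open_source.mem_nhds hp'] with q hq
  rw [jetChart_apply_zero he hq, (chartAt E p.base).left_inv hq]

/-- Jets with distinct base points are separated by the projection to `M`; jets with the same base
point lie in a common chart. -/
instance instT2SpaceHigherTangent : T2Space (HigherTangent 𝓘(ℝ, E) r M) := by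
  refine ⟨fun p q hpq ↦ ?_⟩
  by_cases h : p.base = q.base
  · have he := chart_mem_atlas E p.base
    have hp : p ∈ (jetChart r he).source := mem_chart_source E p.base
    have hq : q ∈ (jetChart r he).source := by
      rw [mem_jetChart_source, ← h]
      exact mem_chart_source E p.base
    have hne : jetChart r he p ≠ jetChart r he q := fun h' ↦ hpq ((jetChart r he).injOn hp hq h')
    obtain ⟨U, W, hU, hW, hpU, hqW, hUW⟩ := t2_separation hne
    refine ⟨_, _, (jetChart r he).isOpen_inter_preimage hU, (jetChart r he).isOpen_inter_preimage hW,
      ⟨hp, hpU⟩, ⟨hq, hqW⟩, ?_⟩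
    exact (hUW.preimage _).mono inter_subset_right inter_subset_right
  · exact separated_by_continuous (continuous_base E M r) h

end JetChart

section Lifts

variable {E : Type*} [NormedAddCommGroup E] [NormedSpace ℝ E] [FiniteDimensional ℝ E]
  {M : Type*} [TopologicalSpace M] [ChartedSpace E M] [IsManifold 𝓘(ℝ, E) ∞ M] [T2Space M]
  {r : ℕ} {e e' : OpenPartialHomeomorph M E}

/-! ### Lifts of vector fields in adapted charts -/

lemma contDiffAt_comp_polyCurve {V W : Type*} [NormedAddCommGroup V] [NormedSpace ℝ V]
    [NormedAddCommGroup W] [NormedSpace ℝ W] {g : V → W} {U : Set V} (hU : IsOpen U)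
    (hg : ContDiffOn ℝ ∞ g U) {x : Fin (r + 1) → V} (hx : x 0 ∈ U) :
    ContDiffAt ℝ ∞ (fun t ↦ g (polyCurve x t)) 0 := by
  refine ContDiffAt.comp (g := g) 0 (hg.contDiffAt (hU.mem_nhds ?_))
    (contDiff_polyCurve x).contDiffAt
  rwa [polyCurve_zero]

lemma eventually_polyCurve_mem {V : Type*} [NormedAddCommGroup V] [NormedSpace ℝ V] {U : Set V}
    (hU : IsOpen U) {x : Fin (r + 1) → V} (hx : x 0 ∈ U) : ∀ᶠ t in 𝓝 (0 : ℝ), polyCurve x t ∈ U :=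
  (contDiff_polyCurve x).continuous.continuousAt.eventually_mem
    (hU.mem_nhds (by rwa [polyCurve_zero]))

/-- The components of the lift `X^(r - j)` in any adapted chart are the Taylor coefficients of
`t ^ j X(x(t))`. -/
lemma Field.mfderiv_jetChart_lift {X : Field E M} (hX : X.IsSmooth) (j : ℕ) (he : e ∈ atlas E M)
    {p : HigherTangent 𝓘(ℝ, E) r M} (hp : p.base ∈ e.source) :
    mfderiv 𝓘(ℝ, Fin (r + 1) → E) 𝓘(ℝ, Fin (r + 1) → E) (jetChart r he) p
        (X.lift r ((r : ℤ) - j) p) =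
      fun ν : Fin (r + 1) ↦ taylorCoeff ((ν : ℕ) : ℤ) fun t ↦
        t ^ j • X.inChart e (polyCurve (jetChart r he p) t) := by
  have he₀ := chart_mem_atlas E p.base
  have hp₀ : p ∈ (jetChart r he₀).source := mem_chart_source E p.base
  set e₀ := chartAt E p.base with he₀_def
  set x := jetChart r he₀ p with hx_def
  have hxp : (jetChart r he₀).symm x = p := (jetChart r he₀).left_inv hp₀
  have hx : x 0 ∈ e₀.target := (jetChart r he₀).map_source hp₀
  have hx' : x 0 ∈ (e₀.symm.trans e).source := by
    refine ⟨hx, ?_⟩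
    change e₀.symm (x 0) ∈ e.source
    rwa [← base_jetChart_symm he₀ hx, hxp]
  have hX₀ := hX.contDiffOn_inChart he₀
  have hτ := contDiffOn_transition he₀ he
  have hO := (e₀.symm.trans e).open_source
  have hXx := contDiffAt_comp_polyCurve e₀.open_target hX₀ hx
  let w : Fin (r + 1) → E := fun ν ↦ taylorCoeff ((ν : ℕ) : ℤ) fun t ↦
    t ^ j • X.inChart e₀ (polyCurve x t)
  -- By definition the lift has components `w` in the preferred chart at `p`.
  have hw : X.lift r ((r : ℤ) - j) p =
      (mfderiv 𝓘(ℝ, Fin (r + 1) → E) 𝓘(ℝ, Fin (r + 1) → E) (jetChart r he₀) p).inverse w := by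
    have : w = fun ν : Fin (r + 1) ↦ taylorCoeff ((ν : ℤ) + ((r : ℤ) - j) - r) fun t ↦
        X.inChart e₀ (polyCurve x t) := by
      funext ν
      change taylorCoeff _ _ = _
      rw [taylorCoeff_pow_smul hXx]
      congr 1
      ring
    rw [this]
    rfl
  have h1 := mfderiv_chart_comp_symm (jetChart_mem_atlas he₀) (jetChart_mem_atlas he)
    (mem_jetChart_target he₀ |>.2 hx) (by rw [hxp]; exact hp) w
  rw [hxp, fderiv_jetChart_transition he₀ he hx'] at h1
  rw [hw, mfderiv_chart_inverse (jetChart_mem_atlas he₀) hp₀]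
  refine h1.trans ?_
  funext ν
  have hν : ((ν : ℕ) : ℤ) ≤ r := by
    have := ν.2
    omega
  have hDτ : ContDiffAt ℝ ∞ (fun t ↦ fderiv ℝ (fun z ↦ e (e₀.symm z)) (polyCurve x t)) 0 :=
    contDiffAt_comp_polyCurve hO (hτ.fderiv_of_isOpen hO (m := ∞) (by simp)) hx'
  have hpow : ∀ {c : ℝ → E}, ContDiffAt ℝ ∞ c 0 → ContDiffAt ℝ ∞ (fun t ↦ t ^ j • c t) 0 :=
    fun hc ↦ (contDiffAt_id.pow j).smul hc
  -- Modulo `t ^ (r + 1)`, the polynomial curve of `w` may be replaced by `t ^ j X(x(t))`.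
  rw [((taylorEq_polyCurve_taylorCoeff r _).clm_apply hDτ (contDiff_polyCurve w).contDiffAt
    (hpow hXx)).taylorCoeff_eq hν]
  have h2 : (fun t ↦ fderiv ℝ (fun z ↦ e (e₀.symm z)) (polyCurve x t)
      (t ^ j • X.inChart e₀ (polyCurve x t))) =ᶠ[𝓝 0]
      fun t ↦ t ^ j • X.inChart e (e (e₀.symm (polyCurve x t))) := by
    filter_upwards [eventually_polyCurve_mem hO hx'] with t ht
    rw [map_smul, X.inChart_transition he₀ he ht.1 ht.2]
  rw [taylorCoeff_congr h2]
  -- The curve `x(t)` in the chart `e₀` is, modulo `t ^ (r + 1)`, the polynomial curve of `p` in `e`.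
  have h3 : TaylorEq r (fun t ↦ e (e₀.symm (polyCurve x t))) (polyCurve (jetChart r he p)) := by
    have := jetChart_transition he₀ he hx'
    rw [hxp] at this
    rw [this]
    exact (taylorEq_polyCurve_taylorCoeff r _).symm
  have h4 : ContDiffAt ℝ ∞ (X.inChart e) (e (e₀.symm (polyCurve x 0))) := by
    rw [polyCurve_zero]
    exact (hX.contDiffOn_inChart he).contDiffAt
      (e.open_target.mem_nhds (e.map_source hx'.2))
  have h5 := contDiffAt_comp_polyCurve hO hτ hx'
  have h6 : ContDiffAt ℝ ∞ (polyCurve (jetChart r he p)) 0 := (contDiff_polyCurve _).contDiffAt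
  have h7 : ContDiffAt ℝ ∞ (X.inChart e) (polyCurve (jetChart r he p) 0) := h3.apply_zero ▸ h4
  exact ((h3.comp h5 h6 h4).pow_smul (ContDiffAt.comp (g := X.inChart e) 0 h4 h5)
    (ContDiffAt.comp (g := X.inChart e) 0 h7 h6) j).taylorCoeff_eq hν

lemma Field.inChart_lift {X : Field E M} (hX : X.IsSmooth) (j : ℕ) (he : e ∈ atlas E M)
    {x : Fin (r + 1) → E} (hx : x 0 ∈ e.target) :
    (X.lift r ((r : ℤ) - j)).inChart (jetChart r he) x =
      fun ν : Fin (r + 1) ↦ taylorCoeff ((ν : ℕ) : ℤ) fun t ↦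
        t ^ j • X.inChart e (polyCurve x t) := by
  have hp : ((jetChart r he).symm x).base ∈ e.source := by
    rw [base_jetChart_symm he hx]
    exact e.map_target hx
  have := X.mfderiv_jetChart_lift hX j he hp
  rwa [(jetChart r he).right_inv (mem_jetChart_target he |>.2 hx)] at this

lemma Field.IsSmooth.lift {X : Field E M} (hX : X.IsSmooth) (j : ℕ) :
    (X.lift r ((r : ℤ) - j)).IsSmooth := by
  refine Field.isSmooth_of_contDiffAt_inChart fun p ↦ ?_
  have he := chart_mem_atlas E p.base
  have hp : p ∈ (jetChart r he).source := mem_chart_source E p.base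
  refine ⟨jetChart r he, jetChart_mem_atlas he, hp, ?_⟩
  have h1 : ContDiffOn ℝ ∞ (fun (x : Fin (r + 1) → E) (ν : Fin (r + 1)) ↦
      taylorCoeff ((ν : ℕ) : ℤ) fun t ↦ t ^ j • X.inChart (chartAt E p.base) (polyCurve x t))
      (jetChart r he).target :=
    contDiffOn_pi.2 fun ν ↦ contDiffOn_taylorCoeff_comp_polyCurve (chartAt E p.base).open_target
      (hX.contDiffOn_inChart he) j ν
  exact (h1.congr fun x hx ↦ X.inChart_lift hX j he hx).contDiffAt
    ((jetChart r he).open_target.mem_nhds ((jetChart r he).map_source hp))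

/-- Every tangent vector of `T^r M` is a sum of values of lifts `X^(r - j)`, `j = 0, …, r`. -/
lemma exists_eq_sum_lift (p : HigherTangent 𝓘(ℝ, E) r M)
    (u : TangentSpace 𝓘(ℝ, Fin (r + 1) → E) p) :
    ∃ X : Fin (r + 1) → Field E M, (∀ j, (X j).IsSmooth) ∧
      u = ∑ j, (X j).lift r ((r : ℤ) - (j : ℕ)) p := by
  have he := chart_mem_atlas E p.base
  have hp : p ∈ (jetChart r he).source := mem_chart_source E p.base
  have hx : jetChart r he p 0 ∈ (chartAt E p.base).target := (jetChart r he).map_source hp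
  let û : Fin (r + 1) → E :=
    mfderiv 𝓘(ℝ, Fin (r + 1) → E) 𝓘(ℝ, Fin (r + 1) → E) (jetChart r he) p u
  -- If `X` has constant components `v` near the base point, then `X^(r - j)` has the coefficient `v`
  -- in degree `j` and no others.
  choose X hX hXe using fun j ↦ exists_smoothField_inChart_eq he hx (û j)
  refine ⟨X, hX, ?_⟩
  have key : ∀ j, mfderiv 𝓘(ℝ, Fin (r + 1) → E) 𝓘(ℝ, Fin (r + 1) → E) (jetChart r he) p
      ((X j).lift r ((r : ℤ) - (j : ℕ)) p) = Pi.single (M := fun _ ↦ E) j (û j) := by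
    intro j
    rw [(X j).mfderiv_jetChart_lift (hX j) j he hp]
    funext ν
    have h1 : (fun t ↦ t ^ (j : ℕ) • (X j).inChart (chartAt E p.base)
        (polyCurve (jetChart r he p) t)) =ᶠ[𝓝 0] polyCurve (Pi.single (M := fun _ ↦ E) j (û j)) := by
      have h2 : Tendsto (polyCurve (jetChart r he p)) (𝓝 0) (𝓝 (jetChart r he p 0)) := by
        have := (contDiff_polyCurve (jetChart r he p)).continuous.tendsto 0
        rwa [polyCurve_zero] at this
      filter_upwards [h2.eventually (hXe j)] with t ht
      rw [ht, polyCurve, Finset.sum_eq_single j]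
      · simp
      · intro ν _ hν
        simp [hν]
      · simp
    rw [taylorCoeff_congr h1, taylorCoeff_polyCurve]
  rw [← mfderiv_symm_mfderiv (jetChart_mem_atlas he) hp u,
    ← mfderiv_symm_mfderiv (jetChart_mem_atlas he) hp (∑ j, (X j).lift r ((r : ℤ) - (j : ℕ)) p)]
  congr 1
  refine Eq.trans ?_ (map_sum (mfderiv 𝓘(ℝ, Fin (r + 1) → E) 𝓘(ℝ, Fin (r + 1) → E)
    (jetChart r he) p) _ _).symm
  refine Eq.trans ?_ (Finset.sum_congr rfl fun j _ ↦ (key j).symm)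
  exact (Finset.univ_sum_single û).symm

/-! ### Lifts of two-point functions -/

variable (E) in
/-- The lift `f^(r - j)` of a two-point function `f` to `T^r M × T^r M = T^r (M × M)`: the
`r`-th Taylor coefficient of `t ^ j f(γ₁(t), γ₂(t))`, which is `0` for `j > r`. -/
def pairLift (r j : ℕ) (f : M × M → ℝ) :
    HigherTangent 𝓘(ℝ, E) r M × HigherTangent 𝓘(ℝ, E) r M → ℝ := fun z ↦
  taylorCoeff r fun t ↦
    t ^ j • f ((Quotient.out z.1 : Curve 𝓘(ℝ, E) M) t, (Quotient.out z.2 : Curve 𝓘(ℝ, E) M) t)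

variable {f : M × M → ℝ}

lemma SmoothPair.contDiffAt_curve (hf : SmoothPair E f) (γ₁ γ₂ : Curve 𝓘(ℝ, E) M) :
    ContDiffAt ℝ ∞ (fun t ↦ f (γ₁ t, γ₂ t)) 0 := by
  rw [← contMDiffAt_iff_contDiffAt]
  exact (hf.comp (γ₁.contMDiff.prodMk γ₂.contMDiff)).contMDiffAt

/-- The lift may be computed with any representatives of the jets. -/
lemma pairLift_jet (hf : SmoothPair E f) (j : ℕ) (γ₁ γ₂ : Curve 𝓘(ℝ, E) M) :
    pairLift E r j f (jet r γ₁, jet r γ₂) = taylorCoeff r fun t ↦ t ^ j • f (γ₁ t, γ₂ t) := by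
  have h1 := jet_prodMk_eq (Quotient.exact (Quotient.out_eq (jet r γ₁)))
    (Quotient.exact (Quotient.out_eq (jet r γ₂))) ⟨f, hf⟩
  exact (TaylorEq.pow_smul (r := r) h1 (hf.contDiffAt_curve _ _) (hf.contDiffAt_curve _ _)
    j).taylorCoeff_eq le_rfl

lemma contrastLift_eq_pairLift (F : C^∞⟮𝓘(ℝ, E).prod 𝓘(ℝ, E), M × M; 𝓘(ℝ, ℝ), ℝ⟯) :
    contrastLift r F = pairLift E r 0 F := by
  funext z
  obtain ⟨⟨γ₁⟩, ⟨γ₂⟩⟩ := z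
  refine Eq.trans ?_ (pairLift_jet F.contMDiff 0 γ₁ γ₂).symm
  simp only [pow_zero, one_smul]
  rfl

lemma pairLift_diag_eq_zero (hf : ∀ x, f (x, x) = 0) (j : ℕ) (p : HigherTangent 𝓘(ℝ, E) r M) :
    pairLift E r j f (p, p) = 0 := by
  simp only [pairLift, hf, smul_zero]
  exact taylorCoeff_zero_curve _

/-- Lifting is linear. -/
lemma pairLift_sub {g : M × M → ℝ} (hf : SmoothPair E f) (hg : SmoothPair E g) (j : ℕ) :
    pairLift E r j (fun z ↦ f z - g z) = fun z ↦ pairLift E r j f z - pairLift E r j g z := by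
  funext z
  simp only [pairLift, smul_sub]
  exact taylorCoeff_sub ((contDiffAt_id.pow j).smul (hf.contDiffAt_curve _ _))
    ((contDiffAt_id.pow j).smul (hg.contDiffAt_curve _ _)) _

variable (E r) in
/-- The regrouping of a pair of tuples of coefficients as a tuple of pairs. -/
def zipCoeff : (Fin (r + 1) → E) × (Fin (r + 1) → E) →L[ℝ] (Fin (r + 1) → E × E) :=
  ContinuousLinearMap.pi fun ν ↦
    (((ContinuousLinearMap.proj ν : (Fin (r + 1) → E) →L[ℝ] E).comp
      (ContinuousLinearMap.fst ℝ _ _)).prod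
    ((ContinuousLinearMap.proj ν : (Fin (r + 1) → E) →L[ℝ] E).comp
      (ContinuousLinearMap.snd ℝ _ _)))

lemma polyCurve_zipCoeff (z : (Fin (r + 1) → E) × (Fin (r + 1) → E)) (t : ℝ) :
    polyCurve (zipCoeff E r z) t = (polyCurve z.1 t, polyCurve z.2 t) := by
  simp [polyCurve, zipCoeff, Prod.ext_iff, Prod.fst_sum, Prod.snd_sum]

lemma twoPoint_pairLift (hf : SmoothPair E f) (j : ℕ) (he : e ∈ atlas E M) (he' : e' ∈ atlas E M) :
    EqOn (twoPoint (jetChart r he) (jetChart r he') (pairLift E r j f))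
      (fun y ↦ taylorCoeff r fun t ↦ t ^ j • twoPoint e e' f (polyCurve (zipCoeff E r y) t))
      ((jetChart r he).target ×ˢ (jetChart r he').target) := by
  intro y hy
  obtain ⟨γ₁, h1, h1'⟩ := exists_jet_symm_eq (r := r) he hy.1
  obtain ⟨γ₂, h2, h2'⟩ := exists_jet_symm_eq (r := r) he' hy.2
  simp only [twoPoint]
  rw [h1, h2, pairLift_jet hf]
  refine taylorCoeff_congr ?_ _
  filter_upwards [h1', h2'] with t ht1 ht2
  rw [polyCurve_zipCoeff, ht1, ht2]

lemma smoothPair_pairLift (hf : SmoothPair E f) (j : ℕ) :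
    SmoothPair (Fin (r + 1) → E) (pairLift E r j f) := by
  refine smoothPair_of_contDiffOn_twoPoint fun ê hê ê' hê' ↦ ?_
  obtain ⟨e, he, rfl⟩ := exists_eq_jetChart_of_mem_atlas hê
  obtain ⟨e', he', rfl⟩ := exists_eq_jetChart_of_mem_atlas hê'
  refine ContDiffOn.congr ?_ (twoPoint_pairLift hf j he he')
  exact (contDiffOn_taylorCoeff_comp_polyCurve (isOpen_target_prod e e')
    (hf.contDiffOn_twoPoint he he') j r).comp (zipCoeff E r).contDiff.contDiffOn fun y hy ↦ hy

/-- The derivative of a lifted two-point function in a direction whose coefficients are the Taylor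
coefficients of `t ^ j c(t)`. -/
lemma fderiv_twoPoint_pairLift (hf : SmoothPair E f) (i j : ℕ) (he : e ∈ atlas E M)
    (he' : e' ∈ atlas E M) {y : (Fin (r + 1) → E) × (Fin (r + 1) → E)}
    (hy : y ∈ (jetChart r he).target ×ˢ (jetChart r he').target)
    {w : (Fin (r + 1) → E) × (Fin (r + 1) → E)} {c : ℝ → E × E} (hc : ContDiffAt ℝ ∞ c 0)
    (hw : TaylorEq r (polyCurve (zipCoeff E r w)) fun t ↦ t ^ j • c t) :
    fderiv ℝ (twoPoint (jetChart r he) (jetChart r he') (pairLift E r i f)) y w =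
      taylorCoeff r fun t ↦ t ^ (i + j) •
        fderiv ℝ (twoPoint e e' f) (polyCurve (zipCoeff E r y) t) (c t) := by
  have hO := isOpen_target_prod e e'
  have hg := hf.contDiffOn_twoPoint he he'
  have hy0 : zipCoeff E r y 0 ∈ e.target ×ˢ e'.target := hy
  let G : (Fin (r + 1) → E × E) → ℝ := fun x ↦ taylorCoeff r fun t ↦
    t ^ i • twoPoint e e' f (polyCurve x t)
  have hG : DifferentiableAt ℝ G (zipCoeff E r y) :=
    ((contDiffOn_taylorCoeff_comp_polyCurve hO hg i r).contDiffAt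
      ((hO.preimage (continuous_apply (0 : Fin (r + 1)))).mem_nhds hy0)).differentiableAt (by simp)
  have hev : twoPoint (jetChart r he) (jetChart r he') (pairLift E r i f) =ᶠ[𝓝 y]
      fun z ↦ G (zipCoeff E r z) :=
    (twoPoint_pairLift hf i he he').eventuallyEq_of_mem
      ((isOpen_target_prod (jetChart r he) (jetChart r he')).mem_nhds hy)
  have h1 := HasFDerivAt.comp (g := G) y hG.hasFDerivAt (zipCoeff E r).hasFDerivAt
  have h2 : fderiv ℝ (fun z ↦ G (zipCoeff E r z)) y = _ := h1.fderiv
  rw [hev.fderiv_eq, h2]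
  refine (fderiv_taylorCoeff_comp_polyCurve hO hg i r hy0 (zipCoeff E r w)).trans ?_
  have hD : ContDiffAt ℝ ∞ (fun t ↦ fderiv ℝ (twoPoint e e' f) (polyCurve (zipCoeff E r y) t)) 0 :=
    contDiffAt_comp_polyCurve hO (hg.fderiv_of_isOpen hO (m := ∞) (by simp)) hy0
  have hpc : ContDiffAt ℝ ∞ (polyCurve (zipCoeff E r w)) 0 := (contDiff_polyCurve _).contDiffAt
  have htc : ContDiffAt ℝ ∞ (fun t ↦ t ^ j • c t) 0 := (contDiffAt_id.pow j).smul hc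
  rw [((hw.clm_apply hD hpc htc).pow_smul (hD.clm_apply hpc) (hD.clm_apply htc)
    i).taylorCoeff_eq le_rfl]
  simp only [map_smul, smul_smul, pow_add]

/-- Lifted vector fields on the left factor act on lifted two-point functions by
`X^(r - j) f^(r - i) = (X f)^(r - i - j)`. -/
lemma along_leftField_lift_pairLift (hf : SmoothPair E f) {X : Field E M} (hX : X.IsSmooth)
    (i j : ℕ) :
    along (leftField (X.lift r ((r : ℤ) - j))) (pairLift E r i f) =
      pairLift E r (i + j) (along (leftField X) f) := by
  funext z
  have he := chart_mem_atlas E z.1.base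
  have he' := chart_mem_atlas E z.2.base
  have hz : z.1 ∈ (jetChart r he).source := mem_chart_source E z.1.base
  have hz' : z.2 ∈ (jetChart r he').source := mem_chart_source E z.2.base
  set e := chartAt E z.1.base
  set e' := chartAt E z.2.base
  set y := (jetChart r he z.1, jetChart r he' z.2) with hy_def
  have hy : y ∈ (jetChart r he).target ×ˢ (jetChart r he').target :=
    ⟨(jetChart r he).map_source hz, (jetChart r he').map_source hz'⟩
  have hzy : z = ((jetChart r he).symm y.1, (jetChart r he').symm y.2) :=
    Prod.ext ((jetChart r he).left_inv hz).symm ((jetChart r he').left_inv hz').symm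
  have hXy := contDiffAt_comp_polyCurve e.open_target (hX.contDiffOn_inChart he) hy.1
  rw [hzy, along_leftField_chart (jetChart_mem_atlas he) (jetChart_mem_atlas he') hy
    ((smoothPair_pairLift hf i).mdifferentiableAt _), X.inChart_lift hX j he hy.1]
  refine (fderiv_twoPoint_pairLift hf i j he he' hy
    (c := fun t ↦ (X.inChart e (polyCurve y.1 t), 0)) (hXy.prodMk contDiffAt_const) ?_).trans ?_
  · have h1 := (taylorEq_polyCurve_taylorCoeff r fun t ↦
      t ^ j • X.inChart e (polyCurve y.1 t)).prodMk (TaylorEq.refl r fun _ ↦ (0 : E))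
      (contDiff_polyCurve _).contDiffAt ((contDiffAt_id.pow j).smul hXy) contDiffAt_const
      contDiffAt_const
    convert h1 using 1
    · funext t
      rw [polyCurve_zipCoeff]
      simp [polyCurve]
    · funext t
      simp
  · refine Eq.trans ?_ (twoPoint_pairLift (hf.along_leftField hX) (i + j) he he' hy).symm
    refine taylorCoeff_congr ?_ _
    filter_upwards [eventually_polyCurve_mem (isOpen_target_prod e e')
      (x := zipCoeff E r y) hy] with t ht
    rw [hf.twoPoint_along_leftField he he' X ht, polyCurve_zipCoeff]

/-- Lifted vector fields on the right factor act on lifted two-point functions by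
`X^(r - j) f^(r - i) = (X f)^(r - i - j)`. -/
lemma along_rightField_lift_pairLift (hf : SmoothPair E f) {X : Field E M} (hX : X.IsSmooth)
    (i j : ℕ) :
    along (rightField (X.lift r ((r : ℤ) - j))) (pairLift E r i f) =
      pairLift E r (i + j) (along (rightField X) f) := by
  have h1 : pairLift E r i f = fun z ↦ pairLift E r i (fun z : M × M ↦ f z.swap) z.swap := rfl
  rw [h1, along_rightField_swap (smoothPair_pairLift hf.swap i),
    along_leftField_lift_pairLift hf.swap hX, along_leftField_swap hf]
  rfl

lemma bracket_lift_one_one (hf : SmoothPair E f) {X Y : Field E M} (hX : X.IsSmooth)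
    (hY : Y.IsSmooth) (a b : ℕ) :
    bracket (pairLift E r 0 f) [X.lift r ((r : ℤ) - a)] [Y.lift r ((r : ℤ) - b)] =
      pairLift E r (a + b) (bracket f [X] [Y]) := by
  simp only [bracket, List.foldr_cons, List.foldr_nil]
  rw [along_rightField_lift_pairLift hf hY,
    along_leftField_lift_pairLift (hf.along_rightField hY) hX, zero_add, add_comm]

lemma bracket_lift_two_one (hf : SmoothPair E f) {X Y Z : Field E M} (hX : X.IsSmooth)
    (hY : Y.IsSmooth) (hZ : Z.IsSmooth) (a b c : ℕ) :
    bracket (pairLift E r 0 f) [X.lift r ((r : ℤ) - a), Y.lift r ((r : ℤ) - b)]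
      [Z.lift r ((r : ℤ) - c)] = pairLift E r (a + b + c) (bracket f [X, Y] [Z]) := by
  simp only [bracket, List.foldr_cons, List.foldr_nil]
  rw [along_rightField_lift_pairLift hf hZ,
    along_leftField_lift_pairLift (hf.along_rightField hZ) hY,
    along_leftField_lift_pairLift ((hf.along_rightField hZ).along_leftField hY) hX]
  congr 1
  ring

lemma bracket_lift_one_two (hf : SmoothPair E f) {X Y Z : Field E M} (hX : X.IsSmooth)
    (hY : Y.IsSmooth) (hZ : Z.IsSmooth) (a b c : ℕ) :
    bracket (pairLift E r 0 f) [X.lift r ((r : ℤ) - a)]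
      [Y.lift r ((r : ℤ) - b), Z.lift r ((r : ℤ) - c)] =
        pairLift E r (a + b + c) (bracket f [X] [Y, Z]) := by
  simp only [bracket, List.foldr_cons, List.foldr_nil]
  rw [along_rightField_lift_pairLift hf hZ,
    along_rightField_lift_pairLift (hf.along_rightField hZ) hY,
    along_leftField_lift_pairLift ((hf.along_rightField hZ).along_rightField hY) hX]
  congr 1
  ring

end Lifts

/-! ### Lifts of tensor fields -/

section TensorLift

variable {E : Type*} [NormedAddCommGroup E] [NormedSpace ℝ E] [FiniteDimensional ℝ E]
  {M : Type*} [TopologicalSpace M] [ChartedSpace E M] [IsManifold 𝓘(ℝ, E) ∞ M] [T2Space M]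
  {r : ℕ} {k : ℕ}

/-- The components of a tangent vector of `T^r M` in the preferred adapted chart. -/
def tangentCoord (p : HigherTangent 𝓘(ℝ, E) r M) :
    TangentSpace 𝓘(ℝ, Fin (r + 1) → E) p →L[ℝ] (Fin (r + 1) → E) :=
  mfderiv 𝓘(ℝ, Fin (r + 1) → E) 𝓘(ℝ, Fin (r + 1) → E) (chartAt (Fin (r + 1) → E) p) p

lemma tangentCoord_injective (p : HigherTangent 𝓘(ℝ, E) r M) :
    Function.Injective (tangentCoord p) := fun u v h ↦ by
  rw [← mfderiv_symm_mfderiv (chart_mem_atlas (Fin (r + 1) → E) p) (mem_chart_source _ p) u,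
    ← mfderiv_symm_mfderiv (chart_mem_atlas (Fin (r + 1) → E) p) (mem_chart_source _ p) v]
  exact congrArg _ h

lemma tangentCoord_surjective (p : HigherTangent 𝓘(ℝ, E) r M) :
    Function.Surjective (tangentCoord p) := fun w ↦ by
  have h := mfderiv_mfderiv_symm (chart_mem_atlas (Fin (r + 1) → E) p)
    (mem_chart_target (Fin (r + 1) → E) p) w
  rw [(chartAt (Fin (r + 1) → E) p).left_inv (mem_chart_source _ p)] at h
  exact ⟨_, h⟩

lemma tangentCoord_lift {X : Field E M} (hX : X.IsSmooth) (j : ℕ)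
    (p : HigherTangent 𝓘(ℝ, E) r M) :
    tangentCoord p (X.lift r ((r : ℤ) - j) p) = fun ν : Fin (r + 1) ↦
      taylorCoeff ((ν : ℕ) : ℤ) fun t ↦ t ^ j • X.inChart (chartAt E p.base)
        (polyCurve (chartAt (Fin (r + 1) → E) p p) t) :=
  X.mfderiv_jetChart_lift hX j (chart_mem_atlas E p.base) (mem_chart_source E p.base)

lemma chartAt_apply_zero_mem (p : HigherTangent 𝓘(ℝ, E) r M) :
    chartAt (Fin (r + 1) → E) p p 0 ∈ (chartAt E p.base).target :=
  mem_chart_target (Fin (r + 1) → E) p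

lemma CovTensor.IsSmooth.contDiffAt_polyCurve {K : CovTensor E M k} (hK : K.IsSmooth)
    (p : HigherTangent 𝓘(ℝ, E) r M) :
    ContDiffAt ℝ ∞ (fun t ↦ K.inChart (chartAt E p.base)
      (polyCurve (chartAt (Fin (r + 1) → E) p p) t)) 0 :=
  contDiffAt_comp_polyCurve (chartAt E p.base).open_target (hK _ (chart_mem_atlas E p.base))
    (chartAt_apply_zero_mem p)

lemma CovTensor.lift_apply_eq_sum {K : CovTensor E M k} (hK : K.IsSmooth)
    (p : HigherTangent 𝓘(ℝ, E) r M) (u : Fin k → TangentSpace 𝓘(ℝ, Fin (r + 1) → E) p) :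
    K.lift r r p u = ∑ m : Fin k → Fin (r + 1),
      taylorCoeff ((r : ℤ) - ∑ i, ((m i : ℕ) : ℤ)) fun t ↦ K.inChart (chartAt E p.base)
        (polyCurve (chartAt (Fin (r + 1) → E) p p) t) fun i ↦ tangentCoord p (u i) (m i) := by
  have h1 : K.lift r r p u = (∑ m : Fin k → Fin (r + 1),
      (taylorCoeff ((r : ℤ) - ∑ i, ((m i : ℕ) : ℤ)) fun t ↦ K.inChart (chartAt E p.base)
        (polyCurve (chartAt (Fin (r + 1) → E) p p) t)).compContinuousLinearMap fun i ↦
          (ContinuousLinearMap.proj (m i) : (Fin (r + 1) → E) →L[ℝ] E))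
      fun i ↦ tangentCoord p (u i) := rfl
  rw [h1, _root_.sum_apply]
  refine Finset.sum_congr rfl fun m _ ↦ ?_
  exact (taylorCoeff_clm_comp (hK.contDiffAt_polyCurve p)
    (ContinuousMultilinearMap.apply ℝ (fun _ : Fin k ↦ E) ℝ
      fun i ↦ tangentCoord p (u i) (m i)) _).symm

/-- The complete lift of a tensor field, evaluated on tangent vectors with components `u_i`, is the
`r`-th Taylor coefficient of `K(x(t))(u_1(t), …, u_k(t))` with polynomial curves `x`, `u_i`. -/
lemma CovTensor.lift_apply {K : CovTensor E M k} (hK : K.IsSmooth)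
    (p : HigherTangent 𝓘(ℝ, E) r M) (u : Fin k → TangentSpace 𝓘(ℝ, Fin (r + 1) → E) p) :
    K.lift r r p u = taylorCoeff r fun t ↦ K.inChart (chartAt E p.base)
      (polyCurve (chartAt (Fin (r + 1) → E) p p) t) fun i ↦ polyCurve (tangentCoord p (u i)) t := by
  have hs : ∀ v : Fin k → E, ContDiffAt ℝ ∞ (fun t ↦ K.inChart (chartAt E p.base)
      (polyCurve (chartAt (Fin (r + 1) → E) p p) t) v) 0 := fun v ↦
    (ContinuousMultilinearMap.apply ℝ (fun _ : Fin k ↦ E) ℝ v).contDiff.contDiffAt.comp 0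
      (hK.contDiffAt_polyCurve p)
  have h1 : ∀ t, (K.inChart (chartAt E p.base) (polyCurve (chartAt (Fin (r + 1) → E) p p) t)
      fun i ↦ polyCurve (tangentCoord p (u i)) t) = ∑ m : Fin k → Fin (r + 1),
        t ^ (∑ i, (m i : ℕ)) • K.inChart (chartAt E p.base)
          (polyCurve (chartAt (Fin (r + 1) → E) p p) t) fun i ↦ tangentCoord p (u i) (m i) := by
    intro t
    simp only [polyCurve]
    rw [ContinuousMultilinearMap.map_sum]
    refine Finset.sum_congr rfl fun m _ ↦ ?_
    rw [ContinuousMultilinearMap.map_smul_univ, Finset.prod_pow_eq_pow_sum]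
  simp only [h1]
  rw [CovTensor.lift_apply_eq_sum hK]
  refine Eq.trans ?_ (taylorCoeff_sum Finset.univ (c := fun (m : Fin k → Fin (r + 1)) (t : ℝ) ↦
    t ^ (∑ i, (m i : ℕ)) • K.inChart (chartAt E p.base)
      (polyCurve (chartAt (Fin (r + 1) → E) p p) t) fun i ↦ tangentCoord p (u i) (m i))
    (fun m _ ↦ (contDiffAt_id.pow _).smul (hs fun i ↦ tangentCoord p (u i) (m i))) r).symm
  refine Finset.sum_congr rfl fun m _ ↦ ?_
  rw [taylorCoeff_pow_smul (hs _)]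
  push_cast
  rfl

/-- The complete lift `K^c`, evaluated on lifts `X_i^(r - j_i)`, is the lift `(K(X))^(r - ∑ j_i)`;
here the function `K(X)` is extended from the diagonal to `M × M`. -/
lemma CovTensor.lift_apply_lift {K : CovTensor E M k} (hK : K.IsSmooth) {X : Fin k → Field E M}
    (hX : ∀ i, (X i).IsSmooth) {G : M × M → ℝ} (hG : SmoothPair E G)
    (hKG : ∀ x, K x (fun i ↦ X i x) = G (x, x)) (j : Fin k → ℕ)
    (p : HigherTangent 𝓘(ℝ, E) r M) :
    K.lift r r p (fun i ↦ (X i).lift r ((r : ℤ) - j i) p) = pairLift E r (∑ i, j i) G (p, p) := by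
  have he := chart_mem_atlas E p.base
  have hp := mem_chart_source (Fin (r + 1) → E) p
  have hx := chartAt_apply_zero_mem p
  have hx' := mem_chart_target (Fin (r + 1) → E) p
  rw [CovTensor.lift_apply hK]
  simp only [fun i ↦ tangentCoord_lift (hX i) (j i) p]
  set x := chartAt (Fin (r + 1) → E) p p with hx_def
  set e := chartAt E p.base
  have hc : ∀ i, ContDiffAt ℝ ∞ (fun t ↦ t ^ j i • (X i).inChart e (polyCurve x t)) 0 := fun i ↦
    (contDiffAt_id.pow (j i)).smul
      (contDiffAt_comp_polyCurve e.open_target ((hX i).contDiffOn_inChart he) hx)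
  have hKs := hK.contDiffAt_polyCurve p
  have h1 := TaylorEq.pi (fun i ↦ taylorEq_polyCurve_taylorCoeff r fun t ↦
    t ^ j i • (X i).inChart e (polyCurve x t)) (fun i ↦ (contDiff_polyCurve _).contDiffAt) hc
  have hev : ContDiff ℝ ∞ fun q : (E [×k]→L[ℝ] ℝ) × (Fin k → E) ↦ q.1 q.2 :=
    contDiff_iff_contDiffAt.2 fun _ ↦ (ContinuousLinearMap.id ℝ
      (E [×k]→L[ℝ] ℝ)).cpolynomialAt_uncurry_of_multilinear.contDiffAt
  have hpi := contDiffAt_pi.2 fun i ↦ (contDiff_polyCurve (r := r) fun ν : Fin (r + 1) ↦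
    taylorCoeff ((ν : ℕ) : ℤ) fun t ↦ t ^ j i • (X i).inChart e (polyCurve x t)).contDiffAt (x := 0)
  have h2 := ((TaylorEq.refl r fun t ↦ K.inChart e (polyCurve x t)).prodMk h1 hKs hKs hpi
    (contDiffAt_pi.2 hc)).comp (hKs.prodMk hpi) (hKs.prodMk (contDiffAt_pi.2 hc)) hev.contDiffAt
  rw [h2.taylorCoeff_eq le_rfl]
  have hpp : ((p, p) : HigherTangent 𝓘(ℝ, E) r M × HigherTangent 𝓘(ℝ, E) r M) =
      ((jetChart r he).symm x, (jetChart r he).symm x) := by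
    have : p = (jetChart r he).symm x := ((jetChart r he).left_inv hp).symm
    rw [← this]
  rw [hpp]
  refine Eq.trans ?_ (twoPoint_pairLift hG (∑ i, j i) he he (x := (x, x)) ⟨hx', hx'⟩).symm
  refine taylorCoeff_congr ?_ _
  filter_upwards [eventually_polyCurve_mem e.open_target hx] with t ht
  rw [ContinuousMultilinearMap.map_smul_univ, Finset.prod_pow_eq_pow_sum, polyCurve_zipCoeff]
  congr 1
  refine Eq.trans ?_ (hKG (e.symm (polyCurve x t)))
  change (K (e.symm (polyCurve x t))) (fun i ↦ mfderiv 𝓘(ℝ, E) 𝓘(ℝ, E) e.symm (polyCurve x t)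
    ((X i).inChart e (polyCurve x t))) = _
  congr 1
  funext i
  exact (X i).mfderiv_symm_inChart he ht

/-- A covariant tensor field on `T^r M` is determined by its values on lifts of vector fields. -/
lemma CovTensor.ext_of_lift
    {A B : CovTensor (Fin (r + 1) → E) (HigherTangent 𝓘(ℝ, E) r M) k}
    (h : ∀ X : Fin k → Field E M, (∀ i, (X i).IsSmooth) → ∀ (j : Fin k → ℕ) p,
      A p (fun i ↦ (X i).lift r ((r : ℤ) - j i) p) =
        B p (fun i ↦ (X i).lift r ((r : ℤ) - j i) p)) : A = B := by
  funext p
  refine ContinuousMultilinearMap.ext fun u ↦ ?_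
  choose X hX hu using fun i ↦ exists_eq_sum_lift p (u i)
  have h1 : u = fun i ↦ ∑ j, (X i j).lift r ((r : ℤ) - ((j : Fin (r + 1)) : ℕ)) p := funext hu
  rw [h1, ContinuousMultilinearMap.map_sum, ContinuousMultilinearMap.map_sum]
  exact Finset.sum_congr rfl fun m _ ↦ h (fun i ↦ X i (m i)) (fun i ↦ hX i (m i)) (fun i ↦ m i) p

/-- The matrix of the complete lift of a bilinear form is block triangular, with the form itself on
the antidiagonal; so non-degeneracy is inherited. -/
lemma lift_nondegenerate {g : CovTensor E M 2} (hg : IsPseudoRiemannian g)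
    (p : HigherTangent 𝓘(ℝ, E) r M) (u : TangentSpace 𝓘(ℝ, Fin (r + 1) → E) p)
    (hu : ∀ v, g.lift r r p ![u, v] = 0) : u = 0 := by
  have he := chart_mem_atlas E p.base
  have hx := chartAt_apply_zero_mem p
  set x := chartAt (Fin (r + 1) → E) p p
  set e := chartAt E p.base
  have hnd : ∀ a : E, (∀ w : E, g.inChart e (x 0) ![a, w] = 0) → a = 0 := by
    intro a ha
    have h1 : mfderiv 𝓘(ℝ, E) 𝓘(ℝ, E) e.symm (x 0) a = 0 := by
      refine hg.nondegenerate _ _ fun v ↦ ?_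
      have h2 := ha (mfderiv 𝓘(ℝ, E) 𝓘(ℝ, E) e (e.symm (x 0)) v)
      have h3 := mfderiv_symm_mfderiv he (e.map_target hx) v
      rw [e.right_inv hx] at h3
      refine Eq.trans ?_ h2
      change _ = g (e.symm (x 0)) _
      congr 1
      funext i
      fin_cases i
      · rfl
      · exact h3.symm
    rw [← mfderiv_mfderiv_symm he hx a, h1]
    exact map_zero _
  have key : ∀ n, ∀ ν : Fin (r + 1), (ν : ℕ) = n → tangentCoord p u ν = 0 := by
    intro n
    induction n using Nat.strong_induction_on with
    | _ n ih =>
      intro ν hν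
      refine hnd _ fun w ↦ ?_
      -- The component of index `ν` of `u` is paired with the one of index `r - ν` of `v`.
      obtain ⟨v, hv⟩ := tangentCoord_surjective p (Pi.single (M := fun _ ↦ E) ν.rev w)
      have h1 := hu v
      rw [CovTensor.lift_apply_eq_sum hg.smooth, Finset.sum_eq_single ![ν, ν.rev]] at h1
      · have h2 : (r : ℤ) - ∑ i, (((![ν, ν.rev] : Fin 2 → Fin (r + 1)) i : ℕ) : ℤ) = (0 : ℕ) := by
          have := ν.2
          simp only [Fin.sum_univ_two, Matrix.cons_val_zero, Matrix.cons_val_one, Fin.val_rev]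
          omega
        rw [h2, taylorCoeff_natCast] at h1
        simp only [Nat.factorial_zero, Nat.cast_one, inv_one, one_smul, iteratedDeriv_zero,
          polyCurve_zero] at h1
        refine Eq.trans ?_ h1
        congr 1
        funext i
        fin_cases i
        · rfl
        · change w = tangentCoord p v ν.rev
          rw [hv, Pi.single_eq_same]
      · intro m _ hm
        have hzero : ∀ i, tangentCoord p ((![u, v] : Fin 2 → TangentSpace _ p) i) (m i) = 0 →
            taylorCoeff ((r : ℤ) - ∑ i, ((m i : ℕ) : ℤ)) (fun t ↦ g.inChart e (polyCurve x t)
              fun i ↦ tangentCoord p ((![u, v] : Fin 2 → TangentSpace _ p) i) (m i)) = 0 := by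
          intro i hi
          have : (fun t ↦ g.inChart e (polyCurve x t) fun i ↦
              tangentCoord p ((![u, v] : Fin 2 → TangentSpace _ p) i) (m i)) = fun _ ↦ 0 :=
            funext fun t ↦ ContinuousMultilinearMap.map_coord_zero _ i hi
          rw [this, taylorCoeff_zero_curve]
        -- Components of `u` of index less than `ν` vanish by induction; those of index greater than `ν`
        -- occur with a Taylor coefficient of negative degree.
        by_cases hm1 : m 1 = ν.rev
        · have hm0 : m 0 ≠ ν := fun h ↦ hm (by
            funext i
            fin_cases i
            · exact h
            · exact hm1)
          rcases lt_or_gt_of_ne hm0 with h | h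
          · exact hzero 0 (ih (m 0) (by rw [← hν]; exact h) (m 0) rfl)
          · have h3 : (r : ℤ) - ∑ i, ((m i : ℕ) : ℤ) < 0 := by
              have := ν.2
              have h4 : (ν : ℕ) < m 0 := h
              simp only [Fin.sum_univ_two, hm1, Fin.val_rev]
              omega
            rw [taylorCoeff, if_pos h3]
        · refine hzero 1 ?_
          change tangentCoord p v (m 1) = 0
          rw [hv, Pi.single_eq_of_ne hm1]
      · simp
  refine tangentCoord_injective p ?_
  rw [map_zero]
  funext ν
  exact key ν ν rfl

end TensorLift

/-! ### The lift of a contrast function -/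

section LiftedContrast

variable {E : Type*} [NormedAddCommGroup E] [NormedSpace ℝ E] [FiniteDimensional ℝ E]
  {M : Type*} [TopologicalSpace M] [ChartedSpace E M] [IsManifold 𝓘(ℝ, E) ∞ M] [T2Space M]
  {r : ℕ} {F : M × M → ℝ} {g : CovTensor E M 2}

/-- The rule `K^c(X^(r - a), Y^(r - b)) = (K(X, Y))^(r - a - b)` with the sign occurring in the
identities that define the induced metric and connection. -/
lemma lift_apply_lift_two (hg : g.IsSmooth) {X Y : Field E M} (hX : X.IsSmooth) (hY : Y.IsSmooth)
    {G : M × M → ℝ} (hG : SmoothPair E G) (hgG : ∀ x, g x ![X x, Y x] = -G (x, x)) (a b : ℕ)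
    (p : HigherTangent 𝓘(ℝ, E) r M) :
    g.lift r r p ![X.lift r ((r : ℤ) - a) p, Y.lift r ((r : ℤ) - b) p] =
      -pairLift E r (a + b) G (p, p) := by
  have hG' : SmoothPair E fun z ↦ 0 - G z := SmoothPair.sub contMDiff_const hG
  have h1 := CovTensor.lift_apply_lift hg (X := ![X, Y]) (by
    intro i
    fin_cases i
    · exact hX
    · exact hY) hG' (fun x ↦ by
      refine Eq.trans ?_ ((hgG x).trans (zero_sub _).symm)
      congr 1
      funext i
      fin_cases i <;> rfl) ![a, b] p
  rw [pairLift_sub contMDiff_const hG] at h1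
  simp only at h1
  rw [pairLift_diag_eq_zero (f := fun _ ↦ 0) (fun _ ↦ rfl), zero_sub] at h1
  simp only [Fin.sum_univ_two, Matrix.cons_val_zero, Matrix.cons_val_one] at h1
  rw [← h1]
  congr 1
  funext i
  fin_cases i <;> rfl

/-- The tensor induced by `F^c` is the complete lift of the metric induced by `F`. -/
lemma IsInducedMetric.eq_lift (hF : SmoothPair E F) (hg : g.IsSmooth) (hgF : IsInducedMetric F g)
    {g' : CovTensor (Fin (r + 1) → E) (HigherTangent 𝓘(ℝ, E) r M) 2}
    (hg' : IsInducedMetric (pairLift E r 0 F) g') : g' = g.lift r r := by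
  refine CovTensor.ext_of_lift fun X hX j p ↦ ?_
  have h1 : ∀ A : CovTensor (Fin (r + 1) → E) (HigherTangent 𝓘(ℝ, E) r M) 2,
      A p (fun i ↦ (X i).lift r ((r : ℤ) - j i) p) =
        A p ![(X 0).lift r ((r : ℤ) - j 0) p, (X 1).lift r ((r : ℤ) - j 1) p] := by
    intro A
    congr 1
    funext i
    fin_cases i <;> rfl
  rw [h1, h1, hg' _ _ ((hX 0).lift _) ((hX 1).lift _), bracket_lift_one_one hF (hX 0) (hX 1)]
  exact (lift_apply_lift_two hg (hX 0) (hX 1)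
    ((hF.along_rightField (hX 1)).along_leftField (hX 0)) (hgF _ _ (hX 0) (hX 1)) _ _ p).symm

/-- The first derivatives of `F^c` vanish along the diagonal: they do so in the directions of all
lifted vector fields on either factor. -/
lemma mvfderiv_pairLift_diag (hF : SmoothPair E F)
    (hd : ∀ x : M, mvfderiv (𝓘(ℝ, E).prod 𝓘(ℝ, E)) F (x, x) = 0)
    (p : HigherTangent 𝓘(ℝ, E) r M) :
    mvfderiv (𝓘(ℝ, Fin (r + 1) → E).prod 𝓘(ℝ, Fin (r + 1) → E)) (pairLift E r 0 F) (p, p) = 0 := by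
  let D : (Fin (r + 1) → E) × (Fin (r + 1) → E) →L[ℝ] ℝ :=
    mvfderiv (𝓘(ℝ, Fin (r + 1) → E).prod 𝓘(ℝ, Fin (r + 1) → E)) (pairLift E r 0 F) (p, p)
  have hl : ∀ u : Fin (r + 1) → E, D (u, 0) = 0 := by
    intro u
    obtain ⟨X, hX, hu⟩ := exists_eq_sum_lift p u
    have h1 : ∀ j, D ((X j).lift r ((r : ℤ) - ((j : Fin (r + 1)) : ℕ)) p, 0) = 0 := fun j ↦ by
      have h2 := congrFun (along_leftField_lift_pairLift (r := r) hF (hX j) 0 j) (p, p)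
      rw [pairLift_diag_eq_zero fun x ↦ DFunLike.congr_fun (hd x) _] at h2
      exact h2
    have h3 : D.comp (ContinuousLinearMap.inl ℝ _ _) u = 0 := by
      rw [hu]
      exact (map_sum (D.comp (ContinuousLinearMap.inl ℝ _ _)) _ _).trans
        (Finset.sum_eq_zero fun j _ ↦ h1 j)
    exact h3
  have hr : ∀ u : Fin (r + 1) → E, D (0, u) = 0 := by
    intro u
    obtain ⟨X, hX, hu⟩ := exists_eq_sum_lift p u
    have h1 : ∀ j, D (0, (X j).lift r ((r : ℤ) - ((j : Fin (r + 1)) : ℕ)) p) = 0 := fun j ↦ by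
      have h2 := congrFun (along_rightField_lift_pairLift (r := r) hF (hX j) 0 j) (p, p)
      rw [pairLift_diag_eq_zero fun x ↦ DFunLike.congr_fun (hd x) _] at h2
      exact h2
    have h3 : D.comp (ContinuousLinearMap.inr ℝ _ _) u = 0 := by
      rw [hu]
      exact (map_sum (D.comp (ContinuousLinearMap.inr ℝ _ _)) _ _).trans
        (Finset.sum_eq_zero fun j _ ↦ h1 j)
    exact h3
  change D = 0
  ext u
  · exact hl u
  · exact hr u

/-- The complete lift of a contrast function is a contrast function. -/
theorem IsContrast.pairLift (hF : IsContrast E F) :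
    IsContrast (Fin (r + 1) → E) (pairLift E r 0 F) := by
  obtain ⟨g, hg, hgF⟩ := hF.metric
  refine isContrast_of_nondegenerate (smoothPair_pairLift hF.smooth 0)
    (pairLift_diag_eq_zero hF.diag 0) (mvfderiv_pairLift_diag hF.smooth hF.diag_deriv)
    fun g' hg' p u hu ↦ ?_
  obtain rfl := IsInducedMetric.eq_lift hF.smooth hg.smooth hgF hg'
  exact lift_nondegenerate hg p u hu

lemma Connection.isSmooth_apply {D : Connection E M}
    (hD : CovariantDerivative.ContMDiffCovariantDerivative D ∞) {X Y : Field E M}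
    (hX : X.IsSmooth) (hY : Y.IsSmooth) : (D.apply X Y).IsSmooth := by
  have h1 := hD.contMDiff.contMDiff (σ := Y) (hY.of_le (by simp)).contMDiffOn
  rw [contMDiffOn_univ] at h1
  exact ContMDiff.clm_bundle_apply h1 hX

/-- Tangent vectors of `T^r M` are determined by their pairing, under the lifted metric, with lifted
vector fields. -/
lemma eq_of_forall_lift (hg : IsPseudoRiemannian g) {p : HigherTangent 𝓘(ℝ, E) r M}
    {u v : TangentSpace 𝓘(ℝ, Fin (r + 1) → E) p}
    (h : ∀ Z : Field E M, Z.IsSmooth → ∀ c : ℕ, g.lift r r p ![u, Z.lift r ((r : ℤ) - c) p] =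
      g.lift r r p ![v, Z.lift r ((r : ℤ) - c) p]) : u = v := by
  let L := fun a ↦ (g.lift r r p).toContinuousLinearMap ![a, 0] 1
  let K := fun b ↦ (g.lift r r p).toContinuousLinearMap ![0, b] 0
  have hL : ∀ a b, L a b = g.lift r r p ![a, b] := fun a b ↦ by
    refine congrArg (g.lift r r p) ?_
    funext i
    fin_cases i <;> rfl
  have hK : ∀ a b, K b a = g.lift r r p ![a, b] := fun a b ↦ by
    refine congrArg (g.lift r r p) ?_
    funext i
    fin_cases i <;> rfl
  refine sub_eq_zero.1 (lift_nondegenerate hg p _ fun w ↦ ?_)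
  rw [← hK, map_sub, hK, hK, ← hL, ← hL]
  obtain ⟨Z, hZ, rfl⟩ := exists_eq_sum_lift p w
  rw [map_sum, map_sum, sub_eq_zero]
  exact Finset.sum_congr rfl fun j _ ↦ by rw [hL, hL, h (Z j) (hZ j)]

/-- The connection induced by `F^c` is the complete lift of the one induced by `F`: both pair in the
same way with lifted vector fields. -/
lemma IsInducedConnection.isConnectionLift (hF : SmoothPair E F) (hg : IsPseudoRiemannian g)
    {D : Connection E M} (hDs : CovariantDerivative.ContMDiffCovariantDerivative D ∞)
    (hD : IsInducedConnection F g D)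
    {D' : Connection (Fin (r + 1) → E) (HigherTangent 𝓘(ℝ, E) r M)}
    (hD' : IsInducedConnection (pairLift E r 0 F) (g.lift r r) D') :
    IsConnectionLift r D D' := by
  intro X Y hX hY l m hl hm
  -- In terms of `a = r - l` and `b = r - m`, the index `l + m - r` is `r - (a + b)`.
  obtain ⟨a, ha⟩ : ∃ a : ℕ, (l : ℤ) = r - a := ⟨r - l, by omega⟩
  obtain ⟨b, hb⟩ : ∃ b : ℕ, (m : ℤ) = r - b := ⟨r - m, by omega⟩
  have hab : (r : ℤ) - a + (r - b) - r = r - ((a + b : ℕ) : ℤ) := by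
    push_cast
    ring
  rw [ha, hb, hab]
  funext p
  refine eq_of_forall_lift hg fun Z hZ c ↦ ?_
  rw [hD' _ _ _ (hX.lift a) (hY.lift b) (hZ.lift c), bracket_lift_two_one hF hX hY hZ]
  exact (lift_apply_lift_two hg.smooth (Connection.isSmooth_apply hDs hX hY) hZ
    (((hF.along_rightField hZ).along_leftField hY).along_leftField hX)
    (hD X Y Z hX hY hZ) (a + b) c p).symm

/-- The skewness tensor of `F^c` is the complete lift of the one of `F`. -/
lemma skewness_eq_lift (hF : SmoothPair E F) {T : CovTensor E M 3} (hT : T.IsSmooth)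
    (hTF : ∀ X Y Z : Field E M, X.IsSmooth → Y.IsSmooth → Z.IsSmooth → ∀ x : M,
      T x ![X x, Y x, Z x] = bracket (fun z ↦ F z - F z.swap) [X] [Y, Z] (x, x))
    {T' : CovTensor (Fin (r + 1) → E) (HigherTangent 𝓘(ℝ, E) r M) 3}
    (hT' : ∀ X Y Z : Field (Fin (r + 1) → E) (HigherTangent 𝓘(ℝ, E) r M),
      X.IsSmooth → Y.IsSmooth → Z.IsSmooth → ∀ p, T' p ![X p, Y p, Z p] =
        bracket (fun z ↦ pairLift E r 0 F z - pairLift E r 0 F z.swap) [X] [Y, Z] (p, p)) :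
    T' = T.lift r r := by
  have hs : SmoothPair E fun z ↦ F z - F z.swap := hF.sub hF.swap
  have hG : (fun z ↦ pairLift E r 0 F z - pairLift E r 0 F z.swap) =
      pairLift E r 0 fun z : M × M ↦ F z - F z.swap :=
    (pairLift_sub hF hF.swap 0).symm
  rw [hG] at hT'
  refine CovTensor.ext_of_lift fun X hX j p ↦ ?_
  have h1 : (fun i ↦ (X i).lift r ((r : ℤ) - j i) p) =
      ![(X 0).lift r ((r : ℤ) - j 0) p, (X 1).lift r ((r : ℤ) - j 1) p,
        (X 2).lift r ((r : ℤ) - j 2) p] := by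
    funext i
    fin_cases i <;> rfl
  rw [CovTensor.lift_apply_lift hT hX
    (((hs.along_rightField (hX 2)).along_rightField (hX 1)).along_leftField (hX 0)) (fun x ↦ by
      refine Eq.trans ?_ (hTF (X 0) (X 1) (X 2) (hX 0) (hX 1) (hX 2) x)
      congr 1
      funext i
      fin_cases i <;> rfl) j p, Fin.sum_univ_three]
  refine (congrArg (T' p) h1).trans ?_
  rw [hT' _ _ _ ((hX 0).lift _) ((hX 1).lift _) ((hX 2).lift _),
    bracket_lift_one_two hs (hX 0) (hX 1) (hX 2)]
  rfl

end LiftedContrast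

end ContrastLift

end

open ContrastLift
theorem mainTheorem1 {E : Type*} [NormedAddCommGroup E] [NormedSpace ℝ E] [FiniteDimensional ℝ E]
    {M : Type*} [TopologicalSpace M] [ChartedSpace E M] [IsManifold 𝓘(ℝ, E) ∞ M] [T2Space M]
    (r : ℕ) (F : C^∞⟮𝓘(ℝ, E).prod 𝓘(ℝ, E), M × M; 𝓘(ℝ, ℝ), ℝ⟯) (hF : IsContrast E F) :
    IsContrast (Fin (r + 1) → E) (contrastLift r F) ∧
    (∃ S : StatisticalData E M, S.IsInducedBy F) ∧
    (∃ S' : StatisticalData (Fin (r + 1) → E) (HigherTangent 𝓘(ℝ, E) r M),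
      S'.IsInducedBy (contrastLift r F)) ∧
    ∀ (S : StatisticalData E M)
      (S' : StatisticalData (Fin (r + 1) → E) (HigherTangent 𝓘(ℝ, E) r M)),
      S.IsInducedBy F → S'.IsInducedBy (contrastLift r F) →
        S'.metric = S.metric.lift r r ∧
        IsConnectionLift r S.conn S'.conn ∧
        IsConnectionLift r S.dual S'.dual ∧
        S'.skewness = S.skewness.lift r r := by
  rw [contrastLift_eq_pairLift]
  have hs : SmoothPair E F := hF.smooth
  have hFc : IsContrast (Fin (r + 1) → E) (pairLift E r 0 F) := hF.pairLift
  refine ⟨hFc, hF.exists_isInducedBy, hFc.exists_isInducedBy, fun S S' hS hS' ↦ ?_⟩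
  have hg := hS.pseudoRiemannian
  have hm : S'.metric = S.metric.lift r r :=
    IsInducedMetric.eq_lift hs hg.smooth hS.metric_eq hS'.metric_eq
  have hdual := (isInducedConnection_swap_iff hs hg hS.metric_eq hS.conn_eq).2 hS.dual_eq
  have hdual' := (isInducedConnection_swap_iff (smoothPair_pairLift hs 0) hS'.pseudoRiemannian
    hS'.metric_eq hS'.conn_eq).2 hS'.dual_eq
  have hconn' := hS'.conn_eq
  rw [hm] at hdual' hconn'
  exact ⟨hm, IsInducedConnection.isConnectionLift hs hg hS.conn_smooth hS.conn_eq hconn',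
    IsInducedConnection.isConnectionLift hs.swap hg hS.dual_smooth hdual hdual',
    skewness_eq_lift hs hS.skewness_smooth hS.skewness_eq hS'.skewness_eq⟩
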